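/- **Notation.** Let $\mathsf h\in\mathbb C$. The superalgebra $osp(1|2)$ has generators $h$ (even) and $e,f$ (odd) with $[h,e]=e$, $[h,f]=-f$, $\{e,f\}=-h$; put $b_+=e^2$, $b_-=-f^2$. For $j\in\{0,\frac12,1,\dots\}$ let $V_j$ have basis $|j\,m\rangle$, $m=j,j-\frac12,\dots,-j$. Put $[x]_q=\frac{q^x-q^{-x}}{q-q^{-1}}$, $[[x]]_q=\frac{q^x-(-1)^{2x}q^{-x}}{q^{1/2}+q^{-1/2}}$ and $E_q(x)=\sum_{n\ge0}x^n/[n]_q!$. The standard $q$-deformed algebra acts on $V_j$ by $\hat h|j\,m\rangle=2m|j\,m\rangle$, $\hat e|j\,m\rangle=|j\,m+\frac12\rangle$ ($\hat e|j\,j\rangle=0$), and $\hat f|j\,m\rangle=-[j+m]_q[[j-m+\frac12]]_q|j\,m-\frac12\rangle$ if $j-m\in\mathbb Z$, $\hat f|j\,m\rangle=[[j+m]]_q[j-m+\frac12]_q|j\,m-\frac12\rangle$ otherwise. On $V_{1/2}\otimes V_j$ (as a $3\times3$ matrix of operators on $V_j$), with $\omega=q-q^{-1}$, $$R_q^{\frac12;j}=\begin{pmatrix}q^{\hat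 h}&-\omega q^{\hat h/2}\hat f&-\omega(1+q^{-1})\hat f^2\\0&1&\omega q^{-(\hat h+1)/2}\hat f\\0&0&q^{-\hat h}\end{pmatrix},\qquad M_j=E_{q^2}(\eta\hat e^2)\big|_{V_j},\quad \eta=\frac{\mathsf h}{q^2-1}.$$ Powers $u^\alpha$ of a unipotent element $u$ (that is, $u-1$ nilpotent) are given by the binomial series. **Limit.** For every $j$, as $q\to1$ ($q\in\mathbb C\setminus\{1\}$, principal branches), the operators $\hat e,\hat f,\hat h$ tend to operators $e,f,h$ on $V_j$, which satisfy the relations of $osp(1|2)$, and $e$ is nilpotent. Let $\tilde T^{\pm1}=\pm\mathsf h e^2+\sqrt{1+\mathsf h^2e^4}$ and $\tilde H=\frac12(\tilde T+\tilde T^{-1})h$. Then $\tilde T$ is unipotent with inverse $\tilde T^{-1}$, $\tilde T-\tilde T^{-1}=2\mathsf h e^2$, $\tilde H=\sqrt{1+\mathsf h^2e^4}\,h$, and $\lim_{q\to1}E_{q^2}(\eta\hat e^2)^{-1}E_{q^2}(q^{2\alpha}\eta\hat e^2)=\tilde T^{\alpha}$ for all $\alpha\in\mathbb C$. The limit of the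 transformed $R$-matrix exists and is $$\lim_{q\to1}(M_{1/2}^{-1}\otimes M_j^{-1})R_q^{\frac12;j}(M_{1/2}\otimes M_j)=\tilde R_{\mathsf h}^{\frac12;j}=\begin{pmatrix}\tilde T&\mathsf h\tilde T^{1/2}e&-\mathsf h\tilde H+\frac{\mathsf h}4(\tilde T-\tilde T^{-1})\\0&1&-\mathsf h\tilde T^{-1/2}e\\0&0&\tilde T^{-1}\end{pmatrix}.$$ **Map and $L$-operator.** Let $\mathsf h\ne0$. Let $\mathcal U_{\mathsf h}(osp(1|2))$ be the algebra with generators $H,E,F,Y,T^{\pm1/2}$ ($T^{1/2}T^{-1/2}=T^{-1/2}T^{1/2}=1$, $T^{\pm1}=(T^{\pm1/2})^2$) and relations $[H,E]=\frac12(T+T^{-1})E$, $[H,F]=-\frac14(T+T^{-1})F-\frac14F(T+T^{-1})$, $\{E,F\}=-H$, $[H,T^{\pm1}]=T^{\pm2}-1$, $[H,Y]=-\frac12(T+T^{-1})Y-\frac12Y(T+T^{-1})-\frac{\mathsf h}4E(T-T^{-1})F+\frac{\mathsf h}4F(T-T^{-1})E$, $[T^{\pm1},Y]=\pm\frac{\mathsf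 h}2(T^{\pm1}H+HT^{\pm1})$, $E^2=\frac{T-T^{-1}}{2\mathsf h}$, $F^2=-Y$, $[T^{\pm1},F]=\pm\mathsf hT^{\pm1}E$, $[Y,E]=\frac14(T+T^{-1})F+\frac14F(T+T^{-1})$, together with the relations for the square root of $T$: $[T^{1/2},E]=0$, $[H,T^{1/2}]=\frac12(T^{3/2}-T^{-1/2})$, $[T^{1/2},F]=\frac{\mathsf h}2T^{1/2}E$. For every associative $\mathbb C$-algebra $A$, the map $$E=e,\quad H=\tilde H,\quad F=f+\frac{\mathsf h}4\frac{\tilde T-1}{\tilde T+1}e-\frac{\mathsf h}2\frac{\tilde T-1}{\tilde T+1}eh,\quad T^{\pm1/2}=\tilde T^{\pm1/2},\quad Y=-F^2$$ is a bijection from the triples $(e,f,h)$ in $A$ that satisfy the relations of $osp(1|2)$ with $e$ nilpotent onto the tuples $(H,E,F,Y,T^{\pm1/2})$ in $A$ that satisfy the relations of $\mathcal U_{\mathsf h}(osp(1|2))$ with $E$ nilpotent and $T^{1/2}$ unipotent. In particular each $V_j$ becomes, through this map, a representation of $\mathcal U_{\mathsf h}(osp(1|2))$, and $\tilde R_{\mathsf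 h}^{\frac12;j}$ is the image in this representation of $$L=\begin{pmatrix}T&\mathsf hT^{1/2}E&-\mathsf hH+\frac{\mathsf h}4(T-T^{-1})\\0&1&-\mathsf hT^{-1/2}E\\0&0&T^{-1}\end{pmatrix}.$$ **FRT.** Let $\mathcal B_{\mathsf h}$ be the algebra with generators $H,E,T^{\pm1/2}$ and those of the above relations that contain neither $F$ nor $Y$. The natural map $\mathcal B_{\mathsf h}\to\mathcal U_{\mathsf h}(osp(1|2))$ is injective, so $\mathcal B_{\mathsf h}$ is the Borel subalgebra. With $R=\tilde R_{\mathsf h}^{\frac12;\frac12}$ and the graded tensor product $(B\otimes C)_{ik,jl}=(-1)^{[k]([i]+[j])}B_{ij}C_{kl}$, $[1]=[3]=0$, $[2]=1$, consider $$R\,L_1L_2=L_2L_1R,\qquad L_1=L\otimes1,\quad L_2=1\otimes L.\qquad(*)$$ The matrix $L$ over $\mathcal B_{\mathsf h}$ satisfies $(*)$. For elements $H,E,T^{\pm1/2}$ of any $\mathbb C$-algebra $A$, with $T^{\pm1/2}$ mutually inverse and $T^{1/2}$ commuting with everything that commutes with $T$, equation $(*)$ holds if and only if $[H,E]=\frac12(T+T^{-1})E$,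 $[H,T^{\pm1}]=T^{\pm2}-1$, $E^2=\frac{T-T^{-1}}{2\mathsf h}$ and $[T,E]=0$; equivalently, if and only if there is an algebra homomorphism $\mathcal B_{\mathsf h}\to A$ that maps the generators to the given elements. Moreover $L$ is invertible over $\mathcal B_{\mathsf h}$ with $$L^{-1}=\begin{pmatrix}T^{-1}&-\mathsf hT^{-1/2}E&\mathsf hH+\frac{\mathsf h}4(T-T^{-1})\\0&1&\mathsf hT^{1/2}E\\0&0&T\end{pmatrix},$$ and $\mathcal B_{\mathsf h}$ ($E$ odd, the other generators even) has exactly one Hopf superalgebra structure with $\Delta(L_{ij})=\sum_kL_{ik}\otimes L_{kj}$, $\Delta(T^{1/2})=T^{1/2}\otimes T^{1/2}$, $\varepsilon(L)=1$, $S(L)=L^{-1}$. It is given by $\Delta(H)=H\otimes T^{-1}+T\otimes H+\mathsf hET^{1/2}\otimes ET^{-1/2}$, $\Delta(E)=E\otimes T^{-1/2}+T^{1/2}\otimes E$, $\Delta(T^{\pm1})=T^{\pm1}\otimes T^{\pm1}$, $\varepsilon(H)=\varepsilon(E)=0$, $\varepsilon(T^{\pm1})=1$, $S(H)=-H-\mathsf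 hE^2$, $S(E)=-E$, $S(T^{\pm1})=T^{\mp1}$. -/

import Mathlib

open scoped TensorProduct
open Filter Topology

universe u

noncomputable section

namespace SuperJordanian

/-! Throughout, `p` is the deformation parameter, written `𝗁` in the comments, and `h` is the Cartan
generator of `osp(1|2)`. -/

/-! ### Functions of unipotent elements -/

section Unipotent

variable {A : Type u} [Ring A] [Algebra ℂ A]

/-- The generalized binomial coefficient `a (a-1) ⋯ (a-k+1) / k!`. -/
def binom (a : ℂ) (k : ℕ) : ℂ := (∏ i ∈ Finset.range k, (a - i)) / (k.factorial : ℂ)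

/-- The power `u ^ a` of a unipotent element `u` (`u - 1` nilpotent), given by the binomial series
`∑ₖ binom a k (u - 1)ᵏ`, which terminates. -/
def unipPow (a : ℂ) (u : A) : A :=
  ∑ k ∈ Finset.range (nilpotencyClass (u - 1)), binom a k • (u - 1) ^ k

/-- `T̃ = 𝗁 e² + √(1 + 𝗁² e⁴)` (for nilpotent `e`). -/
def tT (p : ℂ) (e : A) : A := p • e ^ 2 + unipPow (1 / 2) (1 + p ^ 2 • e ^ 4)

/-- `T̃⁻¹ = -𝗁 e² + √(1 + 𝗁² e⁴)` (for nilpotent `e`). -/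
def tTinv (p : ℂ) (e : A) : A := -(p • e ^ 2) + unipPow (1 / 2) (1 + p ^ 2 • e ^ 4)

/-- `H̃ = ½ (T̃ + T̃⁻¹) h`. -/
def tH (p : ℂ) (e h : A) : A := (1 / 2 : ℂ) • ((tT p e + tTinv p e) * h)

end Unipotent

/-! ### The classical superalgebra `osp(1|2)` and the super-Jordanian algebra: generators and
relations -/

/-- Three elements of an algebra, in the roles of the generators `e, f, h` of `osp(1|2)`. -/
@[ext]
structure OspGens (A : Type u) where
  e : A
  f : A
  h : A

/-- Elements of an algebra in the roles of the generators `H, E, F, Y` and `K = T^{1/2}`,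
`Ki = T^{-1/2}` of the super-Jordanian algebra. -/
@[ext]
structure JordanGens (A : Type u) where
  H : A
  E : A
  F : A
  Y : A
  K : A
  Ki : A

section Relations

variable {A : Type u} [Ring A] [Algebra ℂ A]

/-- The relations of `osp(1|2)`, with `b₊ = e²` and `b₋ = -f²`. -/
structure OspGens.IsOsp (g : OspGens A) : Prop where
  he : g.h * g.e - g.e * g.h = g.e
  hf : g.h * g.f - g.f * g.h = -g.f
  ef : g.e * g.f + g.f * g.e = -g.h
  hbp : g.h * g.e ^ 2 - g.e ^ 2 * g.h = 2 * g.e ^ 2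
  hbm : g.h * (-g.f ^ 2) - (-g.f ^ 2) * g.h = -(2 * (-g.f ^ 2))
  bpbm : g.e ^ 2 * (-g.f ^ 2) - (-g.f ^ 2) * g.e ^ 2 = g.h
  bpf : g.e ^ 2 * g.f - g.f * g.e ^ 2 = g.e
  bme : (-g.f ^ 2) * g.e - g.e * (-g.f ^ 2) = g.f

/-- The defining relations `(lhs, rhs)` of the Borel part of the super-Jordanian algebra, generated
by `H, E` and `K = T^{1/2}`, `Ki = T^{-1/2}`; here `T = K²`, `T⁻¹ = Ki²`.  The last two relations
express that `T^{1/2}` is a function of `T`, and `T` a function of `E²`. -/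
def borelRels (p : ℂ) (H E K Ki : A) : List (A × A) :=
  [ (H * E - E * H, (1 / 2 : ℂ) • ((K ^ 2 + Ki ^ 2) * E)),
    (H * K ^ 2 - K ^ 2 * H, (K ^ 2) ^ 2 - 1),
    (H * Ki ^ 2 - Ki ^ 2 * H, (Ki ^ 2) ^ 2 - 1),
    (E ^ 2, (2 * p)⁻¹ • (K ^ 2 - Ki ^ 2)),
    (K * Ki, 1),
    (Ki * K, 1),
    (K * E, E * K),
    (H * K - K * H, (1 / 2 : ℂ) • (K ^ 3 - Ki)) ]

/-- The remaining defining relations of the super-Jordanian algebra, those that contain `F` or `Y`;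
the last one is the consequence for `T^{1/2}` of `[T, F] = 𝗁 T E`. -/
def jordanExtraRels (p : ℂ) (g : JordanGens A) : List (A × A) :=
  let T := g.K ^ 2
  let Ti := g.Ki ^ 2
  [ (g.H * g.F - g.F * g.H,
      -((1 / 4 : ℂ) • ((T + Ti) * g.F)) - (1 / 4 : ℂ) • (g.F * (T + Ti))),
    (g.E * g.F + g.F * g.E, -g.H),
    (g.H * g.Y - g.Y * g.H,
      -((1 / 2 : ℂ) • ((T + Ti) * g.Y)) - (1 / 2 : ℂ) • (g.Y * (T + Ti))
        - (p / 4) • (g.E * (T - Ti) * g.F) + (p / 4) • (g.F * (T - Ti) * g.E)),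
    (T * g.Y - g.Y * T, (p / 2) • (T * g.H + g.H * T)),
    (Ti * g.Y - g.Y * Ti, -((p / 2) • (Ti * g.H + g.H * Ti))),
    (g.F ^ 2, -g.Y),
    (T * g.F - g.F * T, p • (T * g.E)),
    (Ti * g.F - g.F * Ti, -(p • (Ti * g.E))),
    (g.Y * g.E - g.E * g.Y,
      (1 / 4 : ℂ) • ((T + Ti) * g.F) + (1 / 4 : ℂ) • (g.F * (T + Ti))),
    (g.K * g.F - g.F * g.K, (p / 2) • (g.K * g.E)) ]

/-- All defining relations of the super-Jordanian algebra `𝒰_𝗁(osp(1|2))`. -/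
def jordanRels (p : ℂ) (g : JordanGens A) : List (A × A) :=
  borelRels p g.H g.E g.K g.Ki ++ jordanExtraRels p g

/-- The tuple `g` satisfies the relations of the super-Jordanian algebra `𝒰_𝗁(osp(1|2))`. -/
def JordanGens.IsJordan (p : ℂ) (g : JordanGens A) : Prop := ∀ r ∈ jordanRels p g, r.1 = r.2

/-- The nonlinear map expressing the super-Jordanian generators through classical ones. -/
def contrMap (p : ℂ) (g : OspGens A) : JordanGens A :=
  let T := tT p g.e
  let W := (T - 1) * Ring.inverse (T + 1)
  let F := g.f + (p / 4) • (W * g.e) - (p / 2) • (W * g.e * g.h)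
  { H := tH p g.e g.h
    E := g.e
    F := F
    Y := -F ^ 2
    K := unipPow (1 / 2) T
    Ki := unipPow (-1 / 2) T }

/-- The `L`-matrix in the generators `H, E, K = T^{1/2}, Ki = T^{-1/2}`. -/
def Lmat (p : ℂ) (H E K Ki : A) : Matrix (Fin 3) (Fin 3) A :=
  !![K ^ 2, p • (K * E), -(p • H) + (p / 4) • (K ^ 2 - Ki ^ 2);
     0,     1,           -(p • (Ki * E));
     0,     0,           Ki ^ 2]

/-- The explicit inverse of the `L`-matrix. -/
def LmatInv (p : ℂ) (H E K Ki : A) : Matrix (Fin 3) (Fin 3) A :=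
  !![Ki ^ 2, -(p • (Ki * E)), p • H + (p / 4) • (K ^ 2 - Ki ^ 2);
     0,      1,               p • (K * E);
     0,      0,               K ^ 2]

end Relations

/-! ### The irreducible representations of spin `j = n / 2`, of dimension `4 j + 1 = 2 n + 1`

The basis vector with index `k` is `|j m⟩` with `m = j - k / 2`; its weight `2 m` is `n - k`. -/

/-- Square matrices of size `4 j + 1`, `j = n / 2`. -/
abbrev Mat (n : ℕ) : Type := Matrix (Fin (2 * n + 1)) (Fin (2 * n + 1)) ℂ

/-- The weight `2 m` of the basis vector `|j m⟩` with index `k`. -/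
def weight (n : ℕ) (k : Fin (2 * n + 1)) : ℤ := (n : ℤ) - (k : ℕ)

/-- `e |j m⟩ = |j m + 1/2⟩`, which is the same for the classical and for the `q`-deformed algebra. -/
def repE (n : ℕ) : Mat n := Matrix.of fun i k => if (i : ℕ) + 1 = k then 1 else 0

/-- The classical `h |j m⟩ = 2 m |j m⟩`. -/
def repH (n : ℕ) : Mat n := Matrix.diagonal fun k => (weight n k : ℂ)

/-- The classical `f`: `f |j m⟩ = -(j + m) |j m - 1/2⟩` if `j - m` is an integer, and
`f |j m⟩ = (j - m + 1/2) |j m - 1/2⟩` otherwise. -/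
def repF (n : ℕ) : Mat n := Matrix.of fun i k =>
  if (i : ℕ) = k + 1 then
    if Even (k : ℕ) then -(((2 * n - k : ℤ) / 2 : ℤ) : ℂ) else ((((k : ℤ) + 1) / 2 : ℤ) : ℂ)
  else 0

/-- The classical spin `n / 2` representation. -/
def repOsp (n : ℕ) : OspGens (Mat n) := ⟨repE n, repF n, repH n⟩

/-- `q^{1/2}` (principal branch; only `q` near `1` matters). -/
def qHalf (q : ℂ) : ℂ := q ^ (1 / 2 : ℂ)

/-- `[x]_q = (q^x - q^{-x}) / (q - q⁻¹)` for an integer `x`. -/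
def qNum (q : ℂ) (x : ℤ) : ℂ := (q ^ x - q ^ (-x)) / (q - q⁻¹)

/-- `[[t/2]]_q = (q^{t/2} - (-1)^t q^{-t/2}) / (q^{1/2} + q^{-1/2})` for an integer `t`. -/
def qNum2 (q : ℂ) (t : ℤ) : ℂ :=
  (qHalf q ^ t - (-1) ^ t * qHalf q ^ (-t)) / (qHalf q + (qHalf q)⁻¹)

/-- `f̂` on the spin `n / 2` representation of the standard `q`-deformed algebra:
`f̂ |j m⟩ = -[j + m]_q [[j - m + 1/2]]_q |j m - 1/2⟩` if `j - m = k / 2` is an integer, and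
`f̂ |j m⟩ = [[j + m]]_q [j - m + 1/2]_q |j m - 1/2⟩` otherwise. -/
def repFq (n : ℕ) (q : ℂ) : Mat n := Matrix.of fun i k =>
  if (i : ℕ) = k + 1 then
    if Even (k : ℕ) then -(qNum q ((2 * n - k : ℤ) / 2) * qNum2 q ((k : ℤ) + 1))
    else qNum2 q (2 * n - k : ℤ) * qNum q (((k : ℤ) + 1) / 2)
  else 0

/-- The diagonal operator `q^{(a ĥ + b) / 2}`. -/
def repQH (n : ℕ) (q : ℂ) (a b : ℤ) : Mat n :=
  Matrix.diagonal fun k => qHalf q ^ (a * weight n k + b)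

/-- An operator-valued `3 × 3` matrix, as an operator on `V_{1/2} ⊗ V_j`: the block `(i, k)` maps
`v_k ⊗ w` to `v_i ⊗ B i k w`. -/
def blocks {n : ℕ} (B : Matrix (Fin 3) (Fin 3) (Mat n)) :
    Matrix (Fin 3 × Fin (2 * n + 1)) (Fin 3 × Fin (2 * n + 1)) ℂ :=
  Matrix.of fun x y => B x.1 y.1 x.2 y.2

/-- The standard matrix `R_q^{1/2;j}`, `j = n / 2`. -/
def Rq (n : ℕ) (q : ℂ) : Matrix (Fin 3 × Fin (2 * n + 1)) (Fin 3 × Fin (2 * n + 1)) ℂ :=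
  blocks
    !![repQH n q 2 0, -((q - q⁻¹) • (repQH n q 1 0 * repFq n q)),
          -(((q - q⁻¹) * (1 + q⁻¹)) • repFq n q ^ 2);
       0, 1, (q - q⁻¹) • (repQH n q (-1) (-1) * repFq n q);
       0, 0, repQH n q (-2) 0]

/-- `[n]_q! = [n]_q ⋯ [1]_q`. -/
def qFact (q : ℂ) (n : ℕ) : ℂ := ∏ i ∈ Finset.range n, qNum q ((i : ℤ) + 1)

/-- The deformed exponential `E_q(x) = ∑ₙ xⁿ / [n]_q!` of a nilpotent matrix. -/
def qExp {n : ℕ} (q : ℂ) (x : Mat n) : Mat n :=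
  ∑ k ∈ Finset.range (nilpotencyClass x), (qFact q k)⁻¹ • x ^ k

/-- The singular transforming matrix `M_j = E_{q²}(𝗁 ê² / (q² - 1))`, `j = n / 2`. -/
def Mtrans (n : ℕ) (p q : ℂ) : Mat n := qExp (q ^ 2) ((p / (q ^ 2 - 1)) • repE n ^ 2)

/-- `𝒯_(α) = E_{q²}(η ê²)⁻¹ E_{q²}(q^{2α} η ê²)` with `η = 𝗁 / (q² - 1)`. -/
def calT (n : ℕ) (p q α : ℂ) : Mat n :=
  (Mtrans n p q)⁻¹ * qExp (q ^ 2) ((q ^ (2 * α) * (p / (q ^ 2 - 1))) • repE n ^ 2)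

/-- `(M_{1/2}⁻¹ ⊗ M_j⁻¹) R_q^{1/2;j} (M_{1/2} ⊗ M_j)`.  The operators `M` are even, so no sign enters
their graded tensor product. -/
def RqTransformed (n : ℕ) (p q : ℂ) :
    Matrix (Fin 3 × Fin (2 * n + 1)) (Fin 3 × Fin (2 * n + 1)) ℂ :=
  Matrix.kronecker (Mtrans 1 p q)⁻¹ (Mtrans n p q)⁻¹ * Rq n q *
    Matrix.kronecker (Mtrans 1 p q) (Mtrans n p q)

/-- The operator-valued `3 × 3` matrix that is the limit `R̃_𝗁^{1/2;j}`, in terms of the classical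
generators. -/
def contRBlocks (n : ℕ) (p : ℂ) : Matrix (Fin 3) (Fin 3) (Mat n) :=
  let e := repE n
  let T := tT p e
  let Ti := tTinv p e
  !![T, p • (unipPow (1 / 2) T * e), -(p • tH p e (repH n)) + (p / 4) • (T - Ti);
     0, 1,                           -(p • (unipPow (-1 / 2) T * e));
     0, 0,                           Ti]

/-- The matrix `R̃_𝗁^{1/2;j}`, `j = n / 2`. -/
def contR (n : ℕ) (p : ℂ) : Matrix (Fin 3 × Fin (2 * n + 1)) (Fin 3 × Fin (2 * n + 1)) ℂ :=
  blocks (contRBlocks n p)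

/-! ### The graded `RLL` relations -/

section RLL

variable {A : Type u} [Ring A] [Algebra ℂ A]

/-- Parities of the basis of the fundamental representation: the extremal vectors are even and the
middle one is odd. -/
def par (i : Fin 3) : ℕ := if i = 1 then 1 else 0

/-- The `ℤ₂`-graded tensor product of matrices,
`(B ⊗ C)_{ik,jl} = (-1)^{[k]([i]+[j])} B_{ij} C_{kl}`. -/
def gKron (B C : Matrix (Fin 3) (Fin 3) A) : Matrix (Fin 3 × Fin 3) (Fin 3 × Fin 3) A :=
  Matrix.of fun x y => (-1) ^ (par x.2 * (par x.1 + par y.1)) * (B x.1 y.1 * C x.2 y.2)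

/-- `R₁₂ L₁ L₂ = L₂ L₁ R₁₂` with `R = R_𝗁^{1/2;1/2}`, `L₁ = L ⊗ 1` and `L₂ = 1 ⊗ L`. -/
def RLL (p : ℂ) (L : Matrix (Fin 3) (Fin 3) A) : Prop :=
  let R : Matrix (Fin 3 × Fin 3) (Fin 3 × Fin 3) A := (contR 1 p).map (algebraMap ℂ A)
  R * gKron L 1 * gKron 1 L = gKron 1 L * gKron L 1 * R

end RLL

/-! ### The algebras, as quotients of free algebras -/

/-- The `ℂ`-algebra with generators `X` and the relations `lhs = rhs` for `(lhs, rhs)` in a list. -/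
def Presented (X : Type) (rels : List (FreeAlgebra ℂ X × FreeAlgebra ℂ X)) : Type :=
  RingQuot fun x y : FreeAlgebra ℂ X => (x, y) ∈ rels

namespace Presented

variable {X : Type} {rels : List (FreeAlgebra ℂ X × FreeAlgebra ℂ X)}

instance : Ring (Presented X rels) :=
  inferInstanceAs (Ring (RingQuot fun x y : FreeAlgebra ℂ X => (x, y) ∈ rels))

instance : Algebra ℂ (Presented X rels) :=
  inferInstanceAs (Algebra ℂ (RingQuot fun x y : FreeAlgebra ℂ X => (x, y) ∈ rels))

variable (rels) in
/-- The quotient map. -/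
def mk : FreeAlgebra ℂ X →ₐ[ℂ] Presented X rels :=
  RingQuot.mkAlgHom ℂ fun x y : FreeAlgebra ℂ X => (x, y) ∈ rels

theorem mk_rel {r : FreeAlgebra ℂ X × FreeAlgebra ℂ X} (hr : r ∈ rels) :
    mk rels r.1 = mk rels r.2 :=
  RingQuot.mkAlgHom_rel ℂ (s := fun x y : FreeAlgebra ℂ X => (x, y) ∈ rels) hr

/-- The universal property. -/
def lift {A : Type u} [Ring A] [Algebra ℂ A] (f : X → A)
    (hf : ∀ r ∈ rels, FreeAlgebra.lift ℂ f r.1 = FreeAlgebra.lift ℂ f r.2) :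
    Presented X rels →ₐ[ℂ] A :=
  RingQuot.liftAlgHom ℂ (s := fun x y : FreeAlgebra ℂ X => (x, y) ∈ rels)
    ⟨FreeAlgebra.lift ℂ f, fun _ _ h => hf _ h⟩

theorem lift_mk {A : Type u} [Ring A] [Algebra ℂ A] (f : X → A)
    (hf : ∀ r ∈ rels, FreeAlgebra.lift ℂ f r.1 = FreeAlgebra.lift ℂ f r.2) (g : X) :
    lift f hf (mk rels (FreeAlgebra.ι ℂ g)) = f g := by
  have h := RingQuot.liftAlgHom_mkAlgHom_apply ℂ (FreeAlgebra.lift ℂ f)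
    (s := fun x y : FreeAlgebra ℂ X => (x, y) ∈ rels) (fun _ _ h => hf _ h) (FreeAlgebra.ι ℂ g)
  rw [FreeAlgebra.lift_ι_apply] at h
  exact h

theorem hom_ext {A : Type u} [Ring A] [Algebra ℂ A] {φ ψ : Presented X rels →ₐ[ℂ] A}
    (h : ∀ g, φ (mk rels (FreeAlgebra.ι ℂ g)) = ψ (mk rels (FreeAlgebra.ι ℂ g))) : φ = ψ := by
  have key : φ.comp (mk rels) = ψ.comp (mk rels) := by
    apply FreeAlgebra.hom_ext
    funext g
    exact h g
  ext x
  obtain ⟨y, rfl⟩ := RingQuot.mkAlgHom_surjective ℂ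
    (fun x y : FreeAlgebra ℂ X => (x, y) ∈ rels) x
  exact DFunLike.congr_fun key y

end Presented

/-- The generators of the super-Jordanian algebra. -/
inductive UGen | H | E | F | Y | K | Ki

/-- The image of a tuple of generators under a map. -/
def JordanGens.map {A : Type*} {B : Type*} (φ : A → B) (g : JordanGens A) : JordanGens B :=
  ⟨φ g.H, φ g.E, φ g.F, φ g.Y, φ g.K, φ g.Ki⟩

/-- The generators in the free algebra. -/
def freeU : JordanGens (FreeAlgebra ℂ UGen) :=
  JordanGens.map (FreeAlgebra.ι ℂ) ⟨.H, .E, .F, .Y, .K, .Ki⟩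

/-- The relations of the super-Jordanian algebra, in the free algebra. -/
def freeJordanRels (p : ℂ) : List (FreeAlgebra ℂ UGen × FreeAlgebra ℂ UGen) := jordanRels p freeU

/-- The super-Jordanian algebra `𝒰_𝗁(osp(1|2))` (with `T^{±1/2}` among the generators). -/
abbrev Uh (p : ℂ) : Type := Presented UGen (freeJordanRels p)

/-- The generators of `𝒰_𝗁(osp(1|2))`. -/
def Uh.gens (p : ℂ) : JordanGens (Uh p) := freeU.map (Presented.mk _)

/-- The generators of the Borel algebra. -/
inductive BGen | H | E | K | Ki

/-- The Borel part of the super-Jordanian relations, in the free algebra. -/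
def freeBorelRels (p : ℂ) : List (FreeAlgebra ℂ BGen × FreeAlgebra ℂ BGen) :=
  borelRels p (FreeAlgebra.ι ℂ .H) (FreeAlgebra.ι ℂ .E) (FreeAlgebra.ι ℂ .K) (FreeAlgebra.ι ℂ .Ki)

/-- The algebra generated by `H, E, T^{±1/2}` with the Borel part of the super-Jordanian
relations. -/
abbrev Borel (p : ℂ) : Type := Presented BGen (freeBorelRels p)

namespace Borel

/-- The image of a generator in the Borel algebra. -/
def gen (p : ℂ) (g : BGen) : Borel p := Presented.mk _ (FreeAlgebra.ι ℂ g)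

/-- The generator `H`. -/
def H (p : ℂ) : Borel p := gen p .H
/-- The generator `E`. -/
def E (p : ℂ) : Borel p := gen p .E
/-- The generator `T^{1/2}`. -/
def K (p : ℂ) : Borel p := gen p .K
/-- The generator `T^{-1/2}`. -/
def Ki (p : ℂ) : Borel p := gen p .Ki
/-- `T`. -/
def T (p : ℂ) : Borel p := K p ^ 2
/-- `T⁻¹`. -/
def Ti (p : ℂ) : Borel p := Ki p ^ 2

/-- The `L`-matrix over the Borel algebra. -/
def L (p : ℂ) : Matrix (Fin 3) (Fin 3) (Borel p) := Lmat p (H p) (E p) (K p) (Ki p)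

theorem rels_hold (p : ℂ) : ∀ r ∈ borelRels p (H p) (E p) (K p) (Ki p), r.1 = r.2 := by
  have key : ∀ r ∈ borelRels p (FreeAlgebra.ι ℂ BGen.H) (FreeAlgebra.ι ℂ BGen.E)
      (FreeAlgebra.ι ℂ BGen.K) (FreeAlgebra.ι ℂ BGen.Ki),
      Presented.mk (freeBorelRels p) r.1 = Presented.mk (freeBorelRels p) r.2 :=
    fun r hr => Presented.mk_rel hr
  simp only [borelRels, List.forall_mem_cons, map_sub, map_mul, map_pow, map_smul, map_add,
    map_one, List.not_mem_nil, false_imp_iff, implies_true, and_true] at key ⊢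
  exact key

/-- The images of the generators under the parity automorphism: `E` is odd, the others are even. -/
def parityGen (p : ℂ) : BGen → Borel p
  | .H => H p
  | .E => -E p
  | .K => K p
  | .Ki => Ki p

/-- The parity automorphism of the Borel algebra. -/
def parity (p : ℂ) : Borel p →ₐ[ℂ] Borel p :=
  Presented.lift (parityGen p) (by
    have key := rels_hold p
    simp only [freeBorelRels, borelRels, List.forall_mem_cons, map_sub, map_mul, map_pow, map_smul, map_add,
      map_one, List.not_mem_nil, false_imp_iff, implies_true, and_true,
      FreeAlgebra.lift_ι_apply, parityGen] at key ⊢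
    obtain ⟨h1, h2, h3, h4, h5, h6, h7, h8⟩ := key
    refine ⟨?_, h2, h3, ?_, h5, h6, ?_, h8⟩
    · rw [mul_neg, mul_neg, neg_mul, smul_neg, ← h1]; abel
    · rw [neg_sq, h4]
    · rw [mul_neg, neg_mul, h7])

theorem parity_gen (p : ℂ) (g : BGen) : parity p (gen p g) = parityGen p g :=
  Presented.lift_mk _ _ g

theorem parity_parity (p : ℂ) (x : Borel p) : parity p (parity p x) = x := by
  have : (parity p).comp (parity p) = AlgHom.id ℂ _ := by
    apply Presented.hom_ext
    intro g
    change parity p (parity p (gen p g)) = gen p g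
    rw [parity_gen]
    cases g
    · exact parity_gen p .H
    · change parity p (-E p) = _
      rw [map_neg, show parity p (E p) = -E p from parity_gen p .E, neg_neg]; rfl
    · exact parity_gen p .K
    · exact parity_gen p .Ki
  exact DFunLike.congr_fun this x

/-- The `ℤ₂`-grading: even elements are fixed by the parity automorphism, odd ones change sign. -/
def grading (p : ℂ) (i : ZMod 2) : Submodule ℂ (Borel p) where
  carrier := {x | parity p x = ((-1 : ℂ) ^ i.val) • x}
  zero_mem' := by simp
  add_mem' {x y} hx hy := by
    simp only [Set.mem_ofPred_eq] at *
    rw [map_add, hx, hy, smul_add]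
  smul_mem' c x hx := by
    simp only [Set.mem_ofPred_eq] at *
    rw [map_smul, hx, smul_comm]

theorem mem_grading {p : ℂ} {i : ZMod 2} {x : Borel p} :
    x ∈ grading p i ↔ parity p x = ((-1 : ℂ) ^ i.val) • x := Iff.rfl

instance gradedMonoid (p : ℂ) : SetLike.GradedMonoid (grading p) where
  one_mem := by simp [mem_grading]
  mul_mem i j x y hx hy := by
    rw [mem_grading] at *
    rw [map_mul, hx, hy, smul_mul_smul_comm]
    have h2 : ∀ i : ZMod 2, i = 0 ∨ i = 1 := by decide
    have h11 : (1 : ZMod 2) + 1 = 0 := by decide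
    rcases h2 i with rfl | rfl <;> rcases h2 j with rfl | rfl <;> simp [ZMod.val_one, h11]

/-- The homogeneous components of an element. -/
def proj (p : ℂ) (i : ZMod 2) : Borel p →ₗ[ℂ] grading p i where
  toFun x := ⟨(1 / 2 : ℂ) • (x + (-1 : ℂ) ^ i.val • parity p x), by
    rw [mem_grading, map_smul, map_add, map_smul, parity_parity]
    have h2 : ∀ i : ZMod 2, i = 0 ∨ i = 1 := by decide
    rcases h2 i with rfl | rfl
    · simp only [ZMod.val_zero]; module
    · simp only [ZMod.val_one]; module⟩
  map_add' x y := by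
    ext
    simp only [map_add, smul_add, Submodule.coe_add]
    abel
  map_smul' c x := by
    ext
    simp only [map_smul, RingHom.id_apply, Submodule.coe_smul]
    rw [smul_comm _ c (parity p x), ← smul_add, smul_comm]

instance gradedAlgebra (p : ℂ) : GradedAlgebra (grading p) where
  decompose' x := DirectSum.lof ℂ (ZMod 2) (fun i => grading p i) 0 (proj p 0 x)
    + DirectSum.lof ℂ (ZMod 2) (fun i => grading p i) 1 (proj p 1 x)
  left_inv x := by
    rw [map_add]
    simp only [DirectSum.lof_eq_of, DirectSum.coeAddMonoidHom_of, proj]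
    simp only [LinearMap.coe_mk, AddHom.coe_mk, ZMod.val_zero, ZMod.val_one, pow_zero, pow_one,
      one_smul]
    module
  right_inv x := by
    induction x using DirectSum.induction_on with
    | zero => simp
    | of i x =>
      obtain ⟨x, hx⟩ := x
      rw [DirectSum.coeAddMonoidHom_of]
      rw [mem_grading] at hx
      have h2 : ∀ i, i = 0 ∨ i = (1 : ZMod 2) := by decide
      rcases h2 i with rfl | rfl
      · have a : proj p 0 x = ⟨x, hx⟩ := by
          ext; simp only [proj, LinearMap.coe_mk, AddHom.coe_mk, hx, ZMod.val_zero]; module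
        have b : proj p 1 x = 0 := by
          ext; simp only [proj, LinearMap.coe_mk, AddHom.coe_mk, hx, ZMod.val_zero, ZMod.val_one,
            Submodule.coe_zero]; module
        simp only [a, b, map_zero, add_zero, DirectSum.lof_eq_of]
      · have a : proj p 1 x = ⟨x, hx⟩ := by
          ext; simp only [proj, LinearMap.coe_mk, AddHom.coe_mk, hx, ZMod.val_one]; module
        have b : proj p 0 x = 0 := by
          ext; simp only [proj, LinearMap.coe_mk, AddHom.coe_mk, hx, ZMod.val_zero, ZMod.val_one,
            Submodule.coe_zero]; module
        simp only [a, b, map_zero, zero_add, DirectSum.lof_eq_of]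
    | add x y hx hy =>
      simp only [map_add] at *
      nth_rewrite 3 [← hx]
      nth_rewrite 3 [← hy]
      abel

end Borel

/-! ### Hopf superalgebras -/

section Hopf

variable {A : Type u} [Ring A] [Algebra ℂ A]

/-- The Hopf superalgebra structures on a `ℤ₂`-graded algebra: the coproduct is an algebra
homomorphism into the graded tensor product, and all structure maps are even. -/
@[ext]
structure HopfSuper (𝒜 : ZMod 2 → Submodule ℂ A) [GradedAlgebra 𝒜] where
  comul : A →ₐ[ℂ] 𝒜 ᵍ⊗[ℂ] 𝒜
  counit : A →ₐ[ℂ] ℂ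
  antipode : A →ₗ[ℂ] A
  /-- The coproduct, as a linear map into the underlying tensor product of vector spaces. -/
  Δ : A →ₗ[ℂ] A ⊗[ℂ] A
  Δ_def : Δ = (GradedTensorProduct.of ℂ 𝒜 𝒜).symm.toLinearMap ∘ₗ comul.toLinearMap
  comul_even : ∀ i, ∀ x ∈ 𝒜 i, Δ x ∈ ⨆ a : ZMod 2,
    LinearMap.range (TensorProduct.map (𝒜 a).subtype (𝒜 (i - a)).subtype)
  counit_even : ∀ x ∈ 𝒜 1, counit x = 0
  antipode_even : ∀ i, ∀ x ∈ 𝒜 i, antipode x ∈ 𝒜 i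
  coassoc : (TensorProduct.assoc ℂ A A A).toLinearMap ∘ₗ Δ.rTensor A ∘ₗ Δ = Δ.lTensor A ∘ₗ Δ
  counit_left : counit.toLinearMap.rTensor A ∘ₗ Δ = TensorProduct.mk ℂ ℂ A 1
  counit_right : counit.toLinearMap.lTensor A ∘ₗ Δ = (TensorProduct.mk ℂ A ℂ).flip 1
  antipode_left : LinearMap.mul' ℂ A ∘ₗ antipode.rTensor A ∘ₗ Δ
    = Algebra.linearMap ℂ A ∘ₗ counit.toLinearMap
  antipode_right : LinearMap.mul' ℂ A ∘ₗ antipode.lTensor A ∘ₗ Δ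
    = Algebra.linearMap ℂ A ∘ₗ counit.toLinearMap

end Hopf

/-- The coalgebraic part of the FRT construction: `Δ(L) = L ⊗̇ L`, where `T^{1/2}` is group-like as
`T` is, `ε(L) = 1`, and `S(L) = L⁻¹`. -/
structure IsFRT (p : ℂ) (S : HopfSuper (Borel.grading p)) : Prop where
  comul_L : ∀ i j, S.comul (Borel.L p i j) =
    ∑ k, (Borel.L p i k ᵍ⊗ₜ[ℂ] Borel.L p k j : Borel.grading p ᵍ⊗[ℂ] Borel.grading p)
  comul_K : S.comul (Borel.K p) = Borel.K p ᵍ⊗ₜ[ℂ] Borel.K p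
  counit_L : (Borel.L p).map S.counit = 1
  antipode_L_mul : (Borel.L p).map S.antipode * Borel.L p = 1
  mul_antipode_L : Borel.L p * (Borel.L p).map S.antipode = 1

end SuperJordanian

end

open SuperJordanian

open scoped TensorProduct
open Filter Topology

noncomputable section

namespace SuperJordanian

set_option linter.unusedSimpArgs false

/-! ### Evaluation of power series at nilpotent elements -/

section Eval

open PowerSeries

variable {A : Type u} [Ring A] [Algebra ℂ A]

/-! Everything built from a nilpotent `e` is a formal power series evaluated at `e ^ 2` by the
algebra homomorphism `ev`, so operator identities become identities in `ℂ⟦X⟧`. There `S = √(1 +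
p²X²)`, `T = S + pX = exp(arsinh(pX))`, and `S (Tᵃ)' = a p Tᵃ`. Commutators with `h` and `f` act on
functions of `e ^ 2` as `2e² d/dX` and `-e d/dX` (`commutator_h_ev`, `commutator_f_ev`). With `W =
(T - 1)/(T + 1)` and `pXW = S - 1`, the expressions `{E, F} + H` and `[H, F] + ½(SF + FS)` equal
`{e, f} + h` and `S([h, f] + f)`. Since `S` is invertible, these identities serve both directions of
the bijection; unipotence fixes `T` and its square root.

Let `G(X)` be the series of `E_{q²}(pX/(q² - 1))` and `B_c(X) = G(cX)/G(X)`. The difference equation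
of `G` and the cocycle identity `B_c(dX) B_d(X) = B_{cd}(X)` give recursions for the coefficients of
`B_{q²}` whose limit is `T² = 1 + 2pXT`. Comparing the two orders of the cocycle identity for `q²`
and `c(q)`, after division by `q - 1`, gives the recursion of `Tᵃ`, where `c'(1) = 2a`
(`tendsto_coeff_Bser`).

Conjugation by `M_j` sends `q^{aĥ/2}` to `B_{q^a}(e²) q^{aĥ/2}`, and `ω M⁻¹ f̂ M = -pe + ωΨ` with
`Ψ` convergent (`conjPsi_eq`). Conjugation by `M_{1/2}` adds a singular multiple of the difference
of two diagonal blocks to the corner block. This difference is minus the anticommutator of `e` with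
`ω M⁻¹ f̂ M`, so the poles cancel (`corner_eq`). The limit then needs only `{e, Ψ}`, which the
anticommutator of `ê` and `f̂` supplies.

The Borel algebra is spanned by `c Hᵐ` with `c` in the subalgebra of `K^{±1}, E`. Matrix entries of
such elements on the `V_j` are polynomial in the weight, and the top coefficients form a power
series that vanishes only with the leading `c`, because `T^{1/2}` is transcendental over `ℂ`. So the
`V_j` together are faithful (`Borel.eq_zero_of_rep_eq_zero`), and they factor through `Uh p`.

The graded `RLL` equation is checked entry by entry; four entries already give back the Borel
relations. The coproduct and counit come from the presentation, the antipode from an ungraded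
antihomomorphism twisted on odd elements, and the Hopf axioms propagate along left multiplication by
generators. A coproduct determines its counit and its antipode, which gives uniqueness. -/

theorem exists_pow_eq_zero {R : Type*} [MonoidWithZero R] {x : R} (hx : IsNilpotent x) :
    ∃ N : ℕ, x ^ N = 0 := hx

/-- Polynomials congruent modulo `X ^ N` have the same value at `x`. This is what makes evaluation
of truncations multiplicative, although truncation itself is not. -/
theorem aeval_eq_of_coeff_eq {x : A} {N : ℕ} (hx : x ^ N = 0) {P Q : Polynomial ℂ}
    (h : ∀ k < N, P.coeff k = Q.coeff k) : Polynomial.aeval x P = Polynomial.aeval x Q := by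
  have : (Polynomial.X ^ N : Polynomial ℂ) ∣ P - Q := by
    rw [Polynomial.X_pow_dvd_iff]
    intro d hd
    rw [Polynomial.coeff_sub, h d hd, sub_self]
  obtain ⟨R, hR⟩ := this
  rw [← sub_eq_zero, ← map_sub, hR, map_mul, map_pow, Polynomial.aeval_X, hx, zero_mul]

/-- Evaluation of formal power series at a nilpotent element. -/
def ev (x : A) (hx : IsNilpotent x) : ℂ⟦X⟧ →ₐ[ℂ] A :=
  AlgHom.ofLinearMap
    ((Polynomial.aeval x).toLinearMap ∘ₗ PowerSeries.trunc (nilpotencyClass x))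
    (by
      change Polynomial.aeval x _ = 1
      rw [← map_one (Polynomial.aeval (R := ℂ) x)]
      apply aeval_eq_of_coeff_eq (pow_nilpotencyClass hx)
      intro k hk
      rw [coeff_trunc, if_pos hk, PowerSeries.coeff_one, Polynomial.coeff_one])
    (by
      intro φ ψ
      change Polynomial.aeval x _ = Polynomial.aeval x _ * Polynomial.aeval x _
      rw [← map_mul]
      apply aeval_eq_of_coeff_eq (pow_nilpotencyClass hx)
      intro k hk
      rw [coeff_trunc, if_pos hk, coeff_mul_eq_coeff_trunc_mul_trunc _ _ hk]
      rw [← Polynomial.coe_mul, Polynomial.coeff_coe])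

/-- Any vanishing power of `x` may serve as the cutoff, not only the nilpotency class. A single
bound can then be used for several evaluations. -/
theorem ev_eq_sum {x : A} (hx : IsNilpotent x) {N : ℕ} (hN : x ^ N = 0) (φ : ℂ⟦X⟧) :
    ev x hx φ = ∑ k ∈ Finset.range N, coeff k φ • x ^ k := by
  have h1 : ev x hx φ = Polynomial.aeval x (trunc N φ) := by
    have hle : nilpotencyClass x ≤ N := Nat.sInf_le hN
    apply aeval_eq_of_coeff_eq (pow_nilpotencyClass hx)
    intro k hk
    rw [coeff_trunc, coeff_trunc, if_pos hk, if_pos (hk.trans_le hle)]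
  rw [h1, Polynomial.aeval_def, eval₂_trunc_eq_sum_range]
  simp only [Algebra.smul_def]

theorem ev_congr {x : A} (hx : IsNilpotent x) {N : ℕ} (hN : x ^ N = 0) {φ ψ : ℂ⟦X⟧}
    (h : ∀ k < N, coeff k φ = coeff k ψ) : ev x hx φ = ev x hx ψ := by
  rw [ev_eq_sum hx hN, ev_eq_sum hx hN]
  exact Finset.sum_congr rfl fun k hk => by rw [h k (Finset.mem_range.1 hk)]

theorem ev_X {x : A} (hx : IsNilpotent x) : ev x hx X = x := by
  obtain ⟨N, hN⟩ := exists_pow_eq_zero hx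
  rw [ev_eq_sum hx (N := N + 2) (by rw [pow_add, hN, zero_mul]), Finset.sum_eq_single 1]
  · simp
  · intro b _ hb; simp [PowerSeries.coeff_X, hb]
  · simp

theorem ev_C {x : A} (hx : IsNilpotent x) (a : ℂ) : ev x hx (C a) = algebraMap ℂ A a := by
  rw [← (ev x hx).commutes a]; rfl

theorem ev_coe {x : A} (hx : IsNilpotent x) (P : Polynomial ℂ) :
    ev x hx (P : ℂ⟦X⟧) = Polynomial.aeval x P := by
  have : (ev x hx).comp (Polynomial.coeToPowerSeries.algHom ℂ) = Polynomial.aeval x := by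
    apply Polynomial.algHom_ext
    simp [ev_X]
  rw [← this]
  simp

theorem commute_ev {x a : A} (hx : IsNilpotent x) (h : Commute a x) (φ : ℂ⟦X⟧) :
    Commute a (ev x hx φ) := by
  obtain ⟨N, hN⟩ := exists_pow_eq_zero hx
  rw [ev_eq_sum _ hN]
  exact Commute.sum_right _ _ _ fun k _ => (h.pow_right k).smul_right _

theorem ev_commute_ev {x y : A} (hx : IsNilpotent x) (hy : IsNilpotent y) (h : Commute x y)
    (φ ψ : ℂ⟦X⟧) : Commute (ev x hx φ) (ev y hy ψ) :=
  commute_ev hy (commute_ev hx h.symm φ).symm ψ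

theorem isNilpotent_ev {x : A} (hx : IsNilpotent x) {φ : ℂ⟦X⟧} (h : constantCoeff φ = 0) :
    IsNilpotent (ev x hx φ) := by
  obtain ⟨ψ, rfl⟩ := X_dvd_iff.2 h
  rw [map_mul, ev_X]
  exact (commute_ev hx (Commute.refl x) ψ).isNilpotent_mul_right hx

theorem isNilpotent_ev_sub_one {x : A} (hx : IsNilpotent x) {φ : ℂ⟦X⟧}
    (h : constantCoeff φ = 1) : IsNilpotent (ev x hx φ - 1) := by
  rw [← map_one (ev x hx), ← map_sub]
  exact isNilpotent_ev hx (by rw [map_sub, h, map_one, sub_self])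

/-- Write `φ = X ^ N * (rest) + (polynomial)`, where the `N`-th power of the value of `ψ` is zero.
The first summand dies on both sides, and the second is handled by any algebra homomorphism. -/
theorem ev_subst {x : A} (hx : IsNilpotent x) {ψ : ℂ⟦X⟧} (h : constantCoeff ψ = 0)
    (φ : ℂ⟦X⟧) : ev x hx (φ.subst ψ) = ev (ev x hx ψ) (isNilpotent_ev hx h) φ := by
  have hs : HasSubst ψ := HasSubst.of_constantCoeff_zero' h
  obtain ⟨N, hN⟩ := exists_pow_eq_zero (isNilpotent_ev hx h)
  have hφ := eq_X_pow_mul_shift_add_trunc N φ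
  rw [hφ, subst_add hs, subst_mul hs, subst_pow hs, subst_X hs, subst_coe hs, map_add, map_add,
    map_mul, map_mul, map_pow, map_pow, ev_X, hN, zero_mul, zero_mul, ev_coe]
  congr 1
  rw [← Polynomial.aeval_algHom_apply]

/-- If `[a, x] = c` commutes with `x`, then `[a, φ(x)] = c φ'(x)`. -/
theorem commutator_ev {x a c : A} (hx : IsNilpotent x) (h : a * x - x * a = c) (hc : Commute c x)
    (φ : ℂ⟦X⟧) : a * ev x hx φ - ev x hx φ * a = c * ev x hx (d⁄dX ℂ φ) := by
  obtain ⟨N, hN⟩ := exists_pow_eq_zero hx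
  have hk : ∀ k : ℕ, a * x ^ (k + 1) - x ^ (k + 1) * a = (k + 1 : ℂ) • (c * x ^ k) := by
    intro k
    induction k with
    | zero => simp [h]
    | succ k ih =>
      have e1 : a * x ^ (k + 1 + 1) - x ^ (k + 1 + 1) * a
          = (a * x ^ (k + 1) - x ^ (k + 1) * a) * x + x ^ (k + 1) * (a * x - x * a) := by
        rw [pow_succ x (k + 1)]; noncomm_ring
      rw [e1, ih, h, ← (hc.pow_right (k + 1)).eq, smul_mul_assoc, mul_assoc, ← pow_succ]
      push_cast
      module
  -- The cutoffs differ by one because differentiation lowers the degree; the constant term commutes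
  -- with `a` and drops out.
  rw [ev_eq_sum _ (N := N + 1) (by rw [pow_succ, hN, zero_mul]), ev_eq_sum _ hN, Finset.mul_sum,
    Finset.sum_mul, ← Finset.sum_sub_distrib, Finset.sum_range_succ', Finset.mul_sum]
  simp only [pow_zero, mul_smul_comm, smul_mul_assoc, mul_one, one_mul, sub_self, add_zero,
    ← smul_sub, hk, coeff_derivative, mul_smul]

end Eval

/-! ### Binomial series -/

section Binomial

open PowerSeries

/-- The binomial series `(1 + X) ^ a`. -/
def bser (a : ℂ) : ℂ⟦X⟧ := PowerSeries.mk (binom a)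

theorem binom_zero (a : ℂ) : binom a 0 = 1 := by simp [binom]

theorem binom_succ (a : ℂ) (k : ℕ) : binom a (k + 1) * (k + 1) = (a - k) * binom a k := by
  have h1 : (k.factorial : ℂ) ≠ 0 := by exact_mod_cast k.factorial_ne_zero
  have h2 : (k + 1 : ℂ) ≠ 0 := by exact_mod_cast k.succ_ne_zero
  rw [binom, binom, Finset.prod_range_succ, Nat.factorial_succ]
  push_cast
  field_simp

@[simp]
theorem constantCoeff_bser (a : ℂ) : constantCoeff (bser a) = 1 := by
  rw [← coeff_zero_eq_constantCoeff_apply, bser, coeff_mk, binom_zero]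

theorem derivative_bser (a : ℂ) : (1 + X) * d⁄dX ℂ (bser a) = C a * bser a := by
  ext k
  rw [add_mul, one_mul, map_add, coeff_derivative, coeff_C_mul]
  rcases k with _ | k
  · have := binom_succ a 0
    simp [bser, binom_zero] at this ⊢
    exact this
  · rw [coeff_succ_X_mul, coeff_derivative]
    have := binom_succ a (k + 1)
    simp only [bser, coeff_mk] at this ⊢
    push_cast at this ⊢
    linear_combination this

/-- The hypothesis says that `f / g` has zero derivative, so it is constant, and its constant term
is `1`. -/
theorem eq_of_derivative_mul_eq {f g : ℂ⟦X⟧} (h : d⁄dX ℂ f * g = f * d⁄dX ℂ g)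
    (hf : constantCoeff f = 1) (hg : constantCoeff g = 1) : f = g := by
  have hg' : constantCoeff g ≠ 0 := by rw [hg]; exact one_ne_zero
  have hgi : g * g⁻¹ = 1 := PowerSeries.mul_inv_cancel g hg'
  have : f * g⁻¹ = 1 := by
    apply derivative.ext
    · rw [Derivation.leibniz, derivative_inv']
      simp only [smul_eq_mul, derivative_one]
      linear_combination g⁻¹ ^ 2 * h - (g⁻¹ * d⁄dX ℂ f) * hgi
    · simp [hf, hg]
  calc f = f * g⁻¹ * g := by rw [mul_assoc, mul_comm g⁻¹, hgi, mul_one]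
    _ = g := by rw [this, one_mul]

/-- The equation `(1 + X) f' = a f` with `f(0) = 1` has only one solution. The exponent law for
binomial series follows from it, without the Vandermonde identity. -/
theorem bser_unique {f : ℂ⟦X⟧} {a : ℂ} (h : (1 + X) * d⁄dX ℂ f = C a * f)
    (hf : constantCoeff f = 1) : f = bser a := by
  apply eq_of_derivative_mul_eq _ hf (constantCoeff_bser a)
  have h1 : (1 + X : ℂ⟦X⟧) ≠ 0 := by
    intro h0
    have := congrArg constantCoeff h0
    simp at this
  apply mul_left_cancel₀ h1
  linear_combination bser a * h - f * derivative_bser a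

theorem bser_add (a b : ℂ) : bser (a + b) = bser a * bser b := by
  refine (bser_unique ?_ (by simp)).symm
  rw [Derivation.leibniz, smul_eq_mul, smul_eq_mul, map_add]
  linear_combination bser a * derivative_bser b + bser b * derivative_bser a

theorem bser_zero : bser 0 = 1 := (bser_unique (by simp) (by simp)).symm

theorem bser_one : bser 1 = 1 + X := (bser_unique (by simp) (by simp)).symm

theorem bser_half_sq : bser (1 / 2) * bser (1 / 2) = 1 + X := by
  rw [← bser_add, ← bser_one]; norm_num

end Binomial

/-! ### Powers of unipotent elements -/

section UnipotentPowers

open PowerSeries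

variable {A : Type u} [Ring A] [Algebra ℂ A]

theorem unipPow_eq_ev (a : ℂ) {u : A} (hu : IsNilpotent (u - 1)) :
    unipPow a u = ev (u - 1) hu (bser a) := by
  rw [ev_eq_sum hu (pow_nilpotencyClass hu)]
  simp [unipPow, bser]

theorem unipPow_add (a b : ℂ) {u : A} (hu : IsNilpotent (u - 1)) :
    unipPow (a + b) u = unipPow a u * unipPow b u := by
  simp only [unipPow_eq_ev _ hu, bser_add, map_mul]

theorem unipPow_zero {u : A} (hu : IsNilpotent (u - 1)) : unipPow 0 u = 1 := by
  rw [unipPow_eq_ev _ hu, bser_zero, map_one]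

theorem unipPow_one {u : A} (hu : IsNilpotent (u - 1)) : unipPow 1 u = u := by
  rw [unipPow_eq_ev _ hu, bser_one, map_add, map_one, ev_X, add_sub_cancel]

theorem commute_unipPow (a : ℂ) {u b : A} (hu : IsNilpotent (u - 1)) (h : Commute b u) :
    Commute b (unipPow a u) := by
  rw [unipPow_eq_ev _ hu]
  exact commute_ev hu (h.sub_right (Commute.one_right b)) _

theorem isNilpotent_unipPow_sub_one (a : ℂ) {u : A} (hu : IsNilpotent (u - 1)) :
    IsNilpotent (unipPow a u - 1) := by
  rw [unipPow_eq_ev _ hu]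
  exact isNilpotent_ev_sub_one hu (constantCoeff_bser a)

theorem unipPow_half_mul_self {u : A} (hu : IsNilpotent (u - 1)) :
    unipPow (1 / 2) u * unipPow (1 / 2) u = u := by
  rw [← unipPow_add _ _ hu, add_halves, unipPow_one hu]

theorem isUnit_of_isNilpotent_sub_one {R : Type*} [Ring R] {u : R} (hu : IsNilpotent (u - 1)) : IsUnit u := by
  have := hu.isUnit_one_add
  rwa [add_sub_cancel] at this

theorem isUnit_add_of_unipotent {s r : A} (hs : IsNilpotent (s - 1)) (hr : IsNilpotent (r - 1))
    (h : Commute s r) : IsUnit (s + r) := by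
  have hn : IsNilpotent ((1 / 2 : ℂ) • ((s - 1) + (r - 1))) :=
    IsNilpotent.smul (Commute.isNilpotent_add ((h.sub_left (Commute.one_left r)).sub_right
      ((Commute.one_right _))) hs hr) _
  have hu := hn.isUnit_one_add
  have e : s + r = algebraMap ℂ A 2 * (1 + (1 / 2 : ℂ) • ((s - 1) + (r - 1))) := by
    rw [← Algebra.smul_def, smul_add, smul_smul]
    have : (2 : ℂ) • (1 : A) = 2 := by rw [Algebra.smul_def, mul_one, map_ofNat]
    rw [this]
    norm_num
    rw [← one_add_one_eq_two]; abel
  rw [e]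
  exact ((IsUnit.mk0 (2 : ℂ) two_ne_zero).map (algebraMap ℂ A)).mul hu

/-- The sum `s + r` is twice a unipotent element, hence a unit, and `(s - r)(s + r) = 0` because `s`
and `r` commute. -/
theorem eq_of_sq_eq_of_unipotent {s r : A} (hs : IsNilpotent (s - 1)) (hr : IsNilpotent (r - 1))
    (h : Commute s r) (hsq : s * s = r * r) : s = r := by
  have hu := isUnit_add_of_unipotent hs hr h
  have : (s - r) * (s + r) = 0 := by
    rw [sub_mul, mul_add, mul_add, hsq, h.eq]; abel
  rw [hu.mul_left_eq_zero] at this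
  exact sub_eq_zero.1 this

/-- A unipotent square root of a unipotent element is unique. -/
theorem eq_unipPow_half {s u : A} (hs : IsNilpotent (s - 1)) (hu : IsNilpotent (u - 1))
    (hsq : s * s = u) : s = unipPow (1 / 2) u := by
  apply eq_of_sq_eq_of_unipotent hs (isNilpotent_unipPow_sub_one _ hu)
  · exact commute_unipPow _ hu (hsq ▸ (Commute.refl s).mul_right (Commute.refl s))
  · rw [hsq, unipPow_half_mul_self hu]

end UnipotentPowers

/-! ### The series of `√(1 + p² X²)` and of the powers of `T̃` -/

section Series

open PowerSeries

theorem constantCoeff_subst_eq {ψ : ℂ⟦X⟧} (h : constantCoeff ψ = 0) (φ : ℂ⟦X⟧) :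
    constantCoeff (φ.subst ψ) = constantCoeff φ := by
  have hs : HasSubst ψ := HasSubst.of_constantCoeff_zero' h
  obtain ⟨χ, hχ⟩ := X_dvd_iff.2 (show constantCoeff (φ - C (constantCoeff φ)) = 0 by simp)
  have : φ = X * χ + ((Polynomial.C (constantCoeff φ) : Polynomial ℂ) : ℂ⟦X⟧) := by
    rw [← hχ, Polynomial.coe_C]; ring
  conv_lhs => rw [this]
  rw [subst_add hs, subst_mul hs, subst_X hs, subst_coe hs, map_add, map_mul, h, zero_mul,
    zero_add, Polynomial.aeval_C]
  simp

theorem subst_one {ψ : ℂ⟦X⟧} (hs : HasSubst ψ) : (1 : ℂ⟦X⟧).subst ψ = (1 : ℂ⟦X⟧) := by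
  have := map_one (substAlgHom (R := ℂ) hs)
  rwa [coe_substAlgHom] at this

theorem subst_C_eq {ψ : ℂ⟦X⟧} (hs : HasSubst ψ) (a : ℂ) : (C a : ℂ⟦X⟧).subst ψ = (C a : ℂ⟦X⟧) := by
  rw [← Polynomial.coe_C, subst_coe hs, Polynomial.aeval_C, Polynomial.coe_C]
  rfl

/-- The series `√(1 + p² X²)`. -/
def Sser (p : ℂ) : ℂ⟦X⟧ := (bser (1 / 2)).subst (C (p ^ 2) * X ^ 2 : ℂ⟦X⟧)

/-- The series `p X + √(1 + p² X²)`. -/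
def Tser (p : ℂ) : ℂ⟦X⟧ := C p * X + Sser p

/-- The series `-p X + √(1 + p² X²)`. -/
def Tiser (p : ℂ) : ℂ⟦X⟧ := -(C p * X) + Sser p

/-- The series `(p X + √(1 + p² X²)) ^ a`. -/
def Tpow (p a : ℂ) : ℂ⟦X⟧ := (bser a).subst (Tser p - 1)

/-- The series of `(T̃ - 1) / (T̃ + 1)`. -/
def Wser (p : ℂ) : ℂ⟦X⟧ := (Tser p - 1) * (Tser p + 1)⁻¹

variable (p : ℂ)

theorem constantCoeff_sq_mul_X_sq : constantCoeff (C (p ^ 2) * X ^ 2 : ℂ⟦X⟧) = 0 := by simp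

theorem Sser_sq : Sser p * Sser p = 1 + C (p ^ 2) * X ^ 2 := by
  have hs := HasSubst.of_constantCoeff_zero' (constantCoeff_sq_mul_X_sq p)
  rw [Sser, ← subst_mul hs, bser_half_sq, subst_add hs, subst_X hs, subst_one hs]

@[simp]
theorem constantCoeff_Sser : constantCoeff (Sser p) = 1 := by
  rw [Sser, constantCoeff_subst_eq (constantCoeff_sq_mul_X_sq p), constantCoeff_bser]

@[simp]
theorem constantCoeff_Tser : constantCoeff (Tser p) = 1 := by simp [Tser]

theorem constantCoeff_Tser_sub_one : constantCoeff (Tser p - 1) = 0 := by simp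

theorem Sser_mul_derivative : Sser p * d⁄dX ℂ (Sser p) = C (p ^ 2) * X := by
  have := congrArg (d⁄dX ℂ) (Sser_sq p)
  simp only [Derivation.leibniz, map_add, smul_eq_mul, derivative_one, derivative_C,
    derivative_pow, derivative_X] at this
  have h2 : (2 : ℂ⟦X⟧) ≠ 0 := fun h => by
    have := congrArg constantCoeff h
    rw [map_ofNat, map_zero] at this
    exact two_ne_zero this
  apply mul_left_cancel₀ h2
  rw [map_pow] at this ⊢
  norm_num at this
  linear_combination this

theorem Tser_mul_Tiser : Tser p * Tiser p = 1 := by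
  have := Sser_sq p
  rw [map_pow] at this
  rw [Tser, Tiser]
  linear_combination this

theorem Tser_ne_zero : Tser p ≠ 0 := left_ne_zero_of_mul_eq_one (Tser_mul_Tiser p)

/-- This is the differential equation of `exp(arsinh(pX))`, freed of denominators. -/
theorem Sser_mul_derivative_Tser : Sser p * d⁄dX ℂ (Tser p) = C p * Tser p := by
  have := Sser_mul_derivative p
  rw [map_pow] at this
  rw [Tser]
  simp only [map_add, Derivation.leibniz, smul_eq_mul, derivative_C, derivative_X]
  linear_combination this

@[simp]
theorem constantCoeff_Tpow (a : ℂ) : constantCoeff (Tpow p a) = 1 := by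
  rw [Tpow, constantCoeff_subst_eq (constantCoeff_Tser_sub_one p), constantCoeff_bser]

theorem hasSubst_Tser_sub_one : HasSubst (Tser p - 1) :=
  HasSubst.of_constantCoeff_zero' (constantCoeff_Tser_sub_one p)

theorem Tser_mul_derivative_Tpow (a : ℂ) :
    Tser p * d⁄dX ℂ (Tpow p a) = C a * d⁄dX ℂ (Tser p) * Tpow p a := by
  have hs := hasSubst_Tser_sub_one p
  have h := congrArg (fun φ => PowerSeries.subst (Tser p - 1) φ) (derivative_bser a)
  simp only [subst_mul hs, subst_add hs, subst_X hs, subst_one hs, subst_C_eq hs] at h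
  rw [Tpow, derivative_subst hs, map_sub, derivative_one, sub_zero]
  linear_combination d⁄dX ℂ (Tser p) * h

/-- `Tᵃ = exp(a arsinh(pX))`. Through this equation the commutators of `T̃ᵃ` with `h` and `f` become
explicit. -/
theorem Sser_mul_derivative_Tpow (a : ℂ) :
    Sser p * d⁄dX ℂ (Tpow p a) = C (a * p) * Tpow p a := by
  apply mul_left_cancel₀ (Tser_ne_zero p)
  rw [map_mul]
  linear_combination Sser p * Tser_mul_derivative_Tpow p a
    + C a * Tpow p a * Sser_mul_derivative_Tser p

theorem constantCoeff_Tser_add_one : constantCoeff (Tser p + 1) ≠ 0 := by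
  rw [map_add, constantCoeff_Tser, map_one]; norm_num

theorem Wser_mul : Wser p * (Tser p + 1) = Tser p - 1 := by
  rw [Wser, mul_assoc, PowerSeries.inv_mul_cancel _ (constantCoeff_Tser_add_one p), mul_one]

/-- With `pX = sinh u` one has `W = tanh(u/2)`, and the claim is `sinh u tanh(u/2) = cosh u - 1`. -/
theorem C_mul_X_mul_Wser : C p * X * Wser p = Sser p - 1 := by
  have h0 : Tser p + 1 ≠ 0 := by
    intro h
    exact constantCoeff_Tser_add_one p (by rw [h, map_zero])
  apply mul_right_cancel₀ h0
  have h1 := Wser_mul p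
  have h2 := Sser_sq p
  rw [map_pow] at h2
  rw [mul_assoc, h1, Tser]
  linear_combination -h2

/-- The derivative of `pXW = S - 1`, multiplied by `S`; cancelling `p` requires `p ≠ 0`. It controls
the commutator of `h` with `W e`. -/
theorem Sser_mul_derivative_X_mul_Wser (hp : p ≠ 0) :
    Sser p * (X * d⁄dX ℂ (Wser p) + Wser p) = C p * X := by
  have hC : (C p : ℂ⟦X⟧) ≠ 0 := by simpa using hp
  apply mul_left_cancel₀ hC
  have h := congrArg (d⁄dX ℂ) (C_mul_X_mul_Wser p)
  simp only [Derivation.leibniz, map_sub, smul_eq_mul, derivative_one, derivative_C,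
    derivative_X] at h
  have h2 := Sser_mul_derivative p
  rw [map_pow] at h2
  linear_combination Sser p * h + h2

end Series

/-! ### `T̃` and its powers for nilpotent `e` -/

section Nilpotent

open PowerSeries

variable {A : Type u} [Ring A] [Algebra ℂ A] (p : ℂ) {e : A}

theorem isNilpotent_sq {R : Type*} [MonoidWithZero R] {e : R} (he : IsNilpotent e) :
    IsNilpotent (e ^ 2) := he.pow_of_pos two_ne_zero

theorem ev_sq_mul_X_sq (he : IsNilpotent e) :
    ev (e ^ 2) (isNilpotent_sq he) (C (p ^ 2) * X ^ 2) = p ^ 2 • e ^ 4 := by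
  rw [map_mul, map_pow _ X, ev_X, ev_C, Algebra.smul_def, ← pow_mul]

theorem isNilpotent_one_add_sub_one (he : IsNilpotent e) :
    IsNilpotent (1 + p ^ 2 • e ^ 4 - 1) := by
  rw [add_sub_cancel_left]
  exact (he.pow_of_pos four_ne_zero).smul _

theorem unipPow_half_one_add (he : IsNilpotent e) :
    unipPow (1 / 2) (1 + p ^ 2 • e ^ 4) = ev (e ^ 2) (isNilpotent_sq he) (Sser p) := by
  rw [Sser, ev_subst _ (constantCoeff_sq_mul_X_sq p),
    unipPow_eq_ev _ (isNilpotent_one_add_sub_one p he)]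
  congr 2
  rw [ev_sq_mul_X_sq p he, add_sub_cancel_left]

theorem ev_C_mul_X (he : IsNilpotent e) :
    ev (e ^ 2) (isNilpotent_sq he) (C p * X) = p • e ^ 2 := by
  rw [map_mul, ev_X, ev_C, Algebra.smul_def]

theorem tT_eq_ev (he : IsNilpotent e) : tT p e = ev (e ^ 2) (isNilpotent_sq he) (Tser p) := by
  rw [tT, unipPow_half_one_add p he, Tser, map_add, ev_C_mul_X p he]

theorem tTinv_eq_ev (he : IsNilpotent e) :
    tTinv p e = ev (e ^ 2) (isNilpotent_sq he) (Tiser p) := by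
  rw [tTinv, unipPow_half_one_add p he, Tiser, map_add, map_neg, ev_C_mul_X p he]

theorem isNilpotent_tT_sub_one (he : IsNilpotent e) : IsNilpotent (tT p e - 1) := by
  rw [tT_eq_ev p he]
  exact isNilpotent_ev_sub_one _ (constantCoeff_Tser p)

theorem unipPow_tT (a : ℂ) (he : IsNilpotent e) :
    unipPow a (tT p e) = ev (e ^ 2) (isNilpotent_sq he) (Tpow p a) := by
  rw [Tpow, ev_subst _ (constantCoeff_Tser_sub_one p),
    unipPow_eq_ev _ (isNilpotent_tT_sub_one p he)]
  congr 2
  rw [map_sub, map_one, tT_eq_ev p he]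

theorem tT_mul_tTinv (he : IsNilpotent e) : tT p e * tTinv p e = 1 := by
  rw [tT_eq_ev p he, tTinv_eq_ev p he, ← map_mul, Tser_mul_Tiser, map_one]

theorem tTinv_mul_tT (he : IsNilpotent e) : tTinv p e * tT p e = 1 := by
  rw [tT_eq_ev p he, tTinv_eq_ev p he, ← map_mul, mul_comm, Tser_mul_Tiser, map_one]

theorem tT_sub_tTinv : tT p e - tTinv p e = (2 * p) • e ^ 2 := by
  rw [tT, tTinv]; module

theorem tT_add_tTinv (he : IsNilpotent e) :
    tT p e + tTinv p e = (2 : ℂ) • ev (e ^ 2) (isNilpotent_sq he) (Sser p) := by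
  rw [tT, tTinv, unipPow_half_one_add p he]; module

theorem tH_eq (he : IsNilpotent e) (h : A) :
    tH p e h = ev (e ^ 2) (isNilpotent_sq he) (Sser p) * h := by
  rw [tH, tT_add_tTinv p he, smul_mul_assoc, smul_smul]
  norm_num

theorem unipPow_neg_one {u v : A} (hu : IsNilpotent (u - 1)) (h : v * u = 1) :
    unipPow (-1) u = v := by
  have h1 : u * unipPow (-1) u = 1 := by
    nth_rewrite 1 [← unipPow_one hu]
    rw [← unipPow_add _ _ hu, add_neg_cancel, unipPow_zero hu]
  calc unipPow (-1) u = v * u * unipPow (-1) u := by rw [h, one_mul]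
    _ = v := by rw [mul_assoc, h1, mul_one]

theorem unipPow_half_sq {u : A} (hu : IsNilpotent (u - 1)) : unipPow (1 / 2) u ^ 2 = u := by
  rw [pow_two, unipPow_half_mul_self hu]

theorem unipPow_neg_half_sq {u v : A} (hu : IsNilpotent (u - 1)) (h : v * u = 1) :
    unipPow (-1 / 2) u ^ 2 = v := by
  rw [pow_two, ← unipPow_add _ _ hu, ← unipPow_neg_one hu h]; norm_num

/-- The series `T + 1` has constant term `2`, so `T̃ + 1` is a unit and the default value of
`Ring.inverse` plays no role. -/
theorem inverse_tT_add_one (he : IsNilpotent e) :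
    Ring.inverse (tT p e + 1) = ev (e ^ 2) (isNilpotent_sq he) (Tser p + 1)⁻¹ := by
  have h1 : tT p e + 1 = ev (e ^ 2) (isNilpotent_sq he) (Tser p + 1) := by
    rw [tT_eq_ev p he, map_add, map_one]
  have h2 : ev (e ^ 2) (isNilpotent_sq he) (Tser p + 1)⁻¹ * (tT p e + 1) = 1 := by
    rw [h1, ← map_mul, PowerSeries.inv_mul_cancel _ (constantCoeff_Tser_add_one p), map_one]
  have h3 : (tT p e + 1) * ev (e ^ 2) (isNilpotent_sq he) (Tser p + 1)⁻¹ = 1 := by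
    rw [h1, ← map_mul, PowerSeries.mul_inv_cancel _ (constantCoeff_Tser_add_one p), map_one]
  have hu : IsUnit (tT p e + 1) := ⟨⟨_, _, h3, h2⟩, rfl⟩
  calc Ring.inverse (tT p e + 1)
      = ev (e ^ 2) (isNilpotent_sq he) (Tser p + 1)⁻¹ * (tT p e + 1)
          * Ring.inverse (tT p e + 1) := by rw [h2, one_mul]
    _ = _ := by rw [mul_assoc, Ring.mul_inverse_cancel _ hu, mul_one]

theorem tT_sub_one_mul_inverse (he : IsNilpotent e) :
    (tT p e - 1) * Ring.inverse (tT p e + 1) = ev (e ^ 2) (isNilpotent_sq he) (Wser p) := by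
  rw [inverse_tT_add_one p he, Wser, map_mul, map_sub, map_one, tT_eq_ev p he]

end Nilpotent

/-! ### The relations of `osp(1|2)` and of the super-Jordanian algebra, in reduced form -/

section Relations

variable {A : Type u} [Ring A] [Algebra ℂ A]

/-- The even relations are consequences of the odd ones by the Leibniz rule, for example `[e², f] =
e{e, f} - {e, f}e = [h, e] = e`. -/
theorem OspGens.isOsp_of {A : Type*} [Ring A] {g : OspGens A} (he : g.h * g.e - g.e * g.h = g.e)
    (hf : g.h * g.f - g.f * g.h = -g.f) (ef : g.e * g.f + g.f * g.e = -g.h) : g.IsOsp := by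
  obtain ⟨e, f, h⟩ := g
  simp only at he hf ef
  have bpf : e ^ 2 * f - f * e ^ 2 = e := by
    linear_combination (norm := noncomm_ring) e * ef - ef * e + he
  refine ⟨he, hf, ef, ?_, ?_, ?_, bpf, ?_⟩
  · simp only
    linear_combination (norm := noncomm_ring) he * e + e * he
  · simp only
    linear_combination (norm := noncomm_ring) -hf * f - f * hf
  · simp only
    linear_combination (norm := noncomm_ring) -bpf * f - f * bpf - ef
  · simp only
    linear_combination (norm := noncomm_ring) ef * f - f * ef - hf

/-- The relations of the Borel part, as a conjunction. -/
structure IsBorel (p : ℂ) (H E K Ki : A) : Prop where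
  HE : H * E - E * H = (1 / 2 : ℂ) • ((K ^ 2 + Ki ^ 2) * E)
  HT : H * K ^ 2 - K ^ 2 * H = (K ^ 2) ^ 2 - 1
  HTi : H * Ki ^ 2 - Ki ^ 2 * H = (Ki ^ 2) ^ 2 - 1
  EE : E ^ 2 = (2 * p)⁻¹ • (K ^ 2 - Ki ^ 2)
  KKi : K * Ki = 1
  KiK : Ki * K = 1
  KE : K * E = E * K
  HK : H * K - K * H = (1 / 2 : ℂ) • (K ^ 3 - Ki)

theorem forall_borelRels_iff {p : ℂ} {H E K Ki : A} :
    (∀ r ∈ borelRels p H E K Ki, r.1 = r.2) ↔ IsBorel p H E K Ki := by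
  simp only [borelRels, List.forall_mem_cons, List.not_mem_nil, false_imp_iff, implies_true,
    and_true]
  exact ⟨fun ⟨h1, h2, h3, h4, h5, h6, h7, h8⟩ => ⟨h1, h2, h3, h4, h5, h6, h7, h8⟩,
    fun ⟨h1, h2, h3, h4, h5, h6, h7, h8⟩ => ⟨h1, h2, h3, h4, h5, h6, h7, h8⟩⟩

theorem JordanGens.isJordan_iff {p : ℂ} {g : JordanGens A} :
    g.IsJordan p ↔ IsBorel p g.H g.E g.K g.Ki ∧ ∀ r ∈ jordanExtraRels p g, r.1 = r.2 := by
  rw [JordanGens.IsJordan, jordanRels, List.forall_mem_append, forall_borelRels_iff]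

/-- The rule for the derivation `[a, ·]` on an inverse. It transfers every relation for `T` to
`T⁻¹`. -/
theorem inverse_commutator {R : Type*} [Ring R] {a t ti c : R} (h : a * t - t * a = c)
    (h1 : t * ti = 1) (h2 : ti * t = 1) : a * ti - ti * a = -(ti * c * ti) := by
  calc a * ti - ti * a = (ti * t) * (a * ti) - (ti * a) * (t * ti) := by rw [h1, h2]; simp
    _ = -(ti * (a * t - t * a) * ti) := by noncomm_ring
    _ = _ := by rw [h]

/-- The Leibniz rule gives `-p(TEF + FTE)`. Moving `T` to the left and using `{E, F} = -H` leaves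
`pTH + p²TE²`, and `p²TE²` is `(p/2)[H, T]` by the relations for `E²` and `[H, T]`. -/
theorem commutator_T_F_sq {p : ℂ} {T Ti H E F : A} (h1 : T * Ti = 1)
    (HT : H * T - T * H = T * T - 1)
    (EE : p • (E * E) = (1 / 2 : ℂ) • (T - Ti)) (EF : E * F + F * E = -H)
    (TF : T * F - F * T = p • (T * E)) :
    T * -(F * F) - -(F * F) * T = (p / 2) • (T * H + H * T) := by
  linear_combination (norm := skip) -(TF * F) - F * TF + p • (TF * E) - p • (T * EF) + p • (T * EE)
    - (p / 2) • HT - (p / 2) • h1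
  simp only [mul_add, add_mul, mul_sub, sub_mul, smul_mul_assoc, mul_smul_comm, neg_mul, mul_neg,
    mul_assoc, mul_one, one_mul]
  module

/-- Two Leibniz steps produce the term `F(T + T⁻¹)F`. Half of it is moved to each side of `F²`, and
the commutators picked up on the way are the terms with `T - T⁻¹`. -/
theorem commutator_H_F_sq {p : ℂ} {T Ti H E F : A} 
    (HF : H * F - F * H = -((1 / 4 : ℂ) • ((T + Ti) * F)) - (1 / 4 : ℂ) • (F * (T + Ti)))
    (TF : T * F - F * T = p • (T * E)) (TiF : Ti * F - F * Ti = -(p • (Ti * E)))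
    (TE : T * E = E * T) (TiE : Ti * E = E * Ti) :
    H * -(F * F) - -(F * F) * H = -((1 / 2 : ℂ) • ((T + Ti) * -(F * F)))
      - (1 / 2 : ℂ) • (-(F * F) * (T + Ti))
        - (p / 4) • (E * (T - Ti) * F) + (p / 4) • (F * (T - Ti) * E) := by
  linear_combination (norm := skip) -(HF * F) - F * HF - (1 / 4 : ℂ) • (TF * F) - (1 / 4 : ℂ) • (TiF * F)
    + (1 / 4 : ℂ) • (F * TF) + (1 / 4 : ℂ) • (F * TiF) - (p / 4) • (TE * F) + (p / 4) • (TiE * F)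
  simp only [mul_add, add_mul, mul_sub, sub_mul, smul_mul_assoc, mul_smul_comm, neg_mul, mul_neg,
    mul_assoc, mul_one, one_mul]
  module

theorem commutator_F_sq_E {T Ti H E F : A} 
    (HF : H * F - F * H = -((1 / 4 : ℂ) • ((T + Ti) * F)) - (1 / 4 : ℂ) • (F * (T + Ti)))
     (EF : E * F + F * E = -H) :
    -(F * F) * E - E * -(F * F) = (1 / 4 : ℂ) • ((T + Ti) * F) + (1 / 4 : ℂ) • (F * (T + Ti)) := by
  linear_combination (norm := skip) EF * F - F * EF - HF
  simp only [mul_add, add_mul, mul_sub, sub_mul, smul_mul_assoc, mul_smul_comm, neg_mul, mul_neg,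
    mul_assoc, mul_one, one_mul]
  module

/-- The relations between `H, E, K, K⁻¹` follow from those that involve neither `T⁻¹` nor `T`
explicitly. -/
theorem IsBorel.of {p : ℂ} {H E K Ki : A}
    (HE : H * E - E * H = (1 / 2 : ℂ) • ((K ^ 2 + Ki ^ 2) * E))
    (EE : E ^ 2 = (2 * p)⁻¹ • (K ^ 2 - Ki ^ 2)) (KKi : K * Ki = 1) (KiK : Ki * K = 1)
    (KE : K * E = E * K) (HK : H * K - K * H = (1 / 2 : ℂ) • (K ^ 3 - Ki)) :
    IsBorel p H E K Ki := by
  have HT : H * K ^ 2 - K ^ 2 * H = (K ^ 2) ^ 2 - 1 := by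
    have h : H * K ^ 2 - K ^ 2 * H = (H * K - K * H) * K + K * (H * K - K * H) := by noncomm_ring
    rw [h]
    linear_combination (norm := skip) HK * K + K * HK - (1 / 2 : ℂ) • KiK - (1 / 2 : ℂ) • KKi
    simp only [mul_add, add_mul, mul_sub, sub_mul, smul_mul_assoc, mul_smul_comm, pow_succ,
      pow_zero, one_mul, mul_assoc]
    module
  have T1 : K ^ 2 * Ki ^ 2 = 1 := by
    rw [pow_two, pow_two, mul_assoc, ← mul_assoc K Ki, KKi, one_mul, KKi]
  have T2 : Ki ^ 2 * K ^ 2 = 1 := by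
    rw [pow_two, pow_two, mul_assoc, ← mul_assoc Ki K, KiK, one_mul, KiK]
  refine ⟨HE, HT, ?_, EE, KKi, KiK, KE, HK⟩
  rw [inverse_commutator HT T1 T2, mul_sub, sub_mul, pow_two (K ^ 2), ← mul_assoc (Ki ^ 2), T2,
    one_mul, T1, mul_one, pow_two (Ki ^ 2)]
  abel


theorem pow_two_mul_pow_two {R : Type*} [Monoid R] {a b : R} (h : a * b = 1) :
    a ^ 2 * b ^ 2 = 1 := by
  rw [pow_two, pow_two, mul_assoc, ← mul_assoc a b, h, one_mul, h]

/-- The relations of the super-Jordanian algebra that contain `F` or `Y` all follow from three of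
them and `Y = -F²`. -/
theorem JordanGens.isJordan_of {p : ℂ} (hp : p ≠ 0) {g : JordanGens A}
    (hB : IsBorel p g.H g.E g.K g.Ki)
    (HF : g.H * g.F - g.F * g.H = -((1 / 4 : ℂ) • ((g.K ^ 2 + g.Ki ^ 2) * g.F))
      - (1 / 4 : ℂ) • (g.F * (g.K ^ 2 + g.Ki ^ 2)))
    (EF : g.E * g.F + g.F * g.E = -g.H)
    (KF : g.K * g.F - g.F * g.K = (p / 2) • (g.K * g.E)) (hY : g.Y = -g.F ^ 2) :
    g.IsJordan p := by
  obtain ⟨H, E, F, Y, K, Ki⟩ := g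
  simp only at hB HF EF KF hY
  subst hY
  refine JordanGens.isJordan_iff.2 ⟨hB, ?_⟩
  obtain ⟨HE, HT, HTi, EE, KKi, KiK, KE, HK⟩ := hB
  have TF : K ^ 2 * F - F * K ^ 2 = p • (K ^ 2 * E) := by
    linear_combination (norm := skip) KF * K + K * KF - (p / 2) • (K * KE)
    simp only [mul_add, add_mul, mul_sub, sub_mul, smul_mul_assoc, mul_smul_comm, pow_succ,
      pow_zero, one_mul, mul_assoc]
    module
  have KiE : Ki * E = E * Ki := by
    calc Ki * E = Ki * (E * K) * Ki := by rw [mul_assoc, mul_assoc E, KKi, mul_one]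
      _ = E * Ki := by rw [← KE, ← mul_assoc, KiK, one_mul]
  have TE : K ^ 2 * E = E * K ^ 2 := (show Commute K E from KE).pow_left 2
  have TiE : Ki ^ 2 * E = E * Ki ^ 2 := (show Commute Ki E from KiE).pow_left 2
  have h1 : K ^ 2 * Ki ^ 2 = 1 := pow_two_mul_pow_two KKi
  have h2 : Ki ^ 2 * K ^ 2 = 1 := pow_two_mul_pow_two KiK
  have EE' : p • (E * E) = (1 / 2 : ℂ) • (K ^ 2 - Ki ^ 2) := by
    rw [← pow_two, EE, smul_smul]
    congr 1
    field_simp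
  have TiF : Ki ^ 2 * F - F * Ki ^ 2 = -(p • (Ki ^ 2 * E)) := by
    -- The role of `a` is played by `F`, so `c` is `[F, T]`, with the sign opposite to `TF`.
    have h := inverse_commutator (a := F) (c := -(p • (K ^ 2 * E))) (by rw [← TF]; abel) h1 h2
    rw [mul_neg, mul_smul_comm, ← mul_assoc, h2, one_mul, neg_mul, neg_neg, smul_mul_assoc,
      ← TiE] at h
    rw [← h]; abel
  have TY : K ^ 2 * -F ^ 2 - -F ^ 2 * K ^ 2 = (p / 2) • (K ^ 2 * H + H * K ^ 2) := by
    rw [pow_two (K ^ 2)] at HT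
    rw [pow_two F]
    exact commutator_T_F_sq h1 HT EE' EF TF
  have TiY : Ki ^ 2 * -F ^ 2 - -F ^ 2 * Ki ^ 2 = -((p / 2) • (Ki ^ 2 * H + H * Ki ^ 2)) := by
    generalize -F ^ 2 = Y at TY ⊢
    have h := inverse_commutator (a := Y) (c := -((p / 2) • (K ^ 2 * H + H * K ^ 2)))
      (by rw [← TY]; abel) h1 h2
    rw [mul_neg, mul_smul_comm, mul_add, ← mul_assoc, h2, one_mul, neg_mul, neg_neg,
      smul_mul_assoc, add_mul, mul_assoc (Ki ^ 2), mul_assoc H, h1, mul_one] at h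
    rw [add_comm (Ki ^ 2 * H), ← h]; abel
  simp only [jordanExtraRels, List.forall_mem_cons, List.not_mem_nil, false_imp_iff, implies_true,
    and_true]
  refine ⟨HF, EF, ?_, TY, TiY, by rw [neg_neg], TF, TiF, ?_, KF⟩
  · rw [pow_two F]
    exact commutator_H_F_sq HF TF TiF TE TiE
  · rw [pow_two F]
    exact commutator_F_sq_E HF EF

end Relations

/-! ### The nonlinear map -/

section ContractionMap

open PowerSeries

variable {A : Type u} [Ring A] [Algebra ℂ A]

section

variable {e f h : A} (he : IsNilpotent e) (hhe : h * e - e * h = e)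
include hhe

theorem commutator_h_ev (φ : ℂ⟦X⟧) :
    h * ev (e ^ 2) (isNilpotent_sq he) φ - ev (e ^ 2) (isNilpotent_sq he) φ * h
      = (2 : ℂ) • (e ^ 2 * ev (e ^ 2) (isNilpotent_sq he) (d⁄dX ℂ φ)) := by
  rw [← smul_mul_assoc]
  apply commutator_ev
  · linear_combination (norm := skip) hhe * e + e * hhe
    simp only [mul_add, add_mul, mul_sub, sub_mul, pow_succ, pow_zero, one_mul, mul_assoc]
    module
  · exact (Commute.refl _).smul_left _

/-- The anticommutator relation yields an ordinary commutator `[f, e²] = -e`. It commutes with `e²`,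
so `commutator_ev` applies. -/
theorem commutator_f_ev (hef : e * f + f * e = -h) (φ : ℂ⟦X⟧) :
    f * ev (e ^ 2) (isNilpotent_sq he) φ - ev (e ^ 2) (isNilpotent_sq he) φ * f
      = -(e * ev (e ^ 2) (isNilpotent_sq he) (d⁄dX ℂ φ)) := by
  rw [← neg_mul]
  apply commutator_ev
  · linear_combination (norm := noncomm_ring) -e * hef + hef * e - hhe
  · exact ((Commute.refl e).pow_right 2).neg_left

end

theorem ev_Sser_mul_derivative_Tpow (p a : ℂ) {e : A} (he : IsNilpotent e) :
    ev (e ^ 2) (isNilpotent_sq he) (Sser p) * ev (e ^ 2) (isNilpotent_sq he) (d⁄dX ℂ (Tpow p a))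
      = (a * p) • unipPow a (tT p e) := by
  rw [← map_mul, Sser_mul_derivative_Tpow, map_mul, ev_C, unipPow_tT p a he, Algebra.smul_def]

theorem isBorel_tT {p : ℂ} (hp : p ≠ 0) {e h : A} (he : IsNilpotent e)
    (hhe : h * e - e * h = e) :
    IsBorel p (tH p e h) e (unipPow (1 / 2) (tT p e)) (unipPow (-1 / 2) (tT p e)) := by
  have hT := isNilpotent_tT_sub_one p he
  have hK : unipPow (1 / 2) (tT p e) ^ 2 = tT p e := unipPow_half_sq hT
  have hKi : unipPow (-1 / 2) (tT p e) ^ 2 = tTinv p e := unipPow_neg_half_sq hT (tTinv_mul_tT p he)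
  have hK1 : unipPow (1 / 2) (tT p e) * unipPow (-1 / 2) (tT p e) = 1 := by
    rw [← unipPow_add _ _ hT, ← unipPow_zero hT]; norm_num
  have hK2 : unipPow (-1 / 2) (tT p e) * unipPow (1 / 2) (tT p e) = 1 := by
    rw [← unipPow_add _ _ hT, ← unipPow_zero hT]; norm_num
  have hce : ∀ φ, Commute e (ev (e ^ 2) (isNilpotent_sq he) φ) := fun φ =>
    commute_ev _ ((Commute.refl e).pow_right 2) φ
  have hcx : ∀ φ, Commute (e ^ 2) (ev (e ^ 2) (isNilpotent_sq he) φ) := fun φ =>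
    (hce φ).pow_left 2
  have hEE : e ^ 2 = (2 * p)⁻¹ • (tT p e - tTinv p e) := by
    rw [tT_sub_tTinv, smul_smul, inv_mul_cancel₀ (by simpa using hp), one_smul]
  apply IsBorel.of
  · rw [hK, hKi, tT_add_tTinv p he, tH_eq p he, smul_mul_assoc, smul_smul]
    norm_num
    rw [mul_assoc, ← mul_assoc e, (hce _).eq, mul_assoc _ e, ← mul_sub, hhe]
  · rw [hK, hKi, hEE]
  · exact hK1
  · exact hK2
  · rw [unipPow_tT p _ he]; exact (hce _).symm.eq
  · have h3 : unipPow (1 / 2) (tT p e) ^ 3 - unipPow (-1 / 2) (tT p e)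
        = unipPow (1 / 2) (tT p e) * (tT p e - tTinv p e) := by
      rw [mul_sub, ← hKi, pow_two (unipPow (-1 / 2) _), ← mul_assoc, hK1, one_mul, pow_succ', hK]
    have h4 := commutator_h_ev he hhe (Tpow p (1 / 2))
    have h5 := ev_Sser_mul_derivative_Tpow p (1 / 2) he
    have hc : Commute (unipPow (1 / 2) (tT p e)) (ev (e ^ 2) (isNilpotent_sq he) (Sser p)) := by
      rw [unipPow_tT p _ he]
      exact ev_commute_ev _ _ (Commute.refl _) _ _
    rw [h3, tT_sub_tTinv, tH_eq p he, ← mul_assoc, hc.eq, mul_assoc, mul_assoc, ← mul_sub]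
    nth_rewrite 1 [unipPow_tT p _ he]
    nth_rewrite 1 [unipPow_tT p _ he]
    rw [h4, mul_smul_comm, ← mul_assoc, ← (hcx _).eq, mul_assoc, h5, unipPow_tT p _ he,
      mul_smul_comm, (hcx _).eq, mul_smul_comm]
    module

/-- The commutator of `H̃` with `F` in terms of classical commutators. -/
theorem commutator_tH_F {p : ℂ} (hp : p ≠ 0) {e f h F : A} (he : IsNilpotent e)
    (hhe : h * e - e * h = e)
    (hF : F = f + (p / 4) • (ev (e ^ 2) (isNilpotent_sq he) (Wser p) * e)
      - (p / 2) • (ev (e ^ 2) (isNilpotent_sq he) (Wser p) * e * h))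
    (hSF : ev (e ^ 2) (isNilpotent_sq he) (Sser p) * F - F * ev (e ^ 2) (isNilpotent_sq he) (Sser p)
      = p ^ 2 • (e ^ 2 * e)) :
    tH p e h * F - F * tH p e h
      + (1 / 2 : ℂ) • (ev (e ^ 2) (isNilpotent_sq he) (Sser p) * F
        + F * ev (e ^ 2) (isNilpotent_sq he) (Sser p))
      = ev (e ^ 2) (isNilpotent_sq he) (Sser p) * (h * f - f * h + f) := by
  -- With `X = e²`, the facts `hW` and `hV` evaluate `S[h, We] + SWe` to `2p e³`. No relation
  -- between `h` and `f` enters, so the identity can be read in both directions.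
  have hW := commutator_h_ev he hhe (Wser p)
  have hV := congrArg (ev (e ^ 2) (isNilpotent_sq he)) (Sser_mul_derivative_X_mul_Wser p hp)
  simp only [map_mul, map_add, ev_X, ev_C, ← Algebra.smul_def] at hV
  rw [tH_eq p he]
  generalize ev (e ^ 2) (isNilpotent_sq he) (Sser p) = S at *
  generalize ev (e ^ 2) (isNilpotent_sq he) (d⁄dX ℂ (Wser p)) = W' at *
  generalize ev (e ^ 2) (isNilpotent_sq he) (Wser p) = W at *
  have hSF' := hSF
  rw [hF] at hSF' ⊢
  linear_combination (norm := skip) hSF' * h - (1 / 2 : ℂ) • hSF'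
    + (p / 4) • (S * hW * e) + (p / 4) • (S * W * hhe) - (p / 2) • (S * hW * e * h)
    - (p / 2) • (S * W * hhe * h) + (p / 2) • (hV * e) - p • (hV * e * h)
  simp only [mul_add, add_mul, mul_sub, sub_mul, smul_mul_assoc, mul_smul_comm, neg_mul, mul_neg,
    mul_assoc]
  module

/-- Since `W` commutes with `e`, one finds `{e, Weh} = 2We²h + We²`. The term `(p/4)We` of `F`
cancels the last summand, and `pWe² = S - 1` turns the first into the difference of `H̃` and `h`.
Nothing is assumed about `f`, so both directions of the bijection use this. -/
theorem anticommutator_e_F {p : ℂ} {e f h F : A} (he : IsNilpotent e)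
    (hhe : h * e - e * h = e)
    (hF : F = f + (p / 4) • (ev (e ^ 2) (isNilpotent_sq he) (Wser p) * e)
      - (p / 2) • (ev (e ^ 2) (isNilpotent_sq he) (Wser p) * e * h)) :
    e * F + F * e + tH p e h = e * f + f * e + h := by
  have hW : Commute e (ev (e ^ 2) (isNilpotent_sq he) (Wser p)) :=
    commute_ev _ ((Commute.refl e).pow_right 2) _
  have hS := congrArg (ev (e ^ 2) (isNilpotent_sq he)) (C_mul_X_mul_Wser p)
  simp only [map_mul, map_sub, map_one, ev_X, ev_C, ← Algebra.smul_def] at hS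
  rw [smul_mul_assoc, (hW.pow_left 2).eq] at hS
  rw [tH_eq p he, hF]
  have hS' : ev (e ^ 2) (isNilpotent_sq he) (Sser p)
      = 1 + p • (ev (e ^ 2) (isNilpotent_sq he) (Wser p) * e ^ 2) := by rw [hS]; abel
  rw [hS']
  generalize ev (e ^ 2) (isNilpotent_sq he) (Wser p) = W at *
  have hW' : e * W - W * e = 0 := sub_eq_zero.2 hW.eq
  linear_combination (norm := skip) (p / 4) • (hW' * e) - (p / 2) • (hW' * e * h)
    - (p / 2) • (W * e * hhe)
  simp only [mul_add, add_mul, mul_sub, sub_mul, smul_mul_assoc, mul_smul_comm, neg_mul, mul_neg,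
    mul_assoc, pow_succ, pow_zero, one_mul, mul_zero, zero_mul]
  module

theorem contrMap_F {p : ℂ} {g : OspGens A} (he : IsNilpotent g.e) :
    (contrMap p g).F = g.f + (p / 4) • (ev (g.e ^ 2) (isNilpotent_sq he) (Wser p) * g.e)
      - (p / 2) • (ev (g.e ^ 2) (isNilpotent_sq he) (Wser p) * g.e * g.h) := by
  rw [← tT_sub_one_mul_inverse p he]
  rfl

/-- Here `S = ½(T̃ + T̃⁻¹)`. The commutators of `T̃` and `T̃⁻¹` with `F` have opposite signs, so the
sum is `(p/2)(T̃ - T̃⁻¹)e = p²e³`. -/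
theorem ev_Sser_commutator {p : ℂ} {e F : A} (he : IsNilpotent e)
    (hTF : tT p e * F - F * tT p e = p • (tT p e * e)) :
    ev (e ^ 2) (isNilpotent_sq he) (Sser p) * F - F * ev (e ^ 2) (isNilpotent_sq he) (Sser p)
      = p ^ 2 • (e ^ 2 * e) := by
  have h := inverse_commutator (a := F) (c := -(p • (tT p e * e))) (by rw [← hTF]; abel)
    (tT_mul_tTinv p he) (tTinv_mul_tT p he)
  have hc : Commute e (tTinv p e) := by
    rw [tTinv_eq_ev p he]; exact commute_ev _ ((Commute.refl e).pow_right 2) _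
  rw [mul_neg, mul_smul_comm, ← mul_assoc, tTinv_mul_tT p he, one_mul, neg_mul, neg_neg,
    smul_mul_assoc, hc.eq] at h
  have hS : ev (e ^ 2) (isNilpotent_sq he) (Sser p) = (1 / 2 : ℂ) • (tT p e + tTinv p e) := by
    rw [tT_add_tTinv p he, smul_smul]; norm_num
  have hd := tT_sub_tTinv p (e := e)
  rw [hS]
  linear_combination (norm := skip) (1 / 2 : ℂ) • hTF - (1 / 2 : ℂ) • h + (p / 2) • (hd * e)
  simp only [mul_add, add_mul, sub_mul, smul_mul_assoc, mul_smul_comm]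
  module

theorem contrMap_isJordan {p : ℂ} (hp : p ≠ 0) {g : OspGens A} (hg : g.IsOsp)
    (he : IsNilpotent g.e) : (contrMap p g).IsJordan p := by
  have hT := isNilpotent_tT_sub_one p he
  have hB := isBorel_tT hp he hg.he
  have hF := contrMap_F (p := p) he
  have hce : ∀ φ, Commute g.e (ev (g.e ^ 2) (isNilpotent_sq he) φ) := fun φ =>
    commute_ev _ ((Commute.refl g.e).pow_right 2) φ
  -- With `K'` the derived series, `[K, f] = eK'` and `[K, h] = -2e²K'`. Hence `[K, F] = e(1 +
  -- pe²W)K' = eSK'`, and `SK' = (p/2)K` by the differential equation.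
  have hKF : (contrMap p g).K * (contrMap p g).F - (contrMap p g).F * (contrMap p g).K
      = (p / 2) • ((contrMap p g).K * (contrMap p g).E) := by
    rw [hF]
    change unipPow (1 / 2) (tT p g.e) * _ - _ * unipPow (1 / 2) (tT p g.e)
      = (p / 2) • (unipPow (1 / 2) (tT p g.e) * g.e)
    have h1 := commutator_f_ev he hg.he hg.ef (Tpow p (1 / 2))
    have h2 := commutator_h_ev he hg.he (Tpow p (1 / 2))
    have h3 := ev_Sser_mul_derivative_Tpow p (1 / 2) he
    have hS := congrArg (ev (g.e ^ 2) (isNilpotent_sq he)) (C_mul_X_mul_Wser p)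
    simp only [map_mul, map_sub, map_one, ev_X, ev_C, ← Algebra.smul_def] at hS
    have hKW := ev_commute_ev (isNilpotent_sq he) (isNilpotent_sq he) (Commute.refl _)
      (Tpow p (1 / 2)) (Wser p)
    have hK'e := (hce (d⁄dX ℂ (Tpow p (1 / 2)))).eq
    have hKe := (hce (Tpow p (1 / 2))).eq
    have hWe := (hce (Wser p)).eq
    rw [unipPow_tT p _ he] at h3 ⊢
    have hS' : ev (g.e ^ 2) (isNilpotent_sq he) (Sser p)
      = 1 + p • (g.e ^ 2 * ev (g.e ^ 2) (isNilpotent_sq he) (Wser p)) := by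
      rw [← smul_mul_assoc, hS]; abel
    rw [hS'] at h3
    generalize ev (g.e ^ 2) (isNilpotent_sq he) (d⁄dX ℂ (Tpow p (1 / 2))) = K' at *
    generalize ev (g.e ^ 2) (isNilpotent_sq he) (Tpow p (1 / 2)) = K at *
    generalize ev (g.e ^ 2) (isNilpotent_sq he) (Wser p) = W at *
    have hKW := hKW.eq
    linear_combination (norm := skip) -h1 + (p / 4) • (hKW * g.e) - (p / 2) • (hKW * g.e * g.h)
      + (p / 4) • (W * (-hKe)) - (p / 2) • (W * (-hKe) * g.h) + (p / 2) • (W * g.e * h2)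
      + hK'e + h3 * g.e + p • (W * g.e ^ 2 * hK'e) - p • (g.e * hWe * K' * g.e)
      - p • (hWe * g.e * K' * g.e)
    simp only [mul_add, add_mul, mul_sub, sub_mul, smul_mul_assoc, mul_smul_comm, neg_mul, mul_neg,
      mul_assoc, pow_succ, pow_zero, one_mul]
    module
  have hKK : (contrMap p g).K * (contrMap p g).K = tT p g.e := unipPow_half_mul_self hT
  have hTF : tT p g.e * (contrMap p g).F - (contrMap p g).F * tT p g.e
      = p • (tT p g.e * g.e) := by
    have hKE : (contrMap p g).K * (contrMap p g).E = (contrMap p g).E * (contrMap p g).K := hB.KE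
    rw [← hKK]
    change _ = p • (_ * (contrMap p g).E)
    linear_combination (norm := skip) hKF * (contrMap p g).K + (contrMap p g).K * hKF
      - (p / 2) • ((contrMap p g).K * hKE)
    simp only [mul_add, add_mul, mul_sub, sub_mul, smul_mul_assoc, mul_smul_comm, mul_assoc]
    module
  have hST : ev (g.e ^ 2) (isNilpotent_sq he) (Sser p) = (1 / 2 : ℂ) • (tT p g.e + tTinv p g.e) := by
    rw [tT_add_tTinv p he, smul_smul]; norm_num
  refine JordanGens.isJordan_of hp hB ?_ ?_ hKF rfl
  · have h := commutator_tH_F hp he hg.he hF (ev_Sser_commutator he hTF)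
    have hf0 : g.h * g.f - g.f * g.h + g.f = 0 := by rw [hg.hf]; abel
    rw [hf0, mul_zero, hST] at h
    have hKi : (contrMap p g).Ki ^ 2 = tTinv p g.e := unipPow_neg_half_sq hT (tTinv_mul_tT p he)
    rw [hKi, pow_two, hKK]
    change tH p g.e g.h * _ - _ * tH p g.e g.h = _
    linear_combination (norm := skip) h
    simp only [mul_add, add_mul, mul_sub, sub_mul, smul_mul_assoc, mul_smul_comm, mul_assoc]
    module
  · have h := anticommutator_e_F he hg.he hF
    rw [hg.ef, neg_add_cancel] at h
    exact eq_neg_of_add_eq_zero_left h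

theorem isUnit_ev_Sser (p : ℂ) {e : A} (he : IsNilpotent e) :
    IsUnit (ev (e ^ 2) (isNilpotent_sq he) (Sser p)) :=
  isUnit_of_isNilpotent_sub_one (isNilpotent_ev_sub_one _ (constantCoeff_Sser p))

/-- The image shows `e` directly. Then `H̃ = S h` gives `h` because `S` is unipotent, and `F` gives
`f`. -/
theorem contrMap_injOn (p : ℂ) :
    Set.InjOn (contrMap (A := A) p) {g | g.IsOsp ∧ IsNilpotent g.e} := by
  rintro ⟨e, f, h⟩ ⟨-, he⟩ ⟨e', f', h'⟩ - heq
  obtain rfl : e = e' := congrArg JordanGens.E heq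
  have h1 : tH p e h = tH p e h' := congrArg JordanGens.H heq
  simp only at he
  rw [tH_eq p he, tH_eq p he] at h1
  obtain rfl : h = h' := (isUnit_ev_Sser p he).mul_left_cancel h1
  have h2 := congrArg JordanGens.F heq
  rw [contrMap_F he, contrMap_F he] at h2
  obtain rfl : f = f' := by simpa using h2
  rfl

/-- The map is solved backwards, `h = S⁻¹H` and `f` from the formula for `F`. The identities used
for the direct map then return the `osp(1|2)` relations. -/
theorem contrMap_surjOn {p : ℂ} (hp : p ≠ 0) :
    Set.SurjOn (contrMap (A := A) p) {g | g.IsOsp ∧ IsNilpotent g.e}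
      {G | G.IsJordan p ∧ IsNilpotent G.E ∧ IsNilpotent (G.K - 1)} := by
  rintro ⟨H, e, F, Y, K, Ki⟩ ⟨hJ, he, hK⟩
  simp only at he hK
  obtain ⟨⟨HE, HT, HTi, EE, KKi, KiK, KE, HK⟩, hX⟩ := JordanGens.isJordan_iff.1 hJ
  simp only at HE HT HTi EE KKi KiK KE HK
  simp only [jordanExtraRels, List.forall_mem_cons, List.not_mem_nil, false_imp_iff, implies_true,
    and_true] at hX
  obtain ⟨HF, EF, -, -, -, FF, TF, -, -, -⟩ := hX
  have hcKe : Commute K e := KE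
  have h1 : K ^ 2 * Ki ^ 2 = 1 := pow_two_mul_pow_two KKi
  have EE' : (2 * p) • e ^ 2 = K ^ 2 - Ki ^ 2 := by
    rw [EE, smul_smul, mul_inv_cancel₀ (by simpa using hp), one_smul]
  have hnT : IsNilpotent (K ^ 2 - 1) := by
    have : K ^ 2 - 1 = (K + 1) * (K - 1) := by noncomm_ring
    rw [this]
    exact Commute.isNilpotent_mul_left (by
      rw [commute_iff_eq]; noncomm_ring) hK
  have hcTe : Commute (K ^ 2) (p • e ^ 2) := (hcKe.pow_pow 2 2).smul_right p
  have hs : IsNilpotent (K ^ 2 - p • e ^ 2 - 1) := by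
    rw [sub_right_comm]
    exact Commute.isNilpotent_sub (hcTe.sub_left (Commute.one_left _)) hnT
      ((isNilpotent_sq he).smul p)
  -- The relation for `E²` says that `T - pe²` is a square root of `1 + p²e⁴`. It is unipotent, so
  -- it is the binomial one.
  have hT : K ^ 2 = tT p e := by
    have hsq : (K ^ 2 - p • e ^ 2) * (K ^ 2 - p • e ^ 2) = 1 + p ^ 2 • e ^ 4 := by
      have hcTe' := hcTe.eq
      generalize K ^ 2 = T at *
      have h3 : Ki ^ 2 = T - (2 * p) • e ^ 2 := by rw [EE']; abel
      rw [h3] at h1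
      linear_combination (norm := skip) h1 + hcTe'
      simp only [mul_add, add_mul, mul_sub, sub_mul, smul_mul_assoc, mul_smul_comm, neg_mul,
        mul_neg, mul_assoc, pow_succ, pow_zero, one_mul]
      module
    have := eq_unipPow_half hs (isNilpotent_one_add_sub_one p he) hsq
    rw [tT, ← this]; abel
  have hKeq : K = unipPow (1 / 2) (tT p e) := by
    rw [← hT]
    exact eq_unipPow_half hK hnT (pow_two K).symm
  have hTi : Ki ^ 2 = tTinv p e := by
    have := tT_sub_tTinv p (e := e)
    rw [EE', ← hT] at this
    simpa using this.symm
  have hnT' := isNilpotent_tT_sub_one p he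
  have hKieq : Ki = unipPow (-1 / 2) (tT p e) := by
    have h2 : K * unipPow (-1 / 2) (tT p e) = 1 := by
      rw [hKeq, ← unipPow_add _ _ hnT', ← unipPow_zero hnT']; norm_num
    calc Ki = Ki * (K * unipPow (-1 / 2) (tT p e)) := by rw [h2, mul_one]
      _ = _ := by rw [← mul_assoc, KiK, one_mul]
  obtain ⟨S, hS⟩ := isUnit_ev_Sser p he
  have hST : ev (e ^ 2) (isNilpotent_sq he) (Sser p) = (1 / 2 : ℂ) • (tT p e + tTinv p e) := by
    rw [tT_add_tTinv p he, smul_smul]; norm_num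
  have hSe : Commute e (S : A) := by
    rw [hS]; exact commute_ev _ ((Commute.refl e).pow_right 2) _
  obtain ⟨h, hh⟩ : ∃ h : A, h = (↑S⁻¹ : A) * H := ⟨_, rfl⟩
  have hH : tH p e h = H := by
    rw [tH_eq p he, ← hS, hh, Units.mul_inv_cancel_left]
  set W := ev (e ^ 2) (isNilpotent_sq he) (Wser p) with hW
  obtain ⟨f, hf⟩ : ∃ f : A, f = F - (p / 4) • (W * e) + (p / 2) • (W * e * h) := ⟨_, rfl⟩
  have hF : F = f + (p / 4) • (W * e) - (p / 2) • (W * e * h) := by rw [hf]; abel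
  have hhe : h * e - e * h = e := by
    have hSh : (S : A) * h = H := by rw [hh, Units.mul_inv_cancel_left]
    have h2 : (S : A) * (h * e - e * h) = S * h * e - e * (S * h) := by
      linear_combination (norm := noncomm_ring) hSe.eq * h
    apply S.isUnit.mul_left_cancel
    rw [h2, hSh, HE, hT, hTi, ← smul_mul_assoc, ← hST, hS]
  have hef : e * f + f * e = -h := by
    have := anticommutator_e_F he hhe hF
    rw [EF, hH, neg_add_cancel] at this
    exact eq_neg_of_add_eq_zero_left this.symm
  have hhf : h * f - f * h = -f := by
    rw [hT] at TF
    have := commutator_tH_F hp he hhe hF (ev_Sser_commutator he TF)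
    rw [hH, HF, hT, hTi, hST] at this
    rw [← hST, ← hS] at this
    -- The relation for `[H, F]` makes the left side of `commutator_tH_F` vanish, and `S` can be
    -- cancelled.
    have h0 : (S : A) * (h * f - f * h + f) = S * 0 := by
      rw [← this, mul_zero, hS, hST]
      simp only [mul_add, add_mul, smul_mul_assoc, mul_smul_comm]
      module
    exact eq_neg_of_add_eq_zero_left (S.isUnit.mul_left_cancel h0)
  refine ⟨⟨e, f, h⟩, ⟨OspGens.isOsp_of hhe hhf hef, he⟩, ?_⟩
  have hF' : (contrMap p ⟨e, f, h⟩).F = F := by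
    rw [contrMap_F (show IsNilpotent (OspGens.mk e f h).e from he), hF]
  apply JordanGens.ext
  · exact hH
  · rfl
  · exact hF'
  · change -(contrMap p ⟨e, f, h⟩).F ^ 2 = Y
    rw [hF', FF, neg_neg]
  · exact hKeq.symm
  · exact hKieq.symm

theorem contrMap_bijOn {p : ℂ} (hp : p ≠ 0) :
    Set.BijOn (contrMap (A := A) p) {g | g.IsOsp ∧ IsNilpotent g.e}
      {G | G.IsJordan p ∧ IsNilpotent G.E ∧ IsNilpotent (G.K - 1)} :=
  ⟨fun _ hg => ⟨contrMap_isJordan hp hg.1 hg.2, hg.2,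
    isNilpotent_unipPow_sub_one _ (isNilpotent_tT_sub_one p hg.2)⟩,
    contrMap_injOn p, contrMap_surjOn hp⟩

end ContractionMap

/-! ### The matrices of the spin `n / 2` representations -/

section Representations

/-- The lowering matrix with `|k⟩ ↦ c k |k + 1⟩`. -/
def lowerMat (n : ℕ) (c : ℕ → ℂ) : Mat n :=
  Matrix.of fun i k => if (i : ℕ) = k + 1 then c k else 0

theorem repE_mul_apply (n : ℕ) (M : Mat n) (i k : Fin (2 * n + 1)) :
    (repE n * M) i k = if h : (i : ℕ) + 1 < 2 * n + 1 then M ⟨i + 1, h⟩ k else 0 := by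
  rw [Matrix.mul_apply]
  split_ifs with h
  · rw [Finset.sum_eq_single ⟨i + 1, h⟩]
    · simp [repE]
    · intro j _ hj
      have : (i : ℕ) + 1 ≠ j := fun h' => hj (Fin.ext h'.symm)
      simp [repE, this]
    · simp
  · apply Finset.sum_eq_zero
    intro j _
    have : (i : ℕ) + 1 ≠ j := fun h' => h (h' ▸ j.2)
    simp [repE, this]

theorem mul_repE_apply (n : ℕ) (M : Mat n) (i k : Fin (2 * n + 1)) :
    (M * repE n) i k = if 0 < (k : ℕ) then M i ⟨k - 1, by omega⟩ else 0 := by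
  rw [Matrix.mul_apply]
  split_ifs with h
  · rw [Finset.sum_eq_single ⟨k - 1, by omega⟩]
    · have : (k : ℕ) - 1 + 1 = k := by omega
      simp [repE, this]
    · intro j _ hj
      have : (j : ℕ) + 1 ≠ k := fun h' => hj (Fin.ext (by simp only; omega))
      simp [repE, this]
    · simp
  · apply Finset.sum_eq_zero
    intro j _
    have : (j : ℕ) + 1 ≠ k := by omega
    simp [repE, this]

theorem repE_pow_apply (n m : ℕ) (i k : Fin (2 * n + 1)) :
    (repE n ^ m) i k = if (i : ℕ) + m = k then 1 else 0 := by
  induction m generalizing i with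
  | zero => simp [Matrix.one_apply, Fin.ext_iff]
  | succ m ih =>
    rw [pow_succ', repE_mul_apply]
    split_ifs with h1 h2 h2
    · rw [ih, if_pos (by simp only; omega)]
    · rw [ih, if_neg (by simp only; omega)]
    · omega
    · rfl

theorem repE_pow_eq_zero (n : ℕ) {m : ℕ} (hm : 2 * n + 1 ≤ m) : repE n ^ m = 0 := by
  ext i k
  rw [repE_pow_apply, if_neg (by omega), Matrix.zero_apply]

theorem isNilpotent_repE (n : ℕ) : IsNilpotent (repE n) := ⟨_, repE_pow_eq_zero n le_rfl⟩

theorem repE_sq_pow_eq_zero (n : ℕ) : (repE n ^ 2) ^ (2 * n + 1) = 0 := by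
  rw [← pow_mul]
  exact repE_pow_eq_zero n (by omega)

/-- The condition `c (2 * n) = 0` expresses that the lowest vector is annihilated, so that the last
diagonal entry obeys the general formula. -/
theorem anticommutator_repE_lowerMat (n : ℕ) (c : ℕ → ℂ) (hc : c (2 * n) = 0) :
    repE n * lowerMat n c + lowerMat n c * repE n
      = Matrix.diagonal fun k : Fin (2 * n + 1) => c k + if 0 < (k : ℕ) then c (k - 1) else 0 := by
  ext i k
  rw [Matrix.add_apply, repE_mul_apply, mul_repE_apply, Matrix.diagonal_apply]
  by_cases hik : i = k
  · subst hik
    rw [if_pos rfl]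
    congr 1
    · split_ifs with h
      · simp [lowerMat]
      · have : (i : ℕ) = 2 * n := by omega
        rw [this, hc]
    · split_ifs with h
      · have : (i : ℕ) = i - 1 + 1 := by omega
        simp only [lowerMat, Matrix.of_apply]
        rw [if_pos this]
      · rfl
  · have hik' : (i : ℕ) ≠ k := fun h => hik (Fin.ext h)
    rw [if_neg hik]
    have h1 : (if h : (i : ℕ) + 1 < 2 * n + 1 then lowerMat n c ⟨i + 1, h⟩ k else 0) = 0 := by
      split_ifs with h
      · simp [lowerMat, hik']
      · rfl
    have h2 : (if 0 < (k : ℕ) then lowerMat n c i ⟨k - 1, by omega⟩ else 0) = 0 := by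
      split_ifs with h
      · have : (i : ℕ) ≠ k - 1 + 1 := by omega
        simp only [lowerMat, Matrix.of_apply]
        rw [if_neg this]
      · rfl
    rw [h1, h2, add_zero]

/-- The matrix elements of the classical `f`. -/
def fCoeff (n k : ℕ) : ℂ :=
  if Even k then -(((2 * n - k : ℤ) / 2 : ℤ) : ℂ) else ((((k : ℤ) + 1) / 2 : ℤ) : ℂ)

theorem repF_eq (n : ℕ) : repF n = lowerMat n (fCoeff n) := rfl

theorem fCoeff_even (n i : ℕ) : fCoeff n (2 * i) = -((n : ℂ) - i) := by
  have h : (2 * (n : ℤ) - ((2 * i : ℕ) : ℤ)) / 2 = n - i := by push_cast; omega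
  rw [fCoeff, if_pos (even_two_mul i), h]
  push_cast; ring

theorem fCoeff_odd (n i : ℕ) : fCoeff n (2 * i + 1) = i + 1 := by
  have h : (((2 * i + 1 : ℕ) : ℤ) + 1) / 2 = i + 1 := by push_cast; omega
  rw [fCoeff, if_neg (Nat.not_even_bit1 i), h]
  push_cast; ring

theorem fCoeff_add (n k : ℕ) :
    fCoeff n k + (if 0 < k then fCoeff n (k - 1) else 0) = -((n : ℂ) - k) := by
  rcases Nat.even_or_odd' k with ⟨i, rfl | rfl⟩
  · rcases i with _ | i
    · simp [show fCoeff n 0 = -(n : ℂ) by simpa using fCoeff_even n 0]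
    · rw [if_pos (by omega), show 2 * (i + 1) - 1 = 2 * i + 1 by omega, fCoeff_even, fCoeff_odd]
      push_cast; ring
  · rw [if_pos (by omega), show 2 * i + 1 - 1 = 2 * i by omega, fCoeff_even, fCoeff_odd]
    push_cast; ring

theorem repOsp_isOsp (n : ℕ) : (repOsp n).IsOsp := by
  apply OspGens.isOsp_of
  · ext i k
    change (repH n * repE n - repE n * repH n) i k = repE n i k
    rw [Matrix.sub_apply, repH, Matrix.diagonal_mul, Matrix.mul_diagonal]
    simp only [repE, Matrix.of_apply]
    split_ifs with h
    · simp only [weight, ← h]; push_cast; ring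
    · ring
  · ext i k
    change (repH n * repF n - repF n * repH n) i k = -repF n i k
    rw [Matrix.sub_apply, repF_eq, repH, Matrix.diagonal_mul, Matrix.mul_diagonal]
    simp only [lowerMat, Matrix.of_apply]
    split_ifs with h
    · simp only [weight, h]; push_cast; ring
    · ring
  · change repE n * repF n + repF n * repE n = -repH n
    rw [repF_eq, anticommutator_repE_lowerMat n (fCoeff n) (by rw [fCoeff_even]; ring), repH,
      Matrix.diagonal_neg]
    congr 1
    funext k
    rw [fCoeff_add]
    simp [weight]

end Representations

/-! ### The limit of `f̂` -/

section Limits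

theorem tendsto_slope_one {f : ℂ → ℂ} {f' : ℂ} (h : HasDerivAt f f' 1) :
    Tendsto (fun q => (f q - f 1) / (q - 1)) (𝓝[≠] 1) (𝓝 f') := by
  have := hasDerivAt_iff_tendsto_slope.1 h
  refine this.congr fun q => ?_
  rw [slope_def_field]

theorem tendsto_nhdsNE {f : ℂ → ℂ} {a : ℂ} (h : ContinuousAt f 1) (ha : f 1 = a) :
    Tendsto f (𝓝[≠] 1) (𝓝 a) := ha ▸ h.tendsto.mono_left nhdsWithin_le_nhds

theorem eventually_ne_one : ∀ᶠ q : ℂ in 𝓝[≠] 1, q ≠ 1 := self_mem_nhdsWithin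

theorem eventually_ne_zero : ∀ᶠ q : ℂ in 𝓝[≠] 1, q ≠ 0 :=
  nhdsWithin_le_nhds (isOpen_ne.mem_nhds one_ne_zero)

theorem eventually_sub_inv_ne_zero : ∀ᶠ q : ℂ in 𝓝[≠] 1, q - q⁻¹ ≠ 0 := by
  have h : ∀ᶠ q : ℂ in 𝓝[≠] 1, q ≠ -1 :=
    nhdsWithin_le_nhds (isOpen_ne.mem_nhds (by norm_num))
  filter_upwards [eventually_ne_one, eventually_ne_zero, h] with q h1 h0 h2 h3
  have : (q - 1) * (q + 1) = 0 := by
    have : q * (q - q⁻¹) = 0 := by rw [h3, mul_zero]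
    rw [mul_sub, mul_inv_cancel₀ h0] at this
    linear_combination this
  rcases mul_eq_zero.1 this with h | h
  · exact h1 (sub_eq_zero.1 h)
  · exact h2 (eq_neg_of_add_eq_zero_left h)

theorem hasDerivAt_zpow_one (x : ℤ) : HasDerivAt (fun q : ℂ => q ^ x) x 1 := by
  simpa using hasDerivAt_zpow x (1 : ℂ) (Or.inl one_ne_zero)

theorem tendsto_sub_inv_div : Tendsto (fun q : ℂ => (q - q⁻¹) / (q - 1)) (𝓝[≠] 1) (𝓝 2) := by
  have h : HasDerivAt (fun q : ℂ => q ^ (1 : ℤ) - q ^ (-1 : ℤ)) ((1 : ℤ) - (-1 : ℤ) : ℂ) 1 :=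
    (hasDerivAt_zpow_one 1).sub (hasDerivAt_zpow_one (-1))
  have := tendsto_slope_one h
  norm_num at this
  exact this

theorem tendsto_qNum (x : ℤ) : Tendsto (fun q => qNum q x) (𝓝[≠] 1) (𝓝 (x : ℂ)) := by
  have h : HasDerivAt (fun q : ℂ => q ^ x - q ^ (-x)) ((x : ℂ) - (-x : ℤ)) 1 :=
    (hasDerivAt_zpow_one x).sub (hasDerivAt_zpow_one (-x))
  have h2 := (tendsto_slope_one h).div tendsto_sub_inv_div two_ne_zero
  have e : ((x : ℂ) - (-x : ℤ)) / 2 = x := by push_cast; ring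
  rw [e] at h2
  refine h2.congr' ?_
  filter_upwards [eventually_ne_one] with q hq
  have : q - 1 ≠ 0 := sub_ne_zero.2 hq
  simp only [one_zpow, sub_self, sub_zero, Pi.div_apply, qNum]
  rw [div_div_div_cancel_right₀ this]

theorem continuousAt_qHalf : ContinuousAt qHalf 1 :=
  continuousAt_id.cpow continuousAt_const (by simp)

theorem qHalf_one : qHalf 1 = 1 := by simp [qHalf]

theorem qHalf_sq (q : ℂ) : qHalf q ^ 2 = q := by
  rw [qHalf, ← Complex.cpow_nat_mul]
  norm_num

theorem qHalf_ne_zero {q : ℂ} (hq : q ≠ 0) : qHalf q ≠ 0 := by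
  intro h
  apply hq
  rw [← qHalf_sq q, h]; ring

theorem tendsto_qHalf_zpow (x : ℤ) : Tendsto (fun q => qHalf q ^ x) (𝓝[≠] 1) (𝓝 1) := by
  apply tendsto_nhdsNE
  · exact continuousAt_qHalf.zpow₀ x (Or.inl (by rw [qHalf_one]; exact one_ne_zero))
  · rw [qHalf_one, one_zpow]

/-- For odd `t` the numerator is a sum of two terms that tend to `1`. Only odd arguments occur in
the matrix elements of `f̂`. -/
theorem tendsto_qNum2_odd (t : ℤ) (ht : Odd t) :
    Tendsto (fun q => qNum2 q t) (𝓝[≠] 1) (𝓝 1) := by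
  have h1 := ((tendsto_qHalf_zpow t).add (tendsto_qHalf_zpow (-t))).div
    ((tendsto_qHalf_zpow 1).add (tendsto_qHalf_zpow (-1))) (by norm_num)
  rw [div_self (by norm_num)] at h1
  refine h1.congr fun q => ?_
  simp only [Pi.div_apply, qNum2, ht.neg_one_zpow, zpow_one, zpow_neg]
  ring

/-- The matrix elements of the deformed `f̂`. -/
def fqCoeff (n : ℕ) (q : ℂ) (k : ℕ) : ℂ :=
  if Even k then -(qNum q ((2 * n - k : ℤ) / 2) * qNum2 q ((k : ℤ) + 1))
    else qNum2 q (2 * n - k : ℤ) * qNum q (((k : ℤ) + 1) / 2)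

theorem repFq_eq (n : ℕ) (q : ℂ) : repFq n q = lowerMat n (fqCoeff n q) := rfl

theorem tendsto_fqCoeff (n k : ℕ) :
    Tendsto (fun q => fqCoeff n q k) (𝓝[≠] 1) (𝓝 (fCoeff n k)) := by
  by_cases hk : Even k
  · simp only [fqCoeff, fCoeff, if_pos hk]
    have := ((tendsto_qNum ((2 * n - k : ℤ) / 2)).mul
      (tendsto_qNum2_odd ((k : ℤ) + 1) (by exact_mod_cast hk.add_one))).neg
    rwa [mul_one] at this
  · simp only [fqCoeff, fCoeff, if_neg hk]
    have hk' : Odd (k : ℤ) := by exact_mod_cast Nat.not_even_iff_odd.1 hk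
    have := ((tendsto_qNum2_odd (2 * n - k : ℤ) ((even_two_mul (n : ℤ)).sub_odd hk')).mul
      (tendsto_qNum (((k : ℤ) + 1) / 2)))
    rwa [one_mul] at this

theorem tendsto_repFq (n : ℕ) : Tendsto (repFq n) (𝓝[≠] 1) (𝓝 (repF n)) := by
  rw [repF_eq]
  refine tendsto_pi_nhds.2 fun i => tendsto_pi_nhds.2 fun k => ?_
  simp only [repFq_eq, lowerMat, Matrix.of_apply]
  split_ifs with h
  · exact tendsto_fqCoeff n k
  · exact tendsto_const_nhds

/-- `ω {ê, f̂} = -(q^ĥ - q^{-ĥ})`. -/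
theorem anticommutator_repE_repFq (n : ℕ) {q : ℂ} (h0 : q ≠ 0) (h1 : q - q⁻¹ ≠ 0)
    (h2 : qHalf q + (qHalf q)⁻¹ ≠ 0) :
    (q - q⁻¹) • (repE n * repFq n q + repFq n q * repE n)
      = -(repQH n q 2 0 - repQH n q (-2) 0) := by
  have hs0 := qHalf_ne_zero h0
  have hsq := qHalf_sq q
  have hqz : ∀ x : ℤ, q ^ x = qHalf q ^ x * qHalf q ^ x := fun x => by
    nth_rewrite 1 [← hsq]
    rw [pow_two, mul_zpow]
  have hdd : ∀ a b : ℂ, a / (q - q⁻¹) * (b / (qHalf q + (qHalf q)⁻¹))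
      * ((q - q⁻¹) * (qHalf q + (qHalf q)⁻¹)) = a * b := fun a b => by
    rw [div_mul_div_comm, div_mul_cancel₀ _ (mul_ne_zero h1 h2)]
  -- With `s = q^{1/2}`, each matrix element splits into a constant made of `s^{±(2n+1)}` and a term
  -- made of `s^{±(2n-2k-1)}`. The constant has opposite signs for even and odd `k`, so it cancels
  -- between neighbours; the remaining two terms combine to `(s + s⁻¹)(q^{n-k} - q^{k-n})`.
  have hev : ∀ i : ℕ, fqCoeff n q (2 * i) * ((q - q⁻¹) * (qHalf q + (qHalf q)⁻¹))
      = -((qHalf q ^ (2 * n + 1 : ℤ) - qHalf q ^ (-(2 * n + 1) : ℤ))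
        + (qHalf q ^ (2 * n - 2 * (2 * i) - 1 : ℤ) - qHalf q ^ (-(2 * n - 2 * (2 * i) - 1) : ℤ))) := by
    intro i
    have e1 : (2 * (n : ℤ) - ((2 * i : ℕ) : ℤ)) / 2 = n - i := by push_cast; omega
    rw [fqCoeff, if_pos (even_two_mul i), e1, qNum, qNum2, hqz, hqz]
    have e2 : (-1 : ℂ) ^ (((2 * i : ℕ) : ℤ) + 1) = -1 := by
      apply Odd.neg_one_zpow; push_cast; exact odd_two_mul_add_one _
    rw [e2, neg_mul, hdd]
    push_cast
    simp only [neg_mul, neg_add_rev, neg_sub, zpow_sub₀ hs0, zpow_add₀ hs0, zpow_neg, two_mul, zpow_one]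
    field_simp
    ring
  have hod : ∀ i : ℕ, fqCoeff n q (2 * i + 1) * ((q - q⁻¹) * (qHalf q + (qHalf q)⁻¹))
      = (qHalf q ^ (2 * n + 1 : ℤ) - qHalf q ^ (-(2 * n + 1) : ℤ))
        - (qHalf q ^ (2 * n - 2 * (2 * i + 1) - 1 : ℤ)
          - qHalf q ^ (-(2 * n - 2 * (2 * i + 1) - 1) : ℤ)) := by
    intro i
    have e1 : (((2 * i + 1 : ℕ) : ℤ) + 1) / 2 = i + 1 := by push_cast; omega
    rw [fqCoeff, if_neg (Nat.not_even_bit1 i), e1, qNum, qNum2, hqz, hqz]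
    have e2 : (-1 : ℂ) ^ (2 * (n : ℤ) - ((2 * i + 1 : ℕ) : ℤ)) = -1 := by
      apply Odd.neg_one_zpow; push_cast
      exact (even_two_mul (n : ℤ)).sub_odd (odd_two_mul_add_one _)
    rw [e2, mul_comm (_ / (qHalf q + _)), hdd]
    push_cast
    simp only [neg_mul, neg_add_rev, neg_sub, zpow_sub₀ hs0, zpow_add₀ hs0, zpow_neg, two_mul, zpow_one]
    field_simp
    ring
  rw [repFq_eq, anticommutator_repE_lowerMat]
  · rw [repQH, repQH, Matrix.diagonal_sub, Matrix.diagonal_neg, ← Matrix.diagonal_smul]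
    congr 1
    funext k
    simp only [Pi.smul_apply, smul_eq_mul, add_zero, weight]
    apply mul_right_cancel₀ h2
    generalize (k : ℕ) = k
    rcases Nat.even_or_odd' k with ⟨i, rfl | rfl⟩
    · rcases i with _ | i
      · rw [if_neg (by simp), add_zero]
        have := hev 0
        push_cast at this ⊢
        rw [mul_comm (q - q⁻¹), mul_assoc, this]
        simp only [neg_mul, neg_add_rev, neg_sub, zpow_sub₀ hs0, zpow_add₀ hs0, zpow_neg, two_mul, zpow_one]
        field_simp
        ring
      · have a1 := hev (i + 1)
        have a2 := hod i
        rw [if_pos (by omega), show 2 * (i + 1) - 1 = 2 * i + 1 by omega]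
        rw [mul_comm (q - q⁻¹), mul_assoc, add_mul, a1, a2]
        push_cast
        simp only [neg_mul, neg_add_rev, neg_sub, zpow_sub₀ hs0, zpow_add₀ hs0, zpow_neg, two_mul, zpow_one]
        field_simp
        ring
    · have a1 := hod i
      have a2 := hev i
      rw [if_pos (by omega), show 2 * i + 1 - 1 = 2 * i by omega]
      rw [mul_comm (q - q⁻¹), mul_assoc, add_mul, a1, a2]
      push_cast
      simp only [neg_mul, neg_add_rev, neg_sub, zpow_sub₀ hs0, zpow_add₀ hs0, zpow_neg, two_mul, zpow_one]
      field_simp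
      ring
  -- The coefficient at the lowest vector vanishes since the two terms of `hev` are opposite there.
  · have := hev n
    have h3 := mul_ne_zero h1 h2
    apply mul_right_cancel₀ h3
    rw [this]
    simp only [neg_mul, neg_add_rev, neg_sub, zpow_sub₀ hs0, zpow_add₀ hs0, zpow_neg, two_mul, zpow_one]
    field_simp
    ring

end Limits

/-! ### Ratios of deformed exponentials and their limits -/

section DeformedExponential

open PowerSeries

/-- The series of `E_{q²}(p X / (q² - 1))`. -/
def Gser (p q : ℂ) : ℂ⟦X⟧ :=
  PowerSeries.mk fun k => (p / (q ^ 2 - 1)) ^ k * (qFact (q ^ 2) k)⁻¹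

/-- The series of `E_{q²}(p X / (q² - 1))⁻¹ E_{q²}(c p X / (q² - 1))`. -/
def Bser (p q c : ℂ) : ℂ⟦X⟧ := rescale c (Gser p q) * (Gser p q)⁻¹

variable (p q c : ℂ)

@[simp]
theorem constantCoeff_Gser : constantCoeff (Gser p q) = 1 := by
  rw [← coeff_zero_eq_constantCoeff_apply, Gser, coeff_mk]
  simp [qFact]

theorem constantCoeff_Gser_ne_zero : constantCoeff (Gser p q) ≠ 0 := by simp

@[simp]
theorem constantCoeff_rescale_Gser : constantCoeff (rescale c (Gser p q)) = 1 := by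
  rw [← coeff_zero_eq_constantCoeff_apply, coeff_rescale]
  simp

@[simp]
theorem coeff_zero_Bser : coeff 0 (Bser p q c) = 1 := by
  rw [coeff_zero_eq_constantCoeff_apply, Bser, map_mul, constantCoeff_rescale_Gser, constantCoeff_inv,
    constantCoeff_Gser]
  simp

theorem Bser_mul_Gser : Bser p q c * Gser p q = rescale c (Gser p q) := by
  rw [Bser, mul_assoc, PowerSeries.inv_mul_cancel _ (constantCoeff_Gser_ne_zero p q), mul_one]

theorem rescale_Bser_mul (d : ℂ) :
    rescale d (Bser p q c) * rescale d (Gser p q) = rescale (c * d) (Gser p q) := by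
  rw [← map_mul, Bser_mul_Gser, rescale_rescale]

theorem Gser_ne_zero : Gser p q ≠ 0 := by
  intro h
  apply constantCoeff_Gser_ne_zero p q
  rw [h, map_zero]

/-- Telescoping: `G(cdX)/G(dX)` times `G(dX)/G(X)`. -/
theorem rescale_Bser_mul_Bser (d : ℂ) :
    rescale d (Bser p q c) * Bser p q d = Bser p q (c * d) := by
  apply mul_right_cancel₀ (Gser_ne_zero p q)
  rw [mul_assoc, Bser_mul_Gser, rescale_Bser_mul, Bser_mul_Gser]

theorem Bser_one : Bser p q 1 = 1 := by
  rw [Bser, rescale_one, RingHom.id_apply,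
    PowerSeries.mul_inv_cancel _ (constantCoeff_Gser_ne_zero p q)]

variable {p q c}

theorem qFact_succ (Q : ℂ) (k : ℕ) : qFact Q (k + 1) = qFact Q k * qNum Q ((k : ℤ) + 1) := by
  rw [qFact, Finset.prod_range_succ, qFact]

/-- The difference equation of the deformed exponential: `q^{2(m+1)} - q^{-2(m+1)}` is a multiple of
`[m+1]`, which cancels one factor of the factorial. It is stated only up to order `N` because the
cancellation needs `[m+1] ≠ 0`, which may fail at roots of unity. -/
theorem X_pow_dvd_Gser {N : ℕ} (hq : q ^ 2 ≠ 1) (hd : q ^ 2 - (q ^ 2)⁻¹ ≠ 0) (h0 : q ≠ 0)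
    (hN : ∀ k < N, qNum (q ^ 2) ((k : ℤ) + 1) ≠ 0) :
    X ^ N ∣ rescale (q ^ 2) (Gser p q) - rescale (q ^ 2)⁻¹ (Gser p q)
      - C (p * (1 + (q ^ 2)⁻¹)) * X * Gser p q := by
  rw [X_pow_dvd_iff]
  intro m hm
  rw [map_sub, map_sub, coeff_rescale, coeff_rescale, mul_assoc, coeff_C_mul]
  rcases m with _ | m
  · simp
  · rw [coeff_succ_X_mul, Gser, coeff_mk, coeff_mk, qFact_succ]
    have h1 := hN m (by omega)
    have h2 : qNum (q ^ 2) ((m : ℤ) + 1) * (q ^ 2 - (q ^ 2)⁻¹)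
        = (q ^ 2) ^ (m + 1) - (q ^ 2)⁻¹ ^ (m + 1) := by
      rw [qNum, div_mul_cancel₀ _ hd, zpow_neg, inv_pow]
      norm_cast
    have h3 : p / (q ^ 2 - 1) * (q ^ 2 - (q ^ 2)⁻¹) = p * (1 + (q ^ 2)⁻¹) := by
      have : q ^ 2 - 1 ≠ 0 := sub_ne_zero.2 hq
      field_simp
      ring
    rw [← sub_mul, ← h2, ← h3, mul_inv]
    generalize qNum (q ^ 2) ((m : ℤ) + 1) = a at *
    linear_combination ((q ^ 2 - (q ^ 2)⁻¹) * (p / (q ^ 2 - 1)) ^ (m + 1) * (qFact (q ^ 2) m)⁻¹)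
      * mul_inv_cancel₀ h1

theorem X_pow_dvd_Bser_sub {N : ℕ} (hq : q ^ 2 ≠ 1) (hd : q ^ 2 - (q ^ 2)⁻¹ ≠ 0) (h0 : q ≠ 0)
    (hN : ∀ k < N, qNum (q ^ 2) ((k : ℤ) + 1) ≠ 0) :
    X ^ N ∣ Bser p q (q ^ 2) - Bser p q (q ^ 2)⁻¹ - C (p * (1 + (q ^ 2)⁻¹)) * X := by
  have h := (X_pow_dvd_Gser (p := p) hq hd h0 hN).mul_right (Gser p q)⁻¹
  have e := PowerSeries.mul_inv_cancel _ (constantCoeff_Gser_ne_zero p q)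
  convert h using 1
  rw [Bser, Bser]
  linear_combination (C (p * (1 + (q ^ 2)⁻¹)) * X) * e

/-- The cocycle identity makes `B_{q⁻²}(X)` the inverse of `φ(q⁻²X)` with `φ = B_{q²}`. The
difference equation thus closes on `φ` alone, as `φ(rX)φ(X) = 1 + bXφ(rX)` with `r = q⁻²`. -/
theorem X_pow_dvd_Bser_mul {N : ℕ} (hq : q ^ 2 ≠ 1) (hd : q ^ 2 - (q ^ 2)⁻¹ ≠ 0) (h0 : q ≠ 0)
    (hN : ∀ k < N, qNum (q ^ 2) ((k : ℤ) + 1) ≠ 0) :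
    X ^ N ∣ rescale (q ^ 2)⁻¹ (Bser p q (q ^ 2)) * Bser p q (q ^ 2) - 1
      - C (p * (1 + (q ^ 2)⁻¹)) * (X * rescale (q ^ 2)⁻¹ (Bser p q (q ^ 2))) := by
  have h := (X_pow_dvd_Bser_sub (p := p) hq hd h0 hN).mul_left
    (rescale (q ^ 2)⁻¹ (Bser p q (q ^ 2)))
  have e := rescale_Bser_mul_Bser p q (q ^ 2) (q ^ 2)⁻¹
  rw [mul_inv_cancel₀ (pow_ne_zero 2 h0), Bser_one] at e
  convert h using 1
  linear_combination e

/-- The recursion for the coefficients of a series `φ` with `φ(r X) φ(X) = 1 + b X φ(r X)`. -/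
theorem coeff_succ_of_dvd {φ : ℂ⟦X⟧} {r b : ℂ} {k : ℕ} (h0 : coeff 0 φ = 1)
    (h : X ^ (k + 2) ∣ rescale r φ * φ - 1 - C b * (X * rescale r φ)) :
    coeff (k + 1) φ * (1 + r ^ (k + 1)) = b * (r ^ k * coeff k φ)
      - ∑ i ∈ Finset.range k, r ^ (i + 1) * coeff (i + 1) φ * coeff (k - i) φ := by
  have h1 := X_pow_dvd_iff.1 h (k + 1) (by omega)
  rw [map_sub, map_sub, coeff_mul, Finset.Nat.sum_antidiagonal_eq_sum_range_succ_mk,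
    coeff_C_mul, coeff_succ_X_mul, coeff_rescale, PowerSeries.coeff_one, if_neg (by omega),
    Finset.sum_range_succ, Finset.sum_range_succ'] at h1
  simp only [coeff_rescale, pow_zero, one_mul, h0, Nat.sub_zero, Nat.sub_self, mul_one,
    Nat.add_sub_add_right] at h1
  linear_combination h1

/-- The degenerate case `r = 1`, `b = 2p`, which is `T² = 1 + 2pXT`. Hence `coeff_succ_of_dvd`
covers both the deformed series and its limit. -/
theorem X_pow_dvd_Tser (p : ℂ) (N : ℕ) :
    X ^ N ∣ rescale 1 (Tser p) * Tser p - 1 - C (2 * p) * (X * rescale 1 (Tser p)) := by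
  have h := Tser_mul_Tiser p
  have : rescale 1 (Tser p) * Tser p - 1 - C (2 * p) * (X * rescale 1 (Tser p)) = 0 := by
    rw [rescale_one, RingHom.id_apply, ← h, Tser, Tiser, map_mul, map_ofNat]
    ring
  rw [this]
  exact dvd_zero _

/-- The recursion for the coefficients of a series `φ` with `φ(d X) ψ(X) = ψ(c X) φ(X)`. -/
theorem coeff_succ_of_rescale {φ ψ : ℂ⟦X⟧} {c d : ℂ} (h0 : coeff 0 ψ = 1) (k : ℕ)
    (h : rescale d φ * ψ = rescale c ψ * φ) :
    coeff (k + 1) φ * (d ^ (k + 1) - 1) = ∑ i ∈ Finset.range (k + 1),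
      coeff i φ * coeff (k + 1 - i) ψ * (c ^ (k + 1 - i) - d ^ i) := by
  have h1 := congrArg (coeff (k + 1)) h
  rw [mul_comm (rescale c ψ), coeff_mul, coeff_mul,
    Finset.Nat.sum_antidiagonal_eq_sum_range_succ_mk,
    Finset.Nat.sum_antidiagonal_eq_sum_range_succ_mk, Finset.sum_range_succ,
    Finset.sum_range_succ _ (k + 1)] at h1
  simp only [coeff_rescale, Nat.sub_self, pow_zero, one_mul, h0, mul_one] at h1
  have h2 : ∑ i ∈ Finset.range (k + 1), coeff i φ * coeff (k + 1 - i) ψ * (c ^ (k + 1 - i) - d ^ i)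
      = ∑ i ∈ Finset.range (k + 1), coeff i φ * (c ^ (k + 1 - i) * coeff (k + 1 - i) ψ)
        - ∑ i ∈ Finset.range (k + 1), d ^ i * coeff i φ * coeff (k + 1 - i) ψ := by
    rw [← Finset.sum_sub_distrib]
    exact Finset.sum_congr rfl fun i _ => by ring
  rw [h2]
  linear_combination h1

theorem coeff_X_mul_derivative (φ : ℂ⟦X⟧) (k : ℕ) : coeff k (X * d⁄dX ℂ φ) = k * coeff k φ := by
  rcases k with _ | k
  · simp
  · rw [coeff_succ_X_mul, coeff_derivative]; push_cast; ring

theorem coeff_zero_Tser (p : ℂ) : coeff 0 (Tser p) = 1 := by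
  rw [coeff_zero_eq_constantCoeff_apply, constantCoeff_Tser]

theorem coeff_zero_Tpow (p a : ℂ) : coeff 0 (Tpow p a) = 1 := by
  rw [coeff_zero_eq_constantCoeff_apply, constantCoeff_Tpow]

/-- The coefficients of `X T (Tᵃ)' = a X T' Tᵃ`, doubled to match the limits of the `q`-recursion
divided by `q - 1`. -/
theorem coeff_succ_Tpow (p a : ℂ) (k : ℕ) :
    coeff (k + 1) (Tpow p a) * (2 * (k + 1)) = ∑ i ∈ Finset.range (k + 1),
      coeff i (Tpow p a) * coeff (k + 1 - i) (Tser p) * (2 * a * (k + 1 - i : ℕ) - 2 * i) := by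
  have h1 : (X * d⁄dX ℂ (Tpow p a)) * Tser p = C a * (Tpow p a * (X * d⁄dX ℂ (Tser p))) := by
    linear_combination X * Tser_mul_derivative_Tpow p a
  have h2 := congrArg (coeff (k + 1)) h1
  rw [coeff_C_mul, coeff_mul, coeff_mul,
    Finset.Nat.sum_antidiagonal_eq_sum_range_succ_mk,
    Finset.Nat.sum_antidiagonal_eq_sum_range_succ_mk, Finset.sum_range_succ,
    Finset.sum_range_succ _ (k + 1)] at h2
  simp only [coeff_X_mul_derivative, Nat.sub_self, coeff_zero_Tser, Nat.cast_zero, zero_mul, mul_zero, add_zero, mul_one] at h2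
  have h3 : ∑ i ∈ Finset.range (k + 1), coeff i (Tpow p a) * coeff (k + 1 - i) (Tser p)
      * (2 * a * (k + 1 - i : ℕ) - 2 * i)
      = 2 * (a * ∑ i ∈ Finset.range (k + 1), coeff i (Tpow p a) *
          ((k + 1 - i : ℕ) * coeff (k + 1 - i) (Tser p))
        - ∑ i ∈ Finset.range (k + 1), i * coeff i (Tpow p a) * coeff (k + 1 - i) (Tser p)) := by
    rw [Finset.mul_sum, ← Finset.sum_sub_distrib, Finset.mul_sum]
    exact Finset.sum_congr rfl fun i _ => by ring
  rw [h3]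
  push_cast at h2 ⊢
  linear_combination 2 * h2

/-- The conditions under which the deformed exponential can be used up to order `N`. -/
def Good (N : ℕ) (q : ℂ) : Prop :=
  q ≠ 1 ∧ q ≠ 0 ∧ q ^ 2 ≠ 1 ∧ q ^ 2 - (q ^ 2)⁻¹ ≠ 0 ∧ q - q⁻¹ ≠ 0 ∧ q + 1 ≠ 0 ∧
    qHalf q + (qHalf q)⁻¹ ≠ 0 ∧ ∀ k < N, qNum (q ^ 2) ((k : ℤ) + 1) ≠ 0

theorem tendsto_sq_nhdsNE : Tendsto (fun q : ℂ => q ^ 2) (𝓝[≠] 1) (𝓝[≠] 1) := by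
  rw [tendsto_nhdsWithin_iff]
  refine ⟨tendsto_nhdsNE (by fun_prop) (by norm_num), ?_⟩
  filter_upwards [eventually_sub_inv_ne_zero, eventually_ne_zero] with q h1 h0 h2
  apply h1
  have h3 : q = q⁻¹ := eq_inv_of_mul_eq_one_left (by rw [← pow_two]; exact h2)
  rw [← h3, sub_self]

theorem eventually_good (N : ℕ) : ∀ᶠ q in 𝓝[≠] 1, Good N q := by
  have h1 := tendsto_sq_nhdsNE.eventually eventually_ne_one
  have h2 := tendsto_sq_nhdsNE.eventually eventually_sub_inv_ne_zero
  have h3 : ∀ᶠ q : ℂ in 𝓝[≠] 1, q + 1 ≠ 0 := by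
    have : Tendsto (fun q : ℂ => q + 1) (𝓝[≠] 1) (𝓝 2) :=
      tendsto_nhdsNE (by fun_prop) (by norm_num)
    exact this.eventually_ne two_ne_zero
  have h4 : ∀ᶠ q : ℂ in 𝓝[≠] 1, qHalf q + (qHalf q)⁻¹ ≠ 0 := by
    have := (tendsto_qHalf_zpow 1).add (tendsto_qHalf_zpow (-1))
    simp only [zpow_one, zpow_neg] at this
    exact this.eventually_ne (by norm_num)
  have h5 : ∀ᶠ q : ℂ in 𝓝[≠] 1, ∀ k ∈ Set.Iio N, qNum (q ^ 2) ((k : ℤ) + 1) ≠ 0 := by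
    rw [eventually_all_finite (Set.finite_Iio N)]
    intro k _
    refine ((tendsto_qNum ((k : ℤ) + 1)).comp tendsto_sq_nhdsNE).eventually_ne ?_
    exact_mod_cast k.succ_ne_zero
  filter_upwards [h1, h2, h3, h4, h5, eventually_ne_one, eventually_ne_zero,
    eventually_sub_inv_ne_zero] with q a1 a2 a3 a4 a5 a6 a7 a8
  exact ⟨a6, a7, a1, a2, a8, a3, a4, a5⟩

/-- Strong induction along the common recursion. The factor `1 + r^{k+1}` of the new coefficient
tends to `2`, so it can be divided out. -/
theorem tendsto_coeff_Bser_sq (p : ℂ) (k : ℕ) :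
    Tendsto (fun q => coeff k (Bser p q (q ^ 2))) (𝓝[≠] 1) (𝓝 (coeff k (Tser p))) := by
  induction k using Nat.strong_induction_on with
  | _ k ih =>
  rcases k with _ | k
  · simp only [coeff_zero_Bser, coeff_zero_Tser]
    exact tendsto_const_nhds
  · have hr : ∀ j : ℕ, Tendsto (fun q : ℂ => ((q ^ 2)⁻¹) ^ j) (𝓝[≠] 1) (𝓝 (1 ^ j)) := fun j =>
      tendsto_nhdsNE (ContinuousAt.pow (ContinuousAt.inv₀ (by fun_prop) (by norm_num)) j)
        (by norm_num)
    have hb : Tendsto (fun q : ℂ => p * (1 + (q ^ 2)⁻¹)) (𝓝[≠] 1) (𝓝 (2 * p)) :=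
      tendsto_nhdsNE (continuousAt_const.mul (continuousAt_const.add
        (ContinuousAt.inv₀ (by fun_prop) (by norm_num)))) (by norm_num; ring)
    have h := ((hb.mul ((hr k).mul (ih k (by omega)))).sub (tendsto_finsetSum (Finset.range k)
      fun i hi => ((hr (i + 1)).mul (ih (i + 1) (by have := Finset.mem_range.1 hi; omega))).mul
        (ih (k - i) (by omega)))).div (tendsto_const_nhds.add (hr (k + 1)))
        (show (1 : ℂ) + 1 ^ (k + 1) ≠ 0 by rw [one_pow]; norm_num)
    rw [← coeff_succ_of_dvd (by simp) (X_pow_dvd_Tser p (k + 2)), mul_div_cancel_right₀ _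
      (show (1 : ℂ) + 1 ^ (k + 1) ≠ 0 by rw [one_pow]; norm_num)] at h
    refine h.congr' ?_
    have hne := (tendsto_const_nhds (x := (1 : ℂ))).add (hr (k + 1)) |>.eventually_ne
      (show (1 : ℂ) + 1 ^ (k + 1) ≠ 0 by rw [one_pow]; norm_num)
    filter_upwards [eventually_good (k + 2), hne] with q ⟨g1, g2, g3, g4, g5, g6, g7, g8⟩ hq
    simp only [Pi.div_apply]
    rw [← coeff_succ_of_dvd (coeff_zero_Bser p q _) (X_pow_dvd_Bser_mul g3 g4 g2 g8),
      mul_div_cancel_right₀ _ hq]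

/-- Comparing the two orders of the cocycle identity for `q²` and `c(q)` gives a recursion in which
all factors `q^{2(k+1)} - 1` and `c^j - q^{2i}` vanish at `q = 1`. Divided by `q - 1` they tend to
derivatives, and the limiting recursion is that of `Tᵃ`. -/
theorem tendsto_coeff_Bser (p : ℂ) {a : ℂ} {c : ℂ → ℂ} (hc : HasDerivAt c (2 * a) 1)
    (hc1 : c 1 = 1) (k : ℕ) :
    Tendsto (fun q => coeff k (Bser p q (c q))) (𝓝[≠] 1) (𝓝 (coeff k (Tpow p a))) := by
  induction k using Nat.strong_induction_on with
  | _ k ih =>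
  rcases k with _ | k
  · simp only [coeff_zero_Bser, coeff_zero_Tpow]
    exact tendsto_const_nhds
  · have hs : ∀ i : ℕ, HasDerivAt (fun q : ℂ => (q ^ 2) ^ i) (2 * i) 1 := fun i => by
      simpa [pow_mul] using hasDerivAt_pow (2 * i) (1 : ℂ)
    have hd : Tendsto (fun q : ℂ => ((q ^ 2) ^ (k + 1) - 1) / (q - 1)) (𝓝[≠] 1)
        (𝓝 (2 * (k + 1) : ℂ)) := by
      simpa using tendsto_slope_one (hs (k + 1))
    have hn : ∀ i j : ℕ, Tendsto (fun q : ℂ => (c q ^ j - (q ^ 2) ^ i) / (q - 1)) (𝓝[≠] 1)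
        (𝓝 (2 * a * (j : ℂ) - 2 * (i : ℂ))) := by
      intro i j
      have h1 := hc.pow j
      have h2 : (j : ℂ) * c 1 ^ (j - 1) * (2 * a) = 2 * a * j := by rw [hc1]; simp; ring
      rw [h2] at h1
      have h3 := tendsto_slope_one (h1.sub (hs i))
      simpa [hc1] using h3
    have hk : (2 * (k + 1) : ℂ) ≠ 0 := by
      have : (k + 1 : ℂ) ≠ 0 := by exact_mod_cast k.succ_ne_zero
      exact mul_ne_zero two_ne_zero this
    have h := (tendsto_finsetSum (Finset.range (k + 1)) fun i hi =>
      (((ih i (Finset.mem_range.1 hi)).mul (tendsto_coeff_Bser_sq p (k + 1 - i))).mul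
        (hn i (k + 1 - i)))).div hd hk
    rw [← coeff_succ_Tpow, mul_div_cancel_right₀ _ hk] at h
    refine h.congr' ?_
    filter_upwards [hd.eventually_ne hk, eventually_good 0] with q hq ⟨g1, g2, g3, g4, g5, g6, g7, g8⟩
    have hq1 : q - 1 ≠ 0 := sub_ne_zero.2 g1
    have h5 := rescale_Bser_mul_Bser p q (c q) (q ^ 2)
    have h6 := rescale_Bser_mul_Bser p q (q ^ 2) (c q)
    rw [mul_comm (q ^ 2), ← h5] at h6
    have h7 := coeff_succ_of_rescale (coeff_zero_Bser p q (q ^ 2)) k h6.symm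
    simp only [Pi.div_apply]
    rw [div_eq_iff hq, ← mul_div_assoc, h7, Finset.sum_div]
    exact Finset.sum_congr rfl fun i _ => by rw [mul_div_assoc]

end DeformedExponential

/-! ### The operators `M_j` and `𝒯_(α)` -/

section Operators

open PowerSeries

theorem tendsto_ev {n : ℕ} {x : Mat n} (hx : IsNilpotent x) {φ : ℂ → ℂ⟦X⟧} {ψ : ℂ⟦X⟧}
    (h : ∀ k, Tendsto (fun q => coeff k (φ q)) (𝓝[≠] 1) (𝓝 (coeff k ψ))) :
    Tendsto (fun q => ev x hx (φ q)) (𝓝[≠] 1) (𝓝 (ev x hx ψ)) := by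
  simp only [ev_eq_sum hx (pow_nilpotencyClass hx)]
  exact tendsto_finsetSum _ fun k _ => (h k).smul tendsto_const_nhds

theorem qExp_smul {n : ℕ} {x : Mat n} (hx : IsNilpotent x) (Q c : ℂ) :
    qExp Q (c • x) = ev x hx (PowerSeries.mk fun k => c ^ k * (qFact Q k)⁻¹) := by
  have h1 := ev_eq_sum (hx.smul c) (pow_nilpotencyClass (hx.smul c))
    (PowerSeries.mk fun k => (qFact Q k)⁻¹)
  simp only [coeff_mk] at h1
  rw [qExp, ← h1]
  obtain ⟨N, hN⟩ := exists_pow_eq_zero hx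
  rw [ev_eq_sum hx hN, ev_eq_sum _ (show (c • x) ^ N = 0 by rw [smul_pow, hN, smul_zero])]
  refine Finset.sum_congr rfl fun k _ => ?_
  rw [coeff_mk, coeff_mk, smul_pow, smul_smul, mul_comm (c ^ k)]

variable (n : ℕ) (p q : ℂ)

/-- Evaluation of power series at `e²` in the spin `n / 2` representation. -/
def evE : ℂ⟦X⟧ →ₐ[ℂ] Mat n := ev (repE n ^ 2) (isNilpotent_sq (isNilpotent_repE n))

theorem Mtrans_eq : Mtrans n p q = evE n (Gser p q) := by
  rw [Mtrans, qExp_smul (isNilpotent_sq (isNilpotent_repE n))]; rfl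

theorem Mtrans_inv : (Mtrans n p q)⁻¹ = evE n (Gser p q)⁻¹ := by
  apply Matrix.inv_eq_left_inv
  rw [Mtrans_eq, ← map_mul, PowerSeries.inv_mul_cancel _ (constantCoeff_Gser_ne_zero p q), map_one]

theorem qExp_eq (c : ℂ) :
    qExp (q ^ 2) ((c * (p / (q ^ 2 - 1))) • repE n ^ 2) = evE n (rescale c (Gser p q)) := by
  rw [qExp_smul (isNilpotent_sq (isNilpotent_repE n)), Gser, rescale_mk]
  simp only [mul_pow, mul_assoc]
  rfl

theorem calT_eq (α : ℂ) : calT n p q α = evE n (Bser p q (q ^ (2 * α))) := by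
  rw [calT, qExp_eq, Mtrans_inv, ← map_mul, Bser, mul_comm (rescale _ _)]

theorem tendsto_evE_Bser {a : ℂ} {c : ℂ → ℂ} (hc : HasDerivAt c (2 * a) 1) (hc1 : c 1 = 1) :
    Tendsto (fun q => evE n (Bser p q (c q))) (𝓝[≠] 1) (𝓝 (evE n (Tpow p a))) :=
  tendsto_ev _ (tendsto_coeff_Bser p hc hc1)

theorem hasDerivAt_cpow_one (a : ℂ) : HasDerivAt (fun q : ℂ => q ^ a) a 1 := by
  have := (hasDerivAt_id (1 : ℂ)).cpow_const (c := a) (by simp)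
  simpa using this

theorem evE_Tpow (a : ℂ) : evE n (Tpow p a) = unipPow a (tT p (repE n)) :=
  (unipPow_tT p a (isNilpotent_repE n)).symm

theorem tendsto_calT (α : ℂ) :
    Tendsto (fun q => calT n p q α) (𝓝[≠] 1) (𝓝 (unipPow α (tT p (repE n)))) := by
  simp only [calT_eq, ← evE_Tpow]
  exact tendsto_evE_Bser n p (hasDerivAt_cpow_one (2 * α)) (by simp)

theorem tendsto_calT_one :
    Tendsto (fun q => calT n p q 1) (𝓝[≠] 1) (𝓝 (tT p (repE n))) := by
  have := tendsto_calT n p 1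
  rwa [unipPow_one (isNilpotent_tT_sub_one p (isNilpotent_repE n))] at this

theorem tendsto_calT_neg_one :
    Tendsto (fun q => calT n p q (-1)) (𝓝[≠] 1) (𝓝 (tTinv p (repE n))) := by
  have := tendsto_calT n p (-1)
  rwa [unipPow_neg_one (isNilpotent_tT_sub_one p (isNilpotent_repE n))
    (tTinv_mul_tT p (isNilpotent_repE n))] at this

end Operators

/-! ### Conjugation by `M_j` -/

section Conjugation

open PowerSeries

variable (n : ℕ) (p q : ℂ)

theorem repQH_eq_smul (a b : ℤ) (hq : q ≠ 0) :
    repQH n q a b = qHalf q ^ b • repQH n q a 0 := by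
  rw [repQH, repQH, ← Matrix.diagonal_smul]
  congr 1
  funext k
  rw [Pi.smul_apply, smul_eq_mul, add_zero, zpow_add₀ (qHalf_ne_zero hq), mul_comm]

theorem repQH_mul_repE (a : ℤ) (hq : q ≠ 0) :
    repQH n q a 0 * repE n = qHalf q ^ a • (repE n * repQH n q a 0) := by
  ext i k
  rw [Matrix.smul_apply, repQH, Matrix.diagonal_mul, Matrix.mul_diagonal, repE, Matrix.of_apply]
  split_ifs with h
  · have : a * weight n i + 0 = a + (a * weight n k + 0) := by
      simp only [weight, ← h]; push_cast; ring
    rw [this, zpow_add₀ (qHalf_ne_zero hq), smul_eq_mul]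
    ring
  · simp

theorem repQH_two_mul_repE (hq : q ≠ 0) :
    repQH n q 2 0 * repE n = q • (repE n * repQH n q 2 0) := by
  rw [repQH_mul_repE n q 2 hq]
  congr 1
  exact_mod_cast qHalf_sq q

theorem repQH_neg_two_mul_repE (hq : q ≠ 0) :
    repQH n q (-2) 0 * repE n = q⁻¹ • (repE n * repQH n q (-2) 0) := by
  rw [repQH_mul_repE n q (-2) hq, zpow_neg]
  congr 2
  exact_mod_cast qHalf_sq q

theorem repQH_mul_sq (a : ℤ) (hq : q ≠ 0) :
    repQH n q a 0 * repE n ^ 2 = q ^ a • (repE n ^ 2 * repQH n q a 0) := by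
  have h := repQH_mul_repE n q a hq
  have hs : qHalf q ^ a * qHalf q ^ a = q ^ a := by
    rw [← mul_zpow, ← pow_two, qHalf_sq]
  rw [pow_two, ← mul_assoc, h, smul_mul_assoc, mul_assoc, h, mul_smul_comm, smul_smul, hs,
    mul_assoc]

theorem repQH_mul_sq_pow (a : ℤ) (hq : q ≠ 0) (m : ℕ) :
    repQH n q a 0 * (repE n ^ 2) ^ m = (q ^ a) ^ m • ((repE n ^ 2) ^ m * repQH n q a 0) := by
  induction m with
  | zero => simp
  | succ m ih =>
    rw [pow_succ (repE n ^ 2), ← mul_assoc, ih, smul_mul_assoc, mul_assoc, repQH_mul_sq n q a hq,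
      mul_smul_comm, smul_smul, ← pow_succ, mul_assoc]

theorem evE_eq_sum {N : ℕ} (hN : 2 * n + 1 ≤ N) (φ : ℂ⟦X⟧) :
    evE n φ = ∑ k ∈ Finset.range N, coeff k φ • (repE n ^ 2) ^ k :=
  ev_eq_sum _ (by rw [← pow_mul]; exact repE_pow_eq_zero n (by omega)) φ

/-- The operator is `q^{aĥ/2}` and `e²` raises the weight `2m` by `2`, so passing through `φ(e²)`
rescales the variable by `q^a`. -/
theorem repQH_mul_evE (a : ℤ) (hq : q ≠ 0) (φ : ℂ⟦X⟧) :
    repQH n q a 0 * evE n φ = evE n (rescale (q ^ a) φ) * repQH n q a 0 := by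
  rw [evE_eq_sum n le_rfl, evE_eq_sum n le_rfl, Finset.mul_sum, Finset.sum_mul]
  refine Finset.sum_congr rfl fun k _ => ?_
  rw [mul_smul_comm, repQH_mul_sq_pow n q a hq, smul_smul, smul_mul_assoc, coeff_rescale,
    mul_comm (coeff k φ)]

theorem conj_repQH (a : ℤ) (hq : q ≠ 0) :
    (Mtrans n p q)⁻¹ * repQH n q a 0 * Mtrans n p q
      = evE n (Bser p q (q ^ a)) * repQH n q a 0 := by
  rw [Mtrans_inv, Mtrans_eq, mul_assoc, repQH_mul_evE n q a hq, ← mul_assoc, ← map_mul, Bser,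
    mul_comm (rescale _ _)]

theorem Mtrans_mul_inv : Mtrans n p q * (Mtrans n p q)⁻¹ = 1 := by
  rw [Mtrans_inv, Mtrans_eq, ← map_mul,
    PowerSeries.mul_inv_cancel _ (constantCoeff_Gser_ne_zero p q), map_one]

theorem inv_mul_Mtrans : (Mtrans n p q)⁻¹ * Mtrans n p q = 1 := by
  rw [Mtrans_inv, Mtrans_eq, ← map_mul,
    PowerSeries.inv_mul_cancel _ (constantCoeff_Gser_ne_zero p q), map_one]

theorem commute_repE_evE (φ : ℂ⟦X⟧) : Commute (repE n) (evE n φ) :=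
  commute_ev _ ((Commute.refl _).pow_right 2) φ

/-- The power series `(φ(X) - φ(0)) / X`. -/
def shift (φ : ℂ⟦X⟧) : ℂ⟦X⟧ := PowerSeries.mk fun k => coeff (k + 1) φ

theorem coeff_shift (φ : ℂ⟦X⟧) (k : ℕ) : coeff k (shift φ) = coeff (k + 1) φ := coeff_mk _ _

theorem X_mul_shift (φ : ℂ⟦X⟧) : X * shift φ = φ - C (constantCoeff φ) := by
  ext k
  rcases k with _ | k
  · simp
  · rw [coeff_succ_X_mul, coeff_shift, map_sub, coeff_C, if_neg (by omega), sub_zero]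

variable {n q}

/-- `ω [f̂, ê^{2 (m + 1)}]`. -/
theorem commutator_repFq_pow (h0 : q ≠ 0) (h1 : q - q⁻¹ ≠ 0)
    (h2 : qHalf q + (qHalf q)⁻¹ ≠ 0) (m : ℕ) :
    ((q + 1) * (q - q⁻¹)) • (repFq n q * (repE n ^ 2) ^ (m + 1)
        - (repE n ^ 2) ^ (m + 1) * repFq n q)
      = -(repE n * (repE n ^ 2) ^ m * ((((q ^ 2) ^ (m + 1) - 1) • repQH n q 2 0)
          - (q * ((q ^ 2)⁻¹ ^ (m + 1) - 1)) • repQH n q (-2) 0)) := by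
  have hef := anticommutator_repE_repFq n h0 h1 h2
  have e1 := repQH_two_mul_repE n q h0
  have e2 := repQH_neg_two_mul_repE n q h0
  have e3 := repQH_mul_sq_pow n q 2 h0
  have e4 := repQH_mul_sq_pow n q (-2) h0
  -- The commutator with `e²` is `{f̂, e}e - e{f̂, e}`.
  have hx : (q - q⁻¹) • (repFq n q * repE n ^ 2 - repE n ^ 2 * repFq n q)
      = -((q - 1) • (repE n * repQH n q 2 0)) - (1 - q⁻¹) • (repE n * repQH n q (-2) 0) := by
    linear_combination (norm := skip) hef * repE n - repE n * hef - e1 + e2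
    simp only [mul_add, add_mul, mul_sub, sub_mul, smul_mul_assoc, mul_smul_comm, neg_mul, mul_neg,
      mul_assoc, pow_succ, pow_zero, one_mul]
    module
  have hx' : ((q + 1) * (q - q⁻¹)) • (repFq n q * repE n ^ 2 - repE n ^ 2 * repFq n q)
      = -(repE n * ((q ^ 2 - 1) • repQH n q 2 0 - (q * ((q ^ 2)⁻¹ - 1)) • repQH n q (-2) 0)) := by
    rw [mul_smul, hx]
    -- The factor `q + 1` brings the coefficients to the form `r - 1` with `r = q^{±2}`, which
    -- generalizes to `r^{m+1} - 1`.
    have a1 : (q + 1) * (1 - q⁻¹) = -(q * ((q ^ 2)⁻¹ - 1)) := by field_simp; ring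
    have a2 : (q + 1) * (q - 1) = q ^ 2 - 1 := by ring
    rw [mul_sub, mul_smul_comm, mul_smul_comm, smul_sub, smul_neg, smul_smul, smul_smul, a1, a2]
    module
  have e5 := repQH_mul_sq n q 2 h0
  have e6 := repQH_mul_sq n q (-2) h0
  have z1 : q ^ (2 : ℤ) = q ^ 2 := by norm_cast
  have z2 : q ^ (-2 : ℤ) = (q ^ 2)⁻¹ := by rw [zpow_neg]; norm_cast
  rw [z1] at e5
  rw [z2] at e6
  induction m with
  | zero => simpa using hx'
  | succ m ih =>
    have hd : repFq n q * (repE n ^ 2) ^ (m + 1 + 1) - (repE n ^ 2) ^ (m + 1 + 1) * repFq n q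
        = (repFq n q * (repE n ^ 2) ^ (m + 1) - (repE n ^ 2) ^ (m + 1) * repFq n q) * repE n ^ 2
          + (repE n ^ 2) ^ (m + 1) * (repFq n q * repE n ^ 2 - repE n ^ 2 * repFq n q) := by
      rw [pow_succ (repE n ^ 2) (m + 1)]; noncomm_ring
    have hc : (repE n ^ 2) ^ (m + 1) * repE n = repE n * (repE n ^ 2) ^ (m + 1) := by
      rw [← pow_mul]; exact ((Commute.refl (repE n)).pow_left _).eq
    rw [hd, smul_add, ← smul_mul_assoc, ← mul_smul_comm, ih, hx', mul_neg, ← mul_assoc, hc,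
      pow_succ (repE n ^ 2) m]
    generalize repQH n q 2 0 = D at *
    generalize repQH n q (-2) 0 = D' at *
    generalize (repE n ^ 2) ^ m = x at *
    generalize repE n ^ 2 = y at *
    linear_combination (norm := skip) -(((q ^ 2) ^ (m + 1) - 1) • (repE n * x * e5))
      + (q * ((q ^ 2)⁻¹ ^ (m + 1) - 1)) • (repE n * x * e6)
    simp only [mul_add, add_mul, mul_sub, sub_mul, smul_mul_assoc, mul_smul_comm, neg_mul, mul_neg,
      mul_assoc]
    generalize (q ^ 2)⁻¹ = r
    module

/-- `(q + 1) ω M⁻¹ [f̂, M]`. -/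
theorem commutator_repFq_evE (h0 : q ≠ 0) (h1 : q - q⁻¹ ≠ 0)
    (h2 : qHalf q + (qHalf q)⁻¹ ≠ 0) (φ : ℂ⟦X⟧) :
    ((q + 1) * (q - q⁻¹)) • (repFq n q * evE n φ - evE n φ * repFq n q)
      = -(repE n * (evE n (shift (rescale (q ^ 2) φ - φ)) * repQH n q 2 0
          - q • (evE n (shift (rescale (q ^ 2)⁻¹ φ - φ)) * repQH n q (-2) 0))) := by
  obtain ⟨w, hw⟩ : ∃ w, w = (q + 1) * (q - q⁻¹) := ⟨_, rfl⟩
  -- The sum for `φ` is given one extra term. Its constant term commutes with `f̂` and drops, and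
  -- the others are matched with the shifted series.
  rw [← hw, evE_eq_sum n (Nat.le_succ (2 * n + 1)) φ, evE_eq_sum n le_rfl, evE_eq_sum n le_rfl,
    Finset.sum_range_succ']
  simp only [mul_add, add_mul, Finset.mul_sum, Finset.sum_mul, pow_zero, mul_smul_comm,
    smul_mul_assoc, mul_one, one_mul, coeff_shift, map_sub, coeff_rescale, mul_sub, Finset.smul_sum]
  rw [add_sub_add_right_eq_sub, ← Finset.sum_sub_distrib, ← Finset.sum_sub_distrib, Finset.smul_sum,
    ← Finset.sum_neg_distrib]
  refine Finset.sum_congr rfl fun k _ => ?_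
  have := commutator_repFq_pow (n := n) h0 h1 h2 k
  rw [← hw] at this
  rw [← smul_sub, smul_comm, this]
  generalize (q ^ 2)⁻¹ = r
  simp only [mul_add, add_mul, mul_sub, sub_mul, smul_mul_assoc, mul_smul_comm, neg_mul, mul_neg,
    mul_assoc]
  module

/-- The commutator with `f̂` lowers the degree in `e²` and leaves a difference of series divided by
`X`. Multiplying by `X` reduces the claim to the definition of `Bser`. -/
theorem inv_Gser_mul_shift (c : ℂ) :
    (Gser p q)⁻¹ * shift (rescale c (Gser p q) - Gser p q) = shift (Bser p q c) := by
  apply mul_left_cancel₀ (X_ne_zero (R := ℂ))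
  rw [X_mul_shift, mul_left_comm, X_mul_shift, map_sub, constantCoeff_rescale_Gser,
    constantCoeff_Gser, sub_self, map_zero, sub_zero, mul_sub,
    PowerSeries.inv_mul_cancel _ (constantCoeff_Gser_ne_zero p q),
    ← coeff_zero_eq_constantCoeff_apply, coeff_zero_Bser, Bser, map_one, mul_comm (rescale _ _)]

/-- `ω M⁻¹ f̂ M`. -/
def conjF (n : ℕ) (p q : ℂ) : Mat n :=
  (q - q⁻¹) • ((Mtrans n p q)⁻¹ * repFq n q * Mtrans n p q)

theorem conjF_eq (h0 : q ≠ 0) (h1 : q - q⁻¹ ≠ 0) (h2 : qHalf q + (qHalf q)⁻¹ ≠ 0) :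
    (q + 1) • conjF n p q = ((q + 1) * (q - q⁻¹)) • repFq n q
      - repE n * (evE n (shift (Bser p q (q ^ 2))) * repQH n q 2 0
          - q • (evE n (shift (Bser p q (q ^ 2)⁻¹)) * repQH n q (-2) 0)) := by
  have h := commutator_repFq_evE (n := n) h0 h1 h2 (Gser p q)
  rw [← Mtrans_eq] at h
  have hc : (Mtrans n p q)⁻¹ * repE n = repE n * (Mtrans n p q)⁻¹ := by
    rw [Mtrans_inv]; exact (commute_repE_evE n _).eq.symm
  have hi := inv_mul_Mtrans n p q
  have g1 := congrArg (evE n) (inv_Gser_mul_shift p (q := q) (q ^ 2))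
  have g2 := congrArg (evE n) (inv_Gser_mul_shift p (q := q) (q ^ 2)⁻¹)
  rw [map_mul, ← Mtrans_inv] at g1 g2
  rw [conjF, ← g1, ← g2]
  generalize (Mtrans n p q)⁻¹ = Mi at *
  generalize Mtrans n p q = M at *
  generalize evE n (shift (rescale (q ^ 2) (Gser p q) - Gser p q)) = a at *
  generalize evE n (shift (rescale (q ^ 2)⁻¹ (Gser p q) - Gser p q)) = b at *
  linear_combination (norm := skip) Mi * h + ((q + 1) * (q - q⁻¹)) • (hi * repFq n q)
    - hc * (a * repQH n q 2 0 - q • (b * repQH n q (-2) 0))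
  simp only [mul_add, add_mul, mul_sub, sub_mul, smul_mul_assoc, mul_smul_comm, neg_mul, mul_neg,
    mul_assoc, one_mul]
  module

/-- The difference equation holds modulo `X ^ (2n+2)`, and `(e²)^(2n+2) = 0`, so on `V_j` it is
exact. -/
theorem evE_Bser_sub {q : ℂ} (hq : Good (2 * n + 2) q) :
    evE n (Bser p q (q ^ 2)) - evE n (Bser p q (q ^ 2)⁻¹)
      = (p * (1 + (q ^ 2)⁻¹)) • repE n ^ 2 := by
  obtain ⟨g1, g2, g3, g4, g5, g6, g7, g8⟩ := hq
  have h := X_pow_dvd_iff.1 (X_pow_dvd_Bser_sub (p := p) g3 g4 g2 g8)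
  have e : evE n (C (p * (1 + (q ^ 2)⁻¹)) * X) = (p * (1 + (q ^ 2)⁻¹)) • repE n ^ 2 := by
    rw [evE, map_mul, ev_X, ev_C, Algebra.smul_def]
  rw [← map_sub, ← e]
  refine ev_congr _ (N := 2 * n + 2) (by rw [← pow_mul]; exact repE_pow_eq_zero n (by omega)) ?_
  intro k hk
  have := h k hk
  rwa [map_sub, sub_eq_zero] at this

/-- The shift costs one order. Having `Good` at `2n+2` still leaves the `2n+1` coefficients that
matter. -/
theorem evE_shift_Bser_sub {q : ℂ} (hq : Good (2 * n + 2) q) :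
    evE n (shift (Bser p q (q ^ 2))) - evE n (shift (Bser p q (q ^ 2)⁻¹))
      = (p * (1 + (q ^ 2)⁻¹)) • (1 : Mat n) := by
  obtain ⟨g1, g2, g3, g4, g5, g6, g7, g8⟩ := hq
  have h := X_pow_dvd_iff.1 (X_pow_dvd_Bser_sub (p := p) g3 g4 g2 g8)
  have e : evE n (C (p * (1 + (q ^ 2)⁻¹))) = (p * (1 + (q ^ 2)⁻¹)) • (1 : Mat n) := by
    rw [evE, ev_C, Algebra.algebraMap_eq_smul_one]
  rw [← map_sub, ← e]
  refine ev_congr _ (repE_sq_pow_eq_zero n) ?_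
  intro k hk
  have := h (k + 1) (by omega)
  rw [map_sub, map_sub, mul_comm, coeff_succ_X_mul] at this
  rw [map_sub, coeff_shift, coeff_shift, sub_eq_zero.1 this]

/-- `(ω M⁻¹ f̂ M + p e) / ω`. -/
def conjPsi (n : ℕ) (p q : ℂ) : Mat n := (q - q⁻¹)⁻¹ • (conjF n p q + p • repE n)

theorem conjF_eq_conjPsi (h1 : q - q⁻¹ ≠ 0) :
    conjF n p q = -(p • repE n) + (q - q⁻¹) • conjPsi n p q := by
  rw [conjPsi, smul_smul, mul_inv_cancel₀ h1, one_smul]; abel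

/-- All divisions by `ω` are collected in factors that vanish at `q = 1`: the differences of
`q^{±ĥ}` and `1`, the number `1 - q`, and `q⁻² - q`. Each quotient has a limit. -/
theorem conjPsi_eq {q : ℂ} (hq : Good (2 * n + 2) q) :
    conjPsi n p q = repFq n q - (q + 1)⁻¹ • (repE n *
      (evE n (shift (Bser p q (q ^ 2))) * ((q - q⁻¹)⁻¹ • (repQH n q 2 0 - 1))
        - q • (evE n (shift (Bser p q (q ^ 2)⁻¹)) * ((q - q⁻¹)⁻¹ • (repQH n q (-2) 0 - 1)))
        + ((q - q⁻¹)⁻¹ * (1 - q)) • evE n (shift (Bser p q (q ^ 2)⁻¹))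
        + ((q - q⁻¹)⁻¹ * (p * ((q ^ 2)⁻¹ - q))) • (1 : Mat n))) := by
  have hs := evE_shift_Bser_sub p hq
  obtain ⟨g1, g2, g3, g4, g5, g6, g7, g8⟩ := hq
  have hF := conjF_eq (n := n) p g2 g5 g7
  have hF' : conjF n p q = (q + 1)⁻¹ • (((q + 1) * (q - q⁻¹)) • repFq n q
      - repE n * (evE n (shift (Bser p q (q ^ 2))) * repQH n q 2 0
          - q • (evE n (shift (Bser p q (q ^ 2)⁻¹)) * repQH n q (-2) 0))) := by
    rw [← hF, smul_smul, inv_mul_cancel₀ g6, one_smul]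
  rw [conjPsi, hF']
  -- Trading one shifted series for the other isolates the constant `p(1 + q⁻²)`, which meets `p(q +
  -- 1)` from the added `pe` and leaves `p(q⁻² - q)`.
  have hV : evE n (shift (Bser p q (q ^ 2)⁻¹))
      = evE n (shift (Bser p q (q ^ 2))) - (p * (1 + (q ^ 2)⁻¹)) • (1 : Mat n) := by
    rw [← hs]; abel
  rw [hV]
  generalize evE n (shift (Bser p q (q ^ 2))) = U at *
  generalize repQH n q 2 0 = D at *
  generalize repQH n q (-2) 0 = D' at *
  generalize repFq n q = f at *
  generalize repE n = e at *
  simp only [mul_add, add_mul, mul_sub, sub_mul, smul_mul_assoc, mul_smul_comm, neg_mul, mul_neg,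
    mul_assoc, mul_one, one_mul, smul_add, smul_sub, smul_smul]
  generalize e * (U * D) = t1
  generalize e * (U * D') = t2
  generalize e * D' = t3
  generalize e * U = t4
  generalize hw : q - q⁻¹ = w at *
  have hq1 : q + 1 ≠ 0 := g6
  have hqw : q * w = q ^ 2 - 1 := by rw [← hw]; field_simp
  match_scalars <;> field_simp
  all_goals first | ring1 | linear_combination hqw | linear_combination -hqw

end Conjugation

/-! ### The limit of the transformed `R`-matrix -/

section RMatrixLimit

open PowerSeries

variable (n : ℕ) (p : ℂ)

theorem hasDerivAt_sq_one : HasDerivAt (fun q : ℂ => q ^ 2) (2 * 1) 1 := by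
  simpa using hasDerivAt_pow 2 (1 : ℂ)

theorem hasDerivAt_inv_sq_one : HasDerivAt (fun q : ℂ => (q ^ 2)⁻¹) (2 * (-1)) 1 := by
  have e : (fun q : ℂ => (q ^ 2)⁻¹) = fun q => q ^ (-2 : ℤ) := by
    funext q
    rw [zpow_neg]
    norm_cast
  rw [e]
  convert hasDerivAt_zpow_one (-2) using 1
  push_cast
  norm_num

theorem tendsto_evE_shift_Bser {a : ℂ} {c : ℂ → ℂ} (hc : HasDerivAt c (2 * a) 1) (hc1 : c 1 = 1) :
    Tendsto (fun q => evE n (shift (Bser p q (c q)))) (𝓝[≠] 1)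
      (𝓝 (evE n (shift (Tpow p a)))) := by
  refine tendsto_ev _ fun k => ?_
  simp only [coeff_shift]
  exact tendsto_coeff_Bser p hc hc1 (k + 1)

theorem tendsto_repQH (a : ℤ) : Tendsto (fun q => repQH n q a 0) (𝓝[≠] 1) (𝓝 1) := by
  rw [← Matrix.diagonal_one]
  refine ((continuous_id.matrix_diagonal).tendsto _).comp ?_
  exact tendsto_pi_nhds.2 fun k => tendsto_qHalf_zpow _

/-- On a vector of weight `w` this is the difference quotient of `q^{aw}` at `1`, divided by that of
`q - q⁻¹`, which tends to `2`. -/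
theorem tendsto_repQH_sub_one (a : ℤ) :
    Tendsto (fun q => (q - q⁻¹)⁻¹ • (repQH n q (2 * a) 0 - 1)) (𝓝[≠] 1)
      (𝓝 (((a : ℂ) / 2) • repH n)) := by
  rw [repH, ← Matrix.diagonal_smul]
  have h : ∀ q : ℂ, (q - q⁻¹)⁻¹ • (repQH n q (2 * a) 0 - 1)
      = Matrix.diagonal fun k => (q - q⁻¹)⁻¹ * (qHalf q ^ (2 * a * weight n k + 0) - 1) := by
    intro q
    rw [repQH, ← Matrix.diagonal_one, Matrix.diagonal_sub, ← Matrix.diagonal_smul]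
    rfl
  simp only [h]
  refine ((continuous_id.matrix_diagonal).tendsto _).comp ?_
  refine tendsto_pi_nhds.2 fun k => ?_
  have h1 := (tendsto_slope_one (hasDerivAt_zpow_one (a * weight n k))).div tendsto_sub_inv_div
    two_ne_zero
  have h2 : ((a * weight n k : ℤ) : ℂ) / 2 = (((a : ℂ) / 2) • fun k => (weight n k : ℂ)) k := by
    rw [Pi.smul_apply, smul_eq_mul]; push_cast; ring
  rw [h2] at h1
  refine h1.congr' ?_
  filter_upwards [eventually_ne_one, eventually_sub_inv_ne_zero] with q hq hq'
  have hs : qHalf q ^ (2 * a * weight n k + 0) = q ^ (a * weight n k) := by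
    rw [add_zero, mul_assoc, zpow_mul]
    congr 1
    exact_mod_cast qHalf_sq q
  have : q - 1 ≠ 0 := sub_ne_zero.2 hq
  rw [hs, one_zpow]
  rw [Pi.div_apply]
  field_simp

theorem tendsto_inv_mul_of_hasDerivAt {c : ℂ → ℂ} {a : ℂ} (h : HasDerivAt c a 1) (h1 : c 1 = 0) :
    Tendsto (fun q => (q - q⁻¹)⁻¹ * c q) (𝓝[≠] 1) (𝓝 (a / 2)) := by
  refine ((tendsto_slope_one h).div tendsto_sub_inv_div two_ne_zero).congr' ?_
  filter_upwards [eventually_ne_one, eventually_sub_inv_ne_zero] with q hq hq'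
  have : q - 1 ≠ 0 := sub_ne_zero.2 hq
  rw [Pi.div_apply, h1, sub_zero]
  field_simp

/-- Only the existence of the limit is needed. Later `Ψ` occurs either with a factor that tends to
zero or inside `{e, Ψ}`, whose limit is found independently. -/
theorem exists_tendsto_conjPsi : ∃ Ψ, Tendsto (fun q => conjPsi n p q) (𝓝[≠] 1) (𝓝 Ψ) := by
  have h1 := tendsto_evE_shift_Bser n p hasDerivAt_sq_one (by norm_num)
  have h2 := tendsto_evE_shift_Bser n p hasDerivAt_inv_sq_one (by norm_num)
  have h3 := tendsto_repQH_sub_one n 1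
  have h4 := tendsto_repQH_sub_one n (-1)
  have h5 : Tendsto (fun q : ℂ => (q - q⁻¹)⁻¹ * (1 - q)) (𝓝[≠] 1) (𝓝 _) :=
    tendsto_inv_mul_of_hasDerivAt ((hasDerivAt_id (1 : ℂ)).const_sub 1) (by simp)
  have h6 : Tendsto (fun q : ℂ => (q - q⁻¹)⁻¹ * (p * ((q ^ 2)⁻¹ - q))) (𝓝[≠] 1) (𝓝 _) :=
    tendsto_inv_mul_of_hasDerivAt ((hasDerivAt_inv_sq_one.sub (hasDerivAt_id (1 : ℂ))).const_mul p)
      (by simp)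
  have h7 : Tendsto (fun q : ℂ => q) (𝓝[≠] 1) (𝓝 1) := tendsto_nhdsNE continuousAt_id rfl
  have h8 : Tendsto (fun q : ℂ => (q + 1)⁻¹) (𝓝[≠] 1) (𝓝 2⁻¹) :=
    tendsto_nhdsNE ((continuousAt_id.add continuousAt_const).inv₀ (by norm_num)) (by norm_num)
  have key := (tendsto_repFq n).sub (h8.smul ((tendsto_const_nhds (x := repE n)).mul
    ((((h1.mul h3).sub (h7.smul (h2.mul h4))).add (h5.smul h2)).add
      (h6.smul (tendsto_const_nhds (x := (1 : Mat n)))))))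
  refine ⟨_, key.congr' ?_⟩
  filter_upwards [eventually_good (2 * n + 2)] with q hq
  exact (conjPsi_eq p hq).symm

theorem inv_Mtrans_mul_repE (q : ℂ) :
    (Mtrans n p q)⁻¹ * repE n = repE n * (Mtrans n p q)⁻¹ := by
  rw [Mtrans_inv]; exact (commute_repE_evE n _).eq.symm

/-- Since `M` commutes with `e`, this is the conjugate of the deformed anticommutator. -/
theorem anticommutator_repE_conjF {q : ℂ} (h0 : q ≠ 0) (h1 : q - q⁻¹ ≠ 0)
    (h2 : qHalf q + (qHalf q)⁻¹ ≠ 0) :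
    repE n * conjF n p q + conjF n p q * repE n
      = -(evE n (Bser p q (q ^ 2)) * repQH n q 2 0
        - evE n (Bser p q (q ^ 2)⁻¹) * repQH n q (-2) 0) := by
  have h := anticommutator_repE_repFq n h0 h1 h2
  have hM : Mtrans n p q * repE n = repE n * Mtrans n p q := by
    rw [Mtrans_eq]; exact (commute_repE_evE n _).eq.symm
  have hMi := inv_Mtrans_mul_repE n p q
  have c1 := conj_repQH n p q 2 h0
  have c2 := conj_repQH n p q (-2) h0
  have z1 : q ^ (2 : ℤ) = q ^ 2 := by norm_cast
  have z2 : q ^ (-2 : ℤ) = (q ^ 2)⁻¹ := by rw [zpow_neg]; norm_cast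
  rw [z1] at c1
  rw [z2] at c2
  rw [← c1, ← c2, conjF]
  generalize (Mtrans n p q)⁻¹ = Mi at *
  generalize Mtrans n p q = M at *
  linear_combination (norm := skip) Mi * h * M - (q - q⁻¹) • (hMi * repFq n q * M)
    + (q - q⁻¹) • (Mi * repFq n q * hM)
  simp only [mul_add, add_mul, mul_sub, sub_mul, smul_mul_assoc, mul_smul_comm, neg_mul, mul_neg,
    mul_assoc]
  module

theorem anticommutator_repE_conjPsi {q : ℂ} (hq : Good (2 * n + 2) q) :
    repE n * conjPsi n p q + conjPsi n p q * repE n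
      = -(evE n (Bser p q (q ^ 2)) * ((q - q⁻¹)⁻¹ • (repQH n q 2 0 - 1))
        - evE n (Bser p q (q ^ 2)⁻¹) * ((q - q⁻¹)⁻¹ • (repQH n q (-2) 0 - 1)))
        + (p * q⁻¹) • repE n ^ 2 := by
  have hs := evE_Bser_sub p hq
  obtain ⟨g1, g2, g3, g4, g5, g6, g7, g8⟩ := hq
  have h := anticommutator_repE_conjF n p g2 g5 g7
  have hw : (q - q⁻¹)⁻¹ * (p * (1 - (q ^ 2)⁻¹)) = p * q⁻¹ := by
    rw [inv_mul_eq_iff_eq_mul₀ g5]; field_simp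
  rw [← hw, conjPsi]
  generalize (q - q⁻¹)⁻¹ = w at *
  linear_combination (norm := skip) w • h - w • hs
  simp only [mul_add, add_mul, mul_sub, sub_mul, smul_mul_assoc, mul_smul_comm, neg_mul, mul_neg,
    mul_assoc, mul_one, pow_two]
  generalize (q * q)⁻¹ = r
  module

/-- The quotients `(q^{±ĥ} - 1)/ω` tend to `±h/2` and the series factors to `T̃^{±1}`, so together
they produce `-½(T̃ + T̃⁻¹)h = -H̃`. The term `pe²` is what remains of the two series after the
difference equation. -/
theorem tendsto_anticommutator_conjPsi :
    Tendsto (fun q => repE n * conjPsi n p q + conjPsi n p q * repE n) (𝓝[≠] 1)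
      (𝓝 (p • repE n ^ 2 - tH p (repE n) (repH n))) := by
  have h1 := tendsto_evE_Bser n p hasDerivAt_sq_one (by norm_num)
  have h2 := tendsto_evE_Bser n p hasDerivAt_inv_sq_one (by norm_num)
  have h3 := tendsto_repQH_sub_one n 1
  have h4 := tendsto_repQH_sub_one n (-1)
  have h5 : Tendsto (fun q : ℂ => p * q⁻¹) (𝓝[≠] 1) (𝓝 p) :=
    tendsto_nhdsNE (continuousAt_const.mul (continuousAt_inv₀ one_ne_zero)) (by simp)
  rw [evE_Tpow, unipPow_one (isNilpotent_tT_sub_one p (isNilpotent_repE n))] at h1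
  rw [evE_Tpow, unipPow_neg_one (isNilpotent_tT_sub_one p (isNilpotent_repE n))
    (tTinv_mul_tT p (isNilpotent_repE n))] at h2
  have key := ((h1.mul h3).sub (h2.mul h4)).neg.add
    (h5.smul (tendsto_const_nhds (x := repE n ^ 2)))
  have e : p • repE n ^ 2 - tH p (repE n) (repH n)
      = -(tT p (repE n) * ((((1 : ℤ) : ℂ) / 2) • repH n)
        - tTinv p (repE n) * ((((-1 : ℤ) : ℂ) / 2) • repH n)) + p • repE n ^ 2 := by
    rw [tH, add_mul, mul_smul_comm, mul_smul_comm]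
    push_cast
    module
  rw [e]
  refine key.congr' ?_
  filter_upwards [eventually_good (2 * n + 2)] with q hq
  exact (anticommutator_repE_conjPsi n p hq).symm

theorem tendsto_conjF : Tendsto (fun q => conjF n p q) (𝓝[≠] 1) (𝓝 (-(p • repE n))) := by
  obtain ⟨Ψ, hΨ⟩ := exists_tendsto_conjPsi n p
  have hw : Tendsto (fun q : ℂ => q - q⁻¹) (𝓝[≠] 1) (𝓝 0) :=
    tendsto_nhdsNE (continuousAt_id.sub (continuousAt_inv₀ one_ne_zero)) (by simp)
  have key := (tendsto_const_nhds (x := -(p • repE n))).add (hw.smul hΨ)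
  rw [zero_smul, add_zero] at key
  refine key.congr' ?_
  filter_upwards [eventually_sub_inv_ne_zero] with q hq
  exact (conjF_eq_conjPsi p hq).symm

/-- The corner block of the transformed matrix. -/
theorem corner_eq {q : ℂ} (hq : Good (2 * n + 2) q) :
    -(((1 + q⁻¹) * (q - q⁻¹)⁻¹) • conjF n p q ^ 2) + (p / (q ^ 2 - 1)) •
      (evE n (Bser p q (q ^ 2)) * repQH n q 2 0
        - evE n (Bser p q (q ^ 2)⁻¹) * repQH n q (-2) 0)
      = -((p ^ 2 * (q + 1)⁻¹) • repE n ^ 2)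
        + p • (repE n * conjPsi n p q + conjPsi n p q * repE n)
        - ((1 + q⁻¹) * (q - q⁻¹)) • conjPsi n p q ^ 2 := by
  obtain ⟨g1, g2, g3, g4, g5, g6, g7, g8⟩ := hq
  have h := anticommutator_repE_conjF n p g2 g5 g7
  have h' := neg_eq_iff_eq_neg.2 h
  rw [← h', conjF_eq_conjPsi p g5]
  generalize conjPsi n p q = Ψ
  generalize repE n = e
  generalize hw : q - q⁻¹ = w at *
  -- This relates the denominator of `η` to `ω`. The two poles in `e²` then add up to `p²(1 -
  -- q)/(qω) = -p²/(q + 1)`.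
  have hqw : q * w = q ^ 2 - 1 := by rw [← hw]; field_simp
  rw [← hqw]
  simp only [mul_add, add_mul, mul_sub, sub_mul, smul_mul_assoc, mul_smul_comm, neg_mul, mul_neg,
    mul_assoc, mul_one, pow_two, smul_add, smul_neg, smul_sub, smul_smul]
  match_scalars <;> field_simp
  all_goals first | ring1 | linear_combination p ^ 2 * hqw

theorem tendsto_corner :
    Tendsto (fun q => -(((1 + q⁻¹) * (q - q⁻¹)⁻¹) • conjF n p q ^ 2) + (p / (q ^ 2 - 1)) •
      (evE n (Bser p q (q ^ 2)) * repQH n q 2 0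
        - evE n (Bser p q (q ^ 2)⁻¹) * repQH n q (-2) 0)) (𝓝[≠] 1)
      (𝓝 (-(p • tH p (repE n) (repH n)) + (p / 4) • (tT p (repE n) - tTinv p (repE n)))) := by
  obtain ⟨Ψ, hΨ⟩ := exists_tendsto_conjPsi n p
  have h1 : Tendsto (fun q : ℂ => p ^ 2 * (q + 1)⁻¹) (𝓝[≠] 1) (𝓝 (p ^ 2 * 2⁻¹)) :=
    tendsto_nhdsNE (continuousAt_const.mul
      ((continuousAt_id.add continuousAt_const).inv₀ (by norm_num))) (by norm_num)
  have h2 : Tendsto (fun q : ℂ => (1 + q⁻¹) * (q - q⁻¹)) (𝓝[≠] 1) (𝓝 0) :=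
    tendsto_nhdsNE ((continuousAt_const.add (continuousAt_inv₀ one_ne_zero)).mul
      (continuousAt_id.sub (continuousAt_inv₀ one_ne_zero))) (by simp)
  have key := ((h1.smul (tendsto_const_nhds (x := repE n ^ 2))).neg.add
    ((tendsto_anticommutator_conjPsi n p).const_smul p)).sub (h2.smul (hΨ.pow 2))
  have e : -(p • tH p (repE n) (repH n)) + (p / 4) • (tT p (repE n) - tTinv p (repE n))
      = -((p ^ 2 * 2⁻¹) • repE n ^ 2) + p • (p • repE n ^ 2 - tH p (repE n) (repH n))
        - (0 : ℂ) • Ψ ^ 2 := by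
    rw [tT_sub_tTinv]
    module
  rw [e]
  refine key.congr' ?_
  filter_upwards [eventually_good (2 * n + 2)] with q hq
  exact (corner_eq n p hq).symm

theorem kronecker_mul_blocks_mul_kronecker (P R : Matrix (Fin 3) (Fin 3) ℂ) (M M' : Mat n)
    (B : Matrix (Fin 3) (Fin 3) (Mat n)) :
    Matrix.kronecker P M * blocks B * Matrix.kronecker R M'
      = blocks (Matrix.of fun i k => ∑ j, ∑ l, (P i j * R l k) • (M * B j l * M')) := by
  ext ⟨i, a⟩ ⟨k, b⟩
  simp only [Matrix.mul_apply, Fintype.sum_prod_type, blocks, Matrix.of_apply,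
    Matrix.sum_apply, Matrix.smul_apply, Matrix.kronecker, Matrix.kroneckerMap_apply,
    Finset.sum_mul, Finset.mul_sum, smul_eq_mul]
  rw [Finset.sum_comm (s := Finset.univ (α := Fin 3)) (t := Finset.univ (α := Fin 3))]
  refine Finset.sum_congr rfl fun l _ => ?_
  rw [Finset.sum_comm]
  refine Finset.sum_congr rfl fun j _ => Finset.sum_congr rfl fun y _ =>
    Finset.sum_congr rfl fun x _ => ?_
  ring

/-- In dimension three `e⁴ = 0`, so the deformed exponential stops after its linear term. -/
theorem Mtrans_one {q : ℂ} (hq : q ^ 2 - (q ^ 2)⁻¹ ≠ 0) :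
    Mtrans 1 p q = 1 + (p / (q ^ 2 - 1)) • repE 1 ^ 2 := by
  have h4 : (repE 1 ^ 2) ^ 2 = 0 := by rw [← pow_mul]; exact repE_pow_eq_zero 1 (by norm_num)
  have h1 : qNum (q ^ 2) 1 = 1 := by simp [qNum, div_self hq]
  rw [Mtrans_eq, evE, ev_eq_sum _ h4, Finset.sum_range_succ, Finset.sum_range_one, Gser, coeff_mk,
    coeff_mk]
  simp [qFact, h1]

theorem Mtrans_one_inv {q : ℂ} (hq : q ^ 2 - (q ^ 2)⁻¹ ≠ 0) :
    (Mtrans 1 p q)⁻¹ = 1 - (p / (q ^ 2 - 1)) • repE 1 ^ 2 := by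
  have h4 : repE 1 ^ 2 * repE 1 ^ 2 = 0 := by
    rw [← pow_add]; exact repE_pow_eq_zero 1 (by norm_num)
  apply Matrix.inv_eq_left_inv
  rw [Mtrans_one p hq, sub_mul, mul_add, mul_add, smul_mul_smul_comm, h4]
  simp

theorem repE_one_sq : repE 1 ^ 2 = (!![0, 0, 1; 0, 0, 0; 0, 0, 0] : Matrix (Fin 3) (Fin 3) ℂ) := by
  ext i k
  rw [repE_pow_apply]
  fin_cases i <;> fin_cases k <;> simp

/-- The matrix `M_{1/2}` differs from `1` only by the corner entry `η`. As the middle matrix is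
block upper triangular, its conjugation only adds `η` times the difference of the first and last
diagonal blocks to the corner; `M_j` acts on each block separately. -/
theorem RqTransformed_eq {q : ℂ} (hq : Good (2 * n + 2) q) :
    RqTransformed n p q = blocks
      !![evE n (Bser p q (q ^ 2)) * repQH n q 2 0,
          -(evE n (Bser p q q) * repQH n q 1 0 * conjF n p q),
          -(((1 + q⁻¹) * (q - q⁻¹)⁻¹) • conjF n p q ^ 2) + (p / (q ^ 2 - 1)) •
            (evE n (Bser p q (q ^ 2)) * repQH n q 2 0
              - evE n (Bser p q (q ^ 2)⁻¹) * repQH n q (-2) 0);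
        0, 1, (qHalf q)⁻¹ • (evE n (Bser p q q⁻¹) * repQH n q (-1) 0 * conjF n p q);
        0, 0, evE n (Bser p q (q ^ 2)⁻¹) * repQH n q (-2) 0] := by
  obtain ⟨g1, g2, g3, g4, g5, g6, g7, g8⟩ := hq
  have c1 := conj_repQH n p q 2 g2
  have c2 := conj_repQH n p q (-2) g2
  have c3 := conj_repQH n p q 1 g2
  have c4 := conj_repQH n p q (-1) g2
  have z1 : q ^ (2 : ℤ) = q ^ 2 := by norm_cast
  have z2 : q ^ (-2 : ℤ) = (q ^ 2)⁻¹ := by rw [zpow_neg]; norm_cast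
  rw [z1] at c1
  rw [z2] at c2
  rw [zpow_one] at c3
  rw [zpow_neg_one] at c4
  have hM := inv_mul_Mtrans n p q
  have hM' := Mtrans_mul_inv n p q
  have d : repQH n q (-1) (-1) = (qHalf q)⁻¹ • repQH n q (-1) 0 := by
    rw [repQH_eq_smul n q (-1) (-1) g2, zpow_neg_one]
  have hF : ∀ x, (Mtrans n p q)⁻¹ * ((q - q⁻¹) • (x * repFq n q)) * Mtrans n p q
      = (Mtrans n p q)⁻¹ * x * Mtrans n p q * conjF n p q := by
    intro x
    rw [conjF]
    generalize (Mtrans n p q)⁻¹ = Mi at *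
    generalize Mtrans n p q = M at *
    linear_combination (norm := skip) -((q - q⁻¹) • (Mi * x * hM' * repFq n q * M))
    simp only [mul_add, add_mul, mul_sub, sub_mul, smul_mul_assoc, mul_smul_comm, neg_mul, mul_neg,
      mul_assoc, one_mul]
    module
  have hFF : (Mtrans n p q)⁻¹ * (((q - q⁻¹) * (1 + q⁻¹)) • repFq n q ^ 2) * Mtrans n p q
      = ((1 + q⁻¹) * (q - q⁻¹)⁻¹) • conjF n p q ^ 2 := by
    rw [conjF]
    generalize (Mtrans n p q)⁻¹ = Mi at *
    generalize Mtrans n p q = M at *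
    have h : (Mi * repFq n q * M) ^ 2 = Mi * repFq n q ^ 2 * M := by
      linear_combination (norm := skip) Mi * repFq n q * hM' * repFq n q * M
      simp only [mul_add, add_mul, mul_sub, sub_mul, mul_assoc, one_mul, pow_two]
      abel
    rw [smul_pow, h, smul_smul, mul_smul_comm, smul_mul_assoc]
    congr 1
    field_simp
  have e1 : Mtrans 1 p q = (!![1, 0, p / (q ^ 2 - 1); 0, 1, 0; 0, 0, 1] : Matrix (Fin 3) (Fin 3) ℂ) := by
    rw [Mtrans_one p g4, repE_one_sq]
    ext i k
    fin_cases i <;> fin_cases k <;> simp [Matrix.one_apply]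
  have e2 : (Mtrans 1 p q)⁻¹
      = (!![1, 0, -(p / (q ^ 2 - 1)); 0, 1, 0; 0, 0, 1] : Matrix (Fin 3) (Fin 3) ℂ) := by
    rw [Mtrans_one_inv p g4, repE_one_sq]
    ext i k
    fin_cases i <;> fin_cases k <;> simp [Matrix.one_apply]
  -- The index types `Fin (2 * 1 + 1)` and `Fin 3` agree by computation, so `M_{1/2}` is replaced by
  -- the explicit matrices through substitution.
  have hk : ∀ (X Y : Mat 1) (P R : Matrix (Fin 3) (Fin 3) ℂ), X = P → Y = R →
      Matrix.kronecker X (Mtrans n p q)⁻¹ * Rq n q * Matrix.kronecker Y (Mtrans n p q)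
        = Matrix.kronecker P (Mtrans n p q)⁻¹ * Rq n q * Matrix.kronecker R (Mtrans n p q) := by
    rintro _ _ _ _ rfl rfl
    rfl
  rw [RqTransformed]
  refine (hk _ _ _ _ e2 e1).trans ?_
  rw [Rq, kronecker_mul_blocks_mul_kronecker]
  congr 1
  rw [← c1, ← c2, ← c3, ← c4, ← hFF, ← hF, ← hF, d]
  generalize (Mtrans n p q)⁻¹ = Mi at *
  generalize Mtrans n p q = M at *
  generalize p / (q ^ 2 - 1) = η
  ext1 i k
  fin_cases i <;> fin_cases k <;>
    simp only [Matrix.of_apply, Fin.sum_univ_three, Matrix.cons_val, Matrix.cons_val_zero,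
      Matrix.cons_val_one, Fin.zero_eta, Fin.mk_one, Fin.reduceFinMk, mul_zero, zero_mul, zero_smul,
      smul_zero, add_zero, zero_add, mul_one, one_mul, one_smul, mul_neg, neg_mul, smul_mul_assoc,
      mul_smul_comm, hM, mul_assoc, neg_smul, smul_sub]
  · abel
  · rw [smul_comm]

theorem tendsto_blocks {B : ℂ → Matrix (Fin 3) (Fin 3) (Mat n)}
    {B₀ : Matrix (Fin 3) (Fin 3) (Mat n)}
    (h : ∀ i k, Tendsto (fun q => B q i k) (𝓝[≠] 1) (𝓝 (B₀ i k))) :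
    Tendsto (fun q => blocks (B q)) (𝓝[≠] 1) (𝓝 (blocks B₀)) := by
  refine tendsto_pi_nhds.2 fun x => tendsto_pi_nhds.2 fun y => ?_
  exact tendsto_pi_nhds.1 (tendsto_pi_nhds.1 (h x.1 y.1) x.2) y.2

theorem tendsto_RqTransformed :
    Tendsto (fun q => RqTransformed n p q) (𝓝[≠] 1) (𝓝 (contR n p)) := by
  have hT := isNilpotent_tT_sub_one p (isNilpotent_repE n)
  have h1 := (tendsto_evE_Bser n p hasDerivAt_sq_one (by norm_num)).mul (tendsto_repQH n 2)
  have h2 := (tendsto_evE_Bser n p hasDerivAt_inv_sq_one (by norm_num)).mul (tendsto_repQH n (-2))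
  -- The exponent of the limit is half the derivative of `c` at `1`: the blocks with `c = q` and `c
  -- = q⁻¹` yield the square roots `T̃^{±1/2}`.
  have d3 : HasDerivAt (fun q : ℂ => q) (2 * (1 / 2)) 1 := by
    norm_num
    exact hasDerivAt_id (1 : ℂ)
  have d4 : HasDerivAt (fun q : ℂ => q⁻¹) (2 * (-1 / 2)) 1 := by
    have e : (2 * (-1 / 2) : ℂ) = -(1 ^ 2)⁻¹ := by norm_num
    rw [e]
    exact hasDerivAt_inv one_ne_zero
  have h3 := (((tendsto_evE_Bser n p d3 rfl).mul (tendsto_repQH n 1)).mul (tendsto_conjF n p)).neg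
  have h4 := ((tendsto_evE_Bser n p d4 (by norm_num)).mul (tendsto_repQH n (-1))).mul
    (tendsto_conjF n p)
  have hs := tendsto_qHalf_zpow (-1)
  simp only [zpow_neg_one] at hs
  have h5 := hs.smul h4
  rw [evE_Tpow, unipPow_one hT, mul_one] at h1
  rw [evE_Tpow, unipPow_neg_one hT (tTinv_mul_tT p (isNilpotent_repE n)), mul_one] at h2
  rw [evE_Tpow, mul_one, mul_neg, neg_neg, mul_smul_comm] at h3
  rw [evE_Tpow, mul_one, mul_neg, one_smul, mul_smul_comm] at h5
  have key : Tendsto (fun q => blocks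
      !![evE n (Bser p q (q ^ 2)) * repQH n q 2 0,
          -(evE n (Bser p q q) * repQH n q 1 0 * conjF n p q),
          -(((1 + q⁻¹) * (q - q⁻¹)⁻¹) • conjF n p q ^ 2) + (p / (q ^ 2 - 1)) •
            (evE n (Bser p q (q ^ 2)) * repQH n q 2 0
              - evE n (Bser p q (q ^ 2)⁻¹) * repQH n q (-2) 0);
        0, 1, (qHalf q)⁻¹ • (evE n (Bser p q q⁻¹) * repQH n q (-1) 0 * conjF n p q);
        0, 0, evE n (Bser p q (q ^ 2)⁻¹) * repQH n q (-2) 0]) (𝓝[≠] 1) (𝓝 (contR n p)) := by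
    refine tendsto_blocks n fun i k => ?_
    fin_cases i <;> fin_cases k
    · exact h1
    · exact h3
    · exact tendsto_corner n p
    · exact tendsto_const_nhds
    · exact tendsto_const_nhds
    · exact h5
    · exact tendsto_const_nhds
    · exact tendsto_const_nhds
    · exact h2
  refine key.congr' ?_
  filter_upwards [eventually_good (2 * n + 2)] with q hq
  exact (RqTransformed_eq n p hq).symm

end RMatrixLimit

/-! ### Homomorphisms from the presented algebras -/

section Presentations

variable {A : Type u} [Ring A] [Algebra ℂ A]

theorem map_borelRels {B : Type*} [Ring B] [Algebra ℂ B] (φ : A →ₐ[ℂ] B) (p : ℂ) (H E K Ki : A) :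
    (borelRels p H E K Ki).map (Prod.map φ φ) = borelRels p (φ H) (φ E) (φ K) (φ Ki) := by
  simp [borelRels]

theorem map_jordanRels {B : Type*} [Ring B] [Algebra ℂ B] (φ : A →ₐ[ℂ] B) (p : ℂ)
    (g : JordanGens A) : (jordanRels p g).map (Prod.map φ φ) = jordanRels p (g.map φ) := by
  rw [jordanRels, List.map_append, map_borelRels, jordanRels]
  congr 1
  simp [jordanExtraRels, JordanGens.map]

theorem IsBorel.map {B : Type*} [Ring B] [Algebra ℂ B] (φ : A →ₐ[ℂ] B) {p : ℂ} {H E K Ki : A}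
    (h : IsBorel p H E K Ki) : IsBorel p (φ H) (φ E) (φ K) (φ Ki) := by
  rw [← forall_borelRels_iff] at h ⊢
  rw [← map_borelRels]
  simp only [List.mem_map]
  rintro _ ⟨r, hr, rfl⟩
  exact congrArg φ (h r hr)

theorem Borel.isBorel (p : ℂ) :
    IsBorel p (Borel.H p) (Borel.E p) (Borel.K p) (Borel.Ki p) :=
  forall_borelRels_iff.1 (Borel.rels_hold p)

/-- The images of the generators under a homomorphism from the Borel algebra. -/
def BGen.val (H E K Ki : A) : BGen → A
  | .H => H
  | .E => E
  | .K => K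
  | .Ki => Ki

/-- The homomorphism from the Borel algebra given by elements that satisfy its relations. -/
def Borel.lift {p : ℂ} {H E K Ki : A} (h : IsBorel p H E K Ki) : Borel p →ₐ[ℂ] A :=
  Presented.lift (BGen.val H E K Ki) fun r hr => by
    have h' := forall_borelRels_iff.2 h
    have e := map_borelRels (FreeAlgebra.lift ℂ (BGen.val H E K Ki)) p (FreeAlgebra.ι ℂ BGen.H)
      (FreeAlgebra.ι ℂ BGen.E) (FreeAlgebra.ι ℂ BGen.K) (FreeAlgebra.ι ℂ BGen.Ki)
    simp only [FreeAlgebra.lift_ι_apply, BGen.val] at e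
    rw [← e] at h'
    exact h' _ (List.mem_map_of_mem hr)

section lift

variable {p : ℂ} {H E K Ki : A} (h : IsBorel p H E K Ki)

theorem Borel.lift_H : Borel.lift h (Borel.H p) = H := Presented.lift_mk _ _ BGen.H

theorem Borel.lift_E : Borel.lift h (Borel.E p) = E := Presented.lift_mk _ _ BGen.E

theorem Borel.lift_K : Borel.lift h (Borel.K p) = K := Presented.lift_mk _ _ BGen.K

theorem Borel.lift_Ki : Borel.lift h (Borel.Ki p) = Ki := Presented.lift_mk _ _ BGen.Ki

end lift

theorem Borel.hom_ext {p : ℂ} {φ ψ : Borel p →ₐ[ℂ] A} (hH : φ (Borel.H p) = ψ (Borel.H p))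
    (hE : φ (Borel.E p) = ψ (Borel.E p)) (hK : φ (Borel.K p) = ψ (Borel.K p))
    (hKi : φ (Borel.Ki p) = ψ (Borel.Ki p)) : φ = ψ := by
  apply Presented.hom_ext
  rintro (_ | _ | _ | _)
  exacts [hH, hE, hK, hKi]

/-- A subspace that contains `1` and is stable under left multiplication by the generators is the
whole algebra. -/
theorem Borel.mem_of_left_mul {p : ℂ} (N : Submodule ℂ (Borel p)) (h1 : 1 ∈ N)
    (hH : ∀ x ∈ N, Borel.H p * x ∈ N) (hE : ∀ x ∈ N, Borel.E p * x ∈ N)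
    (hK : ∀ x ∈ N, Borel.K p * x ∈ N) (hKi : ∀ x ∈ N, Borel.Ki p * x ∈ N) (x : Borel p) :
    x ∈ N := by
  have key : ∀ y : FreeAlgebra ℂ BGen, ∀ x ∈ N, Presented.mk (freeBorelRels p) y * x ∈ N := by
    intro y
    induction y using FreeAlgebra.induction with
    | grade0 r =>
      intro x hx
      rw [AlgHom.commutes, ← Algebra.smul_def]
      exact N.smul_mem r hx
    | grade1 g =>
      rcases g with _ | _ | _ | _
      exacts [hH, hE, hK, hKi]
    | mul a b ha hb =>
      intro x hx
      rw [map_mul, mul_assoc]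
      exact ha _ (hb _ hx)
    | add a b ha hb =>
      intro x hx
      rw [map_add, add_mul]
      exact N.add_mem (ha _ hx) (hb _ hx)
  obtain ⟨y, rfl⟩ := RingQuot.mkAlgHom_surjective ℂ
    (fun x y : FreeAlgebra ℂ BGen => (x, y) ∈ freeBorelRels p) x
  have := key y 1 h1
  rw [mul_one] at this
  exact this

theorem Uh.isJordan (p : ℂ) : (Uh.gens p).IsJordan p := by
  rw [JordanGens.IsJordan, Uh.gens, ← map_jordanRels]
  simp only [List.mem_map]
  rintro _ ⟨r, hr, rfl⟩
  exact Presented.mk_rel hr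

/-- The images of the generators under a homomorphism from the super-Jordanian algebra. -/
def UGen.val (g : JordanGens A) : UGen → A
  | .H => g.H
  | .E => g.E
  | .F => g.F
  | .Y => g.Y
  | .K => g.K
  | .Ki => g.Ki

/-- The homomorphism from the super-Jordanian algebra given by elements that satisfy its
relations. -/
def Uh.lift {p : ℂ} {g : JordanGens A} (h : g.IsJordan p) : Uh p →ₐ[ℂ] A :=
  Presented.lift (UGen.val g) fun r hr => by
    have e := map_jordanRels (FreeAlgebra.lift ℂ (UGen.val g)) p freeU
    have e' : freeU.map (FreeAlgebra.lift ℂ (UGen.val g)) = g := by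
      simp only [freeU, JordanGens.map, FreeAlgebra.lift_ι_apply, UGen.val]
    rw [e'] at e
    rw [JordanGens.IsJordan, ← e] at h
    exact h _ (List.mem_map_of_mem hr)

theorem Uh.map_lift {p : ℂ} {g : JordanGens A} (h : g.IsJordan p) :
    (Uh.gens p).map (Uh.lift h) = g := by
  ext
  · exact Presented.lift_mk _ _ UGen.H
  · exact Presented.lift_mk _ _ UGen.E
  · exact Presented.lift_mk _ _ UGen.F
  · exact Presented.lift_mk _ _ UGen.Y
  · exact Presented.lift_mk _ _ UGen.K
  · exact Presented.lift_mk _ _ UGen.Ki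

theorem contrBlocks_eq_map {p : ℂ} (n : ℕ) (φ : Uh p →ₐ[ℂ] Mat n)
    (h : (Uh.gens p).map φ = contrMap p (repOsp n)) :
    contR n p = blocks ((Lmat p (Uh.gens p).H (Uh.gens p).E (Uh.gens p).K
      (Uh.gens p).Ki).map φ) := by
  have hH : φ (Uh.gens p).H = _ := congrArg JordanGens.H h
  have hE : φ (Uh.gens p).E = _ := congrArg JordanGens.E h
  have hK : φ (Uh.gens p).K = _ := congrArg JordanGens.K h
  have hKi : φ (Uh.gens p).Ki = _ := congrArg JordanGens.Ki h
  have hT := isNilpotent_tT_sub_one p (isNilpotent_repE n)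
  have h1 : (contrMap p (repOsp n)).K ^ 2 = tT p (repE n) := unipPow_half_sq hT
  have h2 : (contrMap p (repOsp n)).Ki ^ 2 = tTinv p (repE n) :=
    unipPow_neg_half_sq hT (tTinv_mul_tT p (isNilpotent_repE n))
  rw [contR]
  congr 1
  ext1 i k
  rw [Matrix.map_apply, Lmat, contRBlocks]
  fin_cases i <;> fin_cases k <;>
    simp only [Matrix.of_apply, Matrix.cons_val, Matrix.cons_val_zero, Matrix.cons_val_one,
      Fin.zero_eta, Fin.mk_one, Fin.reduceFinMk, map_pow, map_smul, map_add, map_neg, map_sub,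
      map_mul, map_one, map_zero, hH, hE, hK, hKi, h1, h2] <;> rfl

end Presentations

/-! ### The Borel algebra is a subalgebra -/

section Symbols

open PowerSeries

/-- Passing from series in `e²` to series in `e` puts `E` and `K` into one commutative ring `ℂ⟦X⟧`.
-/
theorem evE_eq_ev_repE (n : ℕ) (φ : ℂ⟦X⟧) :
    evE n φ = ev (repE n) (isNilpotent_repE n) (expand 2 two_ne_zero φ) := by
  have h : constantCoeff (X ^ 2 : ℂ⟦X⟧) = 0 := by simp
  rw [expand_apply, ev_subst _ h, evE]
  congr 2
  rw [map_pow, ev_X]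

theorem ev_repE_apply (n : ℕ) (φ : ℂ⟦X⟧) (i j : Fin (2 * n + 1)) :
    ev (repE n) (isNilpotent_repE n) φ i j
      = if (i : ℕ) ≤ j then coeff ((j : ℕ) - i) φ else 0 := by
  rw [ev_eq_sum _ (repE_pow_eq_zero n le_rfl), Matrix.sum_apply]
  simp only [Matrix.smul_apply, repE_pow_apply, smul_eq_mul, mul_ite, mul_one, mul_zero]
  split_ifs with h
  · rw [Finset.sum_eq_single ((j : ℕ) - i)]
    · rw [if_pos (by omega)]
    · intro b _ hb; rw [if_neg (by omega)]
    · intro hb; exact absurd (Finset.mem_range.2 (by omega)) hb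
  · refine Finset.sum_eq_zero fun b _ => if_neg (by omega)

/-- A family of operators on all `V_j` that maps vectors of weight `w` to `∑ₖ Pₖ(w) eᵏ`-multiples,
with polynomials `Pₖ` of degree at most `m` whose coefficients of degree `m` are those of `g`. -/
def HasSymbol (m : ℕ) (g : ℂ⟦X⟧) (z : ∀ n, Mat n) : Prop :=
  ∃ P : ℕ → Polynomial ℂ, (∀ k, (P k).natDegree ≤ m ∧ (P k).coeff m = coeff k g) ∧
    ∀ n i j, z n i j = if (i : ℕ) ≤ j then (P (j - i)).eval ((n : ℂ) - (j : ℕ)) else 0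

theorem hasSymbol_ev (g : ℂ⟦X⟧) :
    HasSymbol 0 g fun n => ev (repE n) (isNilpotent_repE n) g :=
  ⟨fun k => Polynomial.C (coeff k g), fun k => ⟨by simp, by simp⟩, fun n i j => by
    simp only [ev_repE_apply, Polynomial.eval_C]⟩

theorem HasSymbol.add {m : ℕ} {g g' : ℂ⟦X⟧} {z z' : ∀ n, Mat n} (h : HasSymbol m g z)
    (h' : HasSymbol m g' z') : HasSymbol m (g + g') (z + z') := by
  obtain ⟨P, hP, hz⟩ := h
  obtain ⟨P', hP', hz'⟩ := h'
  refine ⟨fun k => P k + P' k, fun k => ⟨?_, ?_⟩, fun n i j => ?_⟩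
  · exact (Polynomial.natDegree_add_le _ _).trans (max_le (hP k).1 (hP' k).1)
  · rw [Polynomial.coeff_add, (hP k).2, (hP' k).2, map_add]
  · rw [Pi.add_apply, Matrix.add_apply, hz, hz']
    split_ifs <;> simp

theorem HasSymbol.succ {m : ℕ} {g : ℂ⟦X⟧} {z : ∀ n, Mat n} (h : HasSymbol m g z) :
    HasSymbol (m + 1) 0 z := by
  obtain ⟨P, hP, hz⟩ := h
  refine ⟨P, fun k => ⟨(hP k).1.trans (Nat.le_succ m), ?_⟩, hz⟩
  rw [Polynomial.coeff_eq_zero_of_natDegree_lt (Nat.lt_succ_of_le (hP k).1), map_zero]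

theorem hasSymbol_zero (m : ℕ) : HasSymbol m 0 0 :=
  ⟨0, fun k => ⟨by simp, by simp⟩, fun n i j => by simp⟩

/-- The entry in row `0` and column `k` of `V_j` with `2j = n + k` is `P k` at weight `n`. A
polynomial that vanishes at all natural numbers is zero. -/
theorem HasSymbol.eq_zero {m : ℕ} {g : ℂ⟦X⟧} (h : HasSymbol m g 0) : g = 0 := by
  obtain ⟨P, hP, hz⟩ := h
  ext k
  rw [← (hP k).2, map_zero]
  suffices P k = 0 by rw [this, Polynomial.coeff_zero]
  apply Polynomial.eq_zero_of_infinite_isRoot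
  refine Set.infinite_of_injective_forall_mem (f := fun n : ℕ => ((n + k : ℕ) : ℂ) - k) ?_ ?_
  · intro a b hab
    simpa using hab
  · intro n
    have := hz (n + k) ⟨0, by omega⟩ ⟨k, by omega⟩
    simp only [Nat.zero_le, if_true, Nat.sub_zero] at this
    exact this.symm

theorem coeff_taylor_of_natDegree_le {P : Polynomial ℂ} {m : ℕ} (h : P.natDegree ≤ m) (r : ℂ) :
    (Polynomial.taylor r P).coeff m = P.coeff m := by
  rcases h.eq_or_lt with rfl | h
  · rw [Polynomial.coeff_taylor_natDegree, Polynomial.leadingCoeff]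
  · rw [Polynomial.coeff_eq_zero_of_natDegree_lt h,
      Polynomial.coeff_eq_zero_of_natDegree_lt (by rwa [Polynomial.natDegree_taylor])]

/-- A factor `e ^ b` on the right moves the column by `b` and shifts the weight argument by `b`, a
Taylor shift that keeps the coefficient of degree `m`. The symbols therefore multiply as power
series. -/
theorem HasSymbol.mul_ev {m : ℕ} {g : ℂ⟦X⟧} {z : ∀ n, Mat n} (h : HasSymbol m g z) (s : ℂ⟦X⟧) :
    HasSymbol m (g * s) fun n => z n * ev (repE n) (isNilpotent_repE n) s := by
  obtain ⟨P, hP, hz⟩ := h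
  refine ⟨fun k => ∑ b ∈ Finset.range (k + 1),
    Polynomial.C (coeff b s) * Polynomial.taylor (b : ℂ) (P (k - b)), fun k => ⟨?_, ?_⟩, ?_⟩
  · refine Polynomial.natDegree_sum_le_of_forall_le _ _ fun b _ => ?_
    refine (Polynomial.natDegree_C_mul_le _ _).trans ?_
    rw [Polynomial.natDegree_taylor]
    exact (hP _).1
  · rw [Polynomial.finsetSum_coeff, mul_comm, coeff_mul,
      Finset.Nat.sum_antidiagonal_eq_sum_range_succ_mk]
    refine Finset.sum_congr rfl fun b _ => ?_
    rw [Polynomial.coeff_C_mul, coeff_taylor_of_natDegree_le (hP _).1, (hP _).2]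
  · intro n i j
    change (z n * ev (repE n) (isNilpotent_repE n) s) i j = _
    rw [Matrix.mul_apply]
    simp only [ev_repE_apply, hz]
    rw [Fin.sum_univ_eq_sum_range (fun l => (if (i : ℕ) ≤ l then
      (P (l - i)).eval ((n : ℂ) - (l : ℕ)) else 0) * if l ≤ j then coeff ((j : ℕ) - l) s else 0)]
    rw [← Finset.sum_subset (s₁ := Finset.Icc (i : ℕ) j)]
    · split_ifs with hij
      · rw [Polynomial.eval_finsetSum]
        refine Finset.sum_nbij' (fun l => j - l) (fun b => j - b) ?_ ?_ ?_ ?_ ?_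
        · intro l hl; rw [Finset.mem_Icc] at hl; rw [Finset.mem_range]; omega
        · intro b hb; rw [Finset.mem_range] at hb; rw [Finset.mem_Icc]; omega
        · intro l hl; rw [Finset.mem_Icc] at hl; omega
        · intro b hb; rw [Finset.mem_range] at hb; omega
        · intro l hl
          rw [Finset.mem_Icc] at hl
          rw [if_pos hl.1, if_pos hl.2, Polynomial.eval_mul, Polynomial.eval_C,
            Polynomial.taylor_eval, mul_comm, Nat.cast_sub hl.2]
          congr 2
          · ring
          · congr 1; omega
      · rw [Finset.Icc_eq_empty hij, Finset.sum_empty]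
    · intro l hl
      rw [Finset.mem_Icc] at hl
      exact Finset.mem_range.2 (by omega)
    · intro l _ hl
      rw [Finset.mem_Icc, not_and_or] at hl
      rcases hl with hl | hl <;> simp [hl]

/-- Each entry is multiplied by the weight of its column, so the degree rises by one and the top
coefficient stays. -/
theorem HasSymbol.mul_repH {m : ℕ} {g : ℂ⟦X⟧} {z : ∀ n, Mat n} (h : HasSymbol m g z) :
    HasSymbol (m + 1) g fun n => z n * repH n := by
  obtain ⟨P, hP, hz⟩ := h
  refine ⟨fun k => P k * Polynomial.X, fun k => ⟨?_, ?_⟩, fun n i j => ?_⟩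
  · exact Polynomial.natDegree_mul_le.trans
      (add_le_add (hP k).1 Polynomial.natDegree_X_le)
  · rw [Polynomial.coeff_mul_X, (hP k).2]
  · change (z n * repH n) i j = _
    rw [repH, Matrix.mul_diagonal, hz]
    split_ifs
    · rw [Polynomial.eval_mul, Polynomial.eval_X, weight]; push_cast; rfl
    · rw [zero_mul]

/-- In the domain `ℂ⟦X⟧` an element algebraic over the algebraically closed field `ℂ` is a constant,
whereas `X²` has coefficient `ap ≠ 0` here. -/
theorem not_isIntegral_expand_Tpow {p : ℂ} (hp : p ≠ 0) {a : ℂ} (ha : a ≠ 0) :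
    ¬ IsIntegral ℂ (expand 2 two_ne_zero (Tpow p a)) := by
  intro h
  have h1 := IsAlgClosed.degree_eq_one_of_irreducible ℂ (minpoly.irreducible h)
  obtain ⟨r, hr⟩ := minpoly.mem_range_of_degree_eq_one _ _ h1
  have h2 := congrArg (coeff (2 * 1)) hr
  rw [coeff_expand_mul] at h2
  change coeff (2 * 1) (C r) = _ at h2
  rw [coeff_C, if_neg (by norm_num)] at h2
  have h4 := congrArg constantCoeff (Sser_mul_derivative_Tpow p a)
  rw [map_mul, map_mul, constantCoeff_Sser, one_mul, constantCoeff_Tpow, constantCoeff_C,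
    ← coeff_zero_eq_constantCoeff_apply, coeff_derivative, zero_add, ← h2, zero_mul, mul_one] at h4
  exact mul_ne_zero ha hp h4.symm

theorem eq_zero_of_aeval_expand_Tpow {p : ℂ} (hp : p ≠ 0) {a : ℂ} (ha : a ≠ 0) {P : Polynomial ℂ}
    (h : Polynomial.aeval (expand 2 two_ne_zero (Tpow p a)) P = 0) : P = 0 := by
  by_contra h0
  exact not_isIntegral_expand_Tpow hp ha
    (isAlgebraic_iff_isIntegral.1 ⟨P, h0, h⟩)

theorem rescale_neg_one_expand (φ : ℂ⟦X⟧) :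
    rescale (-1) (expand 2 two_ne_zero φ) = expand 2 two_ne_zero φ := by
  ext k
  rw [coeff_rescale, coeff_expand]
  split_ifs with h
  · rw [(even_iff_two_dvd.2 h).neg_one_pow, one_mul]
  · rw [mul_zero]

/-- The substitution `X ↦ -X` separates the even part `P` from the odd part `Q X`; transcendence
then treats each of them. -/
theorem aeval_expand_add_mul_X_eq_zero {p : ℂ} (hp : p ≠ 0) {a : ℂ} (ha : a ≠ 0)
    {P Q : Polynomial ℂ} (h : Polynomial.aeval (expand 2 two_ne_zero (Tpow p a)) P
      + Polynomial.aeval (expand 2 two_ne_zero (Tpow p a)) Q * X = 0) : P = 0 ∧ Q = 0 := by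
  have hr : ∀ P : Polynomial ℂ, rescale (-1)
      (Polynomial.aeval (expand 2 two_ne_zero (Tpow p a)) P)
        = Polynomial.aeval (expand 2 two_ne_zero (Tpow p a)) P := by
    intro P
    rw [Polynomial.aeval_def, Polynomial.hom_eval₂, rescale_neg_one_expand]
    congr 1
    ext1 r
    change rescale (-1 : ℂ) (C r) = C r
    ext k
    rw [coeff_rescale, coeff_C]
    split_ifs with hk
    · rw [hk, pow_zero, one_mul]
    · rw [mul_zero]
  have h' := congrArg (rescale (-1 : ℂ)) h
  rw [map_add, map_mul, hr, hr, rescale_X, map_zero, map_neg, map_one] at h'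
  have h2 : (2 : ℂ⟦X⟧) ≠ 0 := fun h0 => by
    have := congrArg constantCoeff h0
    rw [map_ofNat, map_zero] at this
    exact two_ne_zero this
  have hP : (2 : ℂ⟦X⟧) * Polynomial.aeval (expand 2 two_ne_zero (Tpow p a)) P = 0 := by
    linear_combination h + h'
  have hQ : (2 * X : ℂ⟦X⟧) * Polynomial.aeval (expand 2 two_ne_zero (Tpow p a)) Q = 0 := by
    linear_combination h - h'
  exact ⟨eq_zero_of_aeval_expand_Tpow hp ha ((mul_eq_zero.1 hP).resolve_left h2),
    eq_zero_of_aeval_expand_Tpow hp ha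
      ((mul_eq_zero.1 hQ).resolve_left (mul_ne_zero h2 X_ne_zero))⟩

end Symbols

/-! ### Normal forms in the Borel algebra and joint faithfulness of the representations -/

section Injectivity

open PowerSeries

variable {p : ℂ}

/-- The representation of the Borel algebra on `V_j`, `j = n / 2`. -/
def Borel.rep (hp : p ≠ 0) (n : ℕ) : Borel p →ₐ[ℂ] Mat n :=
  Borel.lift (isBorel_tT hp (isNilpotent_repE n) (repOsp_isOsp n).he)

variable (p) in
/-- The commutative subalgebra generated by `K, K⁻¹` and `E`. -/
def Borel.torus : Subalgebra ℂ (Borel p) :=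
  Algebra.adjoin ℂ {Borel.K p, Borel.Ki p, Borel.E p}

theorem Borel.K_mem_torus : Borel.K p ∈ Borel.torus p := Algebra.subset_adjoin (by simp)

theorem Borel.Ki_mem_torus : Borel.Ki p ∈ Borel.torus p := Algebra.subset_adjoin (by simp)

theorem Borel.E_mem_torus : Borel.E p ∈ Borel.torus p := Algebra.subset_adjoin (by simp)

/-- The derivation `[H, ·]` maps the generators of the torus into it. Hence `H` can always be moved
to the right of torus elements. -/
theorem Borel.commutator_H_mem_torus {c : Borel p} (hc : c ∈ Borel.torus p) :
    Borel.H p * c - c * Borel.H p ∈ Borel.torus p := by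
  have hB := Borel.isBorel p
  induction hc using Algebra.adjoin_induction with
  | mem x hx =>
    have hK := Borel.K_mem_torus (p := p)
    have hKi := Borel.Ki_mem_torus (p := p)
    have hE := Borel.E_mem_torus (p := p)
    rcases hx with rfl | rfl | rfl
    · rw [hB.HK]
      exact Subalgebra.smul_mem _ (sub_mem (pow_mem hK 3) hKi) _
    · rw [inverse_commutator hB.HK hB.KKi hB.KiK]
      exact neg_mem (mul_mem (mul_mem hKi
        (Subalgebra.smul_mem _ (sub_mem (pow_mem hK 3) hKi) _)) hKi)
    · rw [hB.HE]
      exact Subalgebra.smul_mem _ (mul_mem (add_mem (pow_mem hK 2) (pow_mem hKi 2)) hE) _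
  | algebraMap r =>
    rw [← Algebra.commutes, sub_self]
    exact zero_mem _
  | add x y _ _ hx hy =>
    have : Borel.H p * (x + y) - (x + y) * Borel.H p
      = (Borel.H p * x - x * Borel.H p) + (Borel.H p * y - y * Borel.H p) := by noncomm_ring
    rw [this]
    exact add_mem hx hy
  | mul x y hx' hy' hx hy =>
    have : Borel.H p * (x * y) - x * y * Borel.H p
      = (Borel.H p * x - x * Borel.H p) * y + x * (Borel.H p * y - y * Borel.H p) := by noncomm_ring
    rw [this]
    exact add_mem (mul_mem hx hy') (mul_mem hx' hy)

/-- The elements `∑ₐ cₐ Hᵃ` with `a < m` and `cₐ` in the torus. -/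
def Borel.filt (p : ℂ) : ℕ → Submodule ℂ (Borel p)
  | 0 => ⊥
  | m + 1 => Borel.filt p m ⊔
      (Subalgebra.toSubmodule (Borel.torus p)).map (LinearMap.mulRight ℂ (Borel.H p ^ m))

theorem Borel.mem_filt_succ {m : ℕ} {x : Borel p} : x ∈ Borel.filt p (m + 1) ↔
    ∃ y ∈ Borel.filt p m, ∃ c ∈ Borel.torus p, x = y + c * Borel.H p ^ m := by
  rw [Borel.filt, Submodule.mem_sup]
  constructor
  · rintro ⟨y, hy, _, ⟨c, hc, rfl⟩, rfl⟩
    exact ⟨y, hy, c, hc, rfl⟩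
  · rintro ⟨y, hy, c, hc, rfl⟩
    exact ⟨y, hy, _, ⟨c, hc, rfl⟩, rfl⟩

theorem Borel.monotone_filt : Monotone (Borel.filt p) :=
  monotone_nat_of_le_succ fun _ => le_sup_left

theorem Borel.mul_mem_filt {m : ℕ} {x c : Borel p} (hc : c ∈ Borel.torus p)
    (hx : x ∈ Borel.filt p m) : c * x ∈ Borel.filt p m := by
  induction m generalizing x with
  | zero =>
    rw [Borel.filt, Submodule.mem_bot] at hx ⊢
    rw [hx, mul_zero]
  | succ m ih =>
    obtain ⟨y, hy, d, hd, rfl⟩ := Borel.mem_filt_succ.1 hx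
    exact Borel.mem_filt_succ.2 ⟨_, ih hy, _, mul_mem hc hd, by rw [mul_add, mul_assoc]⟩

theorem Borel.H_mul_mem_filt {m : ℕ} {x : Borel p} (hx : x ∈ Borel.filt p m) :
    Borel.H p * x ∈ Borel.filt p (m + 1) := by
  induction m generalizing x with
  | zero =>
    rw [Borel.filt, Submodule.mem_bot] at hx
    rw [hx, mul_zero]
    exact zero_mem _
  | succ m ih =>
    obtain ⟨y, hy, d, hd, rfl⟩ := Borel.mem_filt_succ.1 hx
    refine Borel.mem_filt_succ.2 ⟨Borel.H p * y
      + (Borel.H p * d - d * Borel.H p) * Borel.H p ^ m, add_mem (ih hy) ?_, d, hd, ?_⟩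
    · exact Borel.mem_filt_succ.2 ⟨0, zero_mem _, _, Borel.commutator_H_mem_torus hd,
        (zero_add _).symm⟩
    · rw [pow_succ']; noncomm_ring

/-- The spanning half of a Poincaré–Birkhoff–Witt theorem: the union of the filtration contains `1`
and is stable under left multiplication by the generators. -/
theorem Borel.exists_mem_filt (x : Borel p) : ∃ m, x ∈ Borel.filt p m := by
  have hdir : Directed (· ≤ ·) (Borel.filt p) := Borel.monotone_filt.directed_le
  have key : x ∈ ⨆ m, Borel.filt p m := by
    apply Borel.mem_of_left_mul
    · exact Submodule.mem_iSup_of_mem 1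
        (Borel.mem_filt_succ.2 ⟨0, zero_mem _, 1, one_mem _, by simp⟩)
    · intro x hx
      obtain ⟨m, hm⟩ := (Submodule.mem_iSup_of_directed _ hdir).1 hx
      exact Submodule.mem_iSup_of_mem (m + 1) (Borel.H_mul_mem_filt hm)
    all_goals
      intro x hx
      obtain ⟨m, hm⟩ := (Submodule.mem_iSup_of_directed _ hdir).1 hx
      refine Submodule.mem_iSup_of_mem m (Borel.mul_mem_filt ?_ hm)
    exacts [Borel.E_mem_torus, Borel.K_mem_torus, Borel.Ki_mem_torus]
  exact (Submodule.mem_iSup_of_directed _ hdir).1 key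

theorem Borel.exists_ev_eq_rep (hp : p ≠ 0) {c : Borel p} (hc : c ∈ Borel.torus p) :
    ∃ φ : ℂ⟦X⟧, ∀ n, Borel.rep hp n c = ev (repE n) (isNilpotent_repE n) φ := by
  have hK : ∀ n a, unipPow a (tT p (repE n)) = ev (repE n) (isNilpotent_repE n)
      (expand 2 two_ne_zero (Tpow p a)) := fun n a => by
    rw [← evE_eq_ev_repE, evE_Tpow]
  induction hc using Algebra.adjoin_induction with
  | mem x hx =>
    rcases hx with rfl | rfl | rfl
    · exact ⟨_, fun n => (Borel.lift_K _).trans (hK n _)⟩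
    · exact ⟨_, fun n => (Borel.lift_Ki _).trans (hK n _)⟩
    · exact ⟨X, fun n => (Borel.lift_E _).trans (ev_X _).symm⟩
  | algebraMap r => exact ⟨C r, fun n => by rw [ev_C, AlgHom.commutes]⟩
  | add x y _ _ hx hy =>
    obtain ⟨φ, hφ⟩ := hx
    obtain ⟨ψ, hψ⟩ := hy
    exact ⟨φ + ψ, fun n => by rw [map_add, map_add, hφ, hψ]⟩
  | mul x y _ _ hx hy =>
    obtain ⟨φ, hφ⟩ := hx
    obtain ⟨ψ, hψ⟩ := hy
    exact ⟨φ * ψ, fun n => by rw [map_mul, map_mul, hφ, hψ]⟩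

/-- A power of `K` clears the negative powers, and the relation for `E²` removes all but the first
power of `E`. -/
theorem Borel.exists_normal_form {c : Borel p} (hc : c ∈ Borel.torus p) :
    ∃ (N : ℕ) (P Q : Polynomial ℂ), Borel.K p ^ N * c
      = Polynomial.aeval (Borel.K p) P + Polynomial.aeval (Borel.K p) Q * Borel.E p := by
  -- Stability of the normal form under left multiplication by `c` is the version that passes to
  -- products.
  suffices ∀ x : Borel p, (∃ (N : ℕ) (P Q : Polynomial ℂ), Borel.K p ^ N * x
      = Polynomial.aeval (Borel.K p) P + Polynomial.aeval (Borel.K p) Q * Borel.E p) →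
      ∃ (N : ℕ) (P Q : Polynomial ℂ), Borel.K p ^ N * (c * x)
      = Polynomial.aeval (Borel.K p) P + Polynomial.aeval (Borel.K p) Q * Borel.E p by
    simpa using this 1 ⟨0, 1, 0, by simp⟩
  have hB := Borel.isBorel p
  have hKE : ∀ P : Polynomial ℂ, Borel.E p * Polynomial.aeval (Borel.K p) P
      = Polynomial.aeval (Borel.K p) P * Borel.E p := fun P => by
    rw [Polynomial.aeval_eq_sum_range]
    have : Commute (Borel.E p) (Borel.K p) := hB.KE.symm
    exact Commute.sum_right _ _ _ fun i _ => (this.pow_right i).smul_right _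
  induction hc using Algebra.adjoin_induction with
  | mem y hy =>
    rintro x ⟨N, P, Q, h⟩
    rcases hy with rfl | rfl | rfl
    · refine ⟨N, Polynomial.X * P, Polynomial.X * Q, ?_⟩
      rw [← mul_assoc, ← pow_succ, pow_succ', mul_assoc, h]
      simp [mul_add, mul_assoc]
    · refine ⟨N + 1, P, Q, ?_⟩
      rw [pow_succ, mul_assoc, ← mul_assoc (Borel.K p), hB.KKi, one_mul, h]
    -- The witnesses come from `K²E² = (2p)⁻¹(K⁴ - 1)`; the extra `K²` clears the `K⁻²` in `E²`.
    · refine ⟨N + 2, Polynomial.C (2 * p)⁻¹ * (Polynomial.X ^ 4 - 1) * Q, Polynomial.X ^ 2 * P, ?_⟩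
      have hN : Borel.K p ^ N * Borel.E p = Borel.E p * Borel.K p ^ N := by
        have := (hKE (Polynomial.X ^ N)).symm
        simpa using this
      have hEE : Borel.K p ^ 2 * Borel.E p ^ 2 = (2 * p)⁻¹ • (Borel.K p ^ 4 - 1) := by
        rw [hB.EE, mul_smul_comm, mul_sub, ← pow_add, pow_two_mul_pow_two hB.KKi]
      have hP := hKE P
      have hQ := hKE Q
      have hKQ : Borel.K p ^ 2 * Polynomial.aeval (Borel.K p) Q
          = Polynomial.aeval (Borel.K p) Q * Borel.K p ^ 2 := by
        rw [← Polynomial.aeval_X_pow (R := ℂ), ← map_mul, mul_comm, map_mul]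
      have hR : Polynomial.aeval (Borel.K p) (Polynomial.C (2 * p)⁻¹ * (Polynomial.X ^ 4 - 1) * Q)
          = Polynomial.aeval (Borel.K p) Q * ((2 * p)⁻¹ • (Borel.K p ^ 4 - 1)) := by
        rw [mul_comm, map_mul, map_mul, Polynomial.aeval_C, map_sub, map_one,
          Polynomial.aeval_X_pow, Algebra.smul_def]
      rw [hR, ← hEE, map_mul, Polynomial.aeval_X_pow]
      calc Borel.K p ^ (N + 2) * (Borel.E p * x)
          = Borel.K p ^ 2 * (Borel.K p ^ N * Borel.E p) * x := by rw [add_comm, pow_add]; noncomm_ring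
        _ = Borel.K p ^ 2 * Borel.E p * (Borel.K p ^ N * x) := by rw [hN]; noncomm_ring
        _ = Borel.K p ^ 2 * (Borel.E p * Polynomial.aeval (Borel.K p) P)
            + Borel.K p ^ 2 * (Borel.E p * Polynomial.aeval (Borel.K p) Q) * Borel.E p := by
          rw [h]; noncomm_ring
        _ = (Borel.K p ^ 2 * Polynomial.aeval (Borel.K p) Q) * (Borel.E p * Borel.E p)
            + Borel.K p ^ 2 * Polynomial.aeval (Borel.K p) P * Borel.E p := by
          rw [hP, hQ]; noncomm_ring
        _ = _ := by rw [hKQ, pow_two (Borel.E p)]; noncomm_ring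
  | algebraMap r =>
    rintro x ⟨N, P, Q, h⟩
    refine ⟨N, Polynomial.C r * P, Polynomial.C r * Q, ?_⟩
    rw [← Algebra.smul_def, mul_smul_comm, h]
    simp [Algebra.smul_def, mul_add, mul_assoc]
  | add y z _ _ hy hz =>
    intro x hx
    obtain ⟨N, P, Q, h⟩ := hy x hx
    obtain ⟨N', P', Q', h'⟩ := hz x hx
    refine ⟨N + N', Polynomial.X ^ N' * P + Polynomial.X ^ N * P',
      Polynomial.X ^ N' * Q + Polynomial.X ^ N * Q', ?_⟩
    rw [add_mul, mul_add, pow_add]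
    nth_rewrite 1 [← pow_add]
    rw [add_comm N, pow_add, mul_assoc, mul_assoc, h, h']
    simp only [map_add, map_mul, map_pow, Polynomial.aeval_X, mul_add, add_mul, mul_assoc]
    abel
  | mul y z _ _ hy hz =>
    intro x hx
    rw [mul_assoc]
    exact hy _ (hz x hx)

/-- In the representations `E` becomes `X` and `K` becomes the transcendental series of `T^{1/2}` at
`X²`, so both polynomials of the normal form vanish. -/
theorem Borel.eq_zero_of_mem_torus (hp : p ≠ 0) {c : Borel p} (hc : c ∈ Borel.torus p)
    (h : ∀ n, Borel.rep hp n c = 0) : c = 0 := by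
  obtain ⟨N, P, Q, e⟩ := Borel.exists_normal_form hc
  have hn : ∀ n, ev (repE n) (isNilpotent_repE n)
      (Polynomial.aeval (expand 2 two_ne_zero (Tpow p (1 / 2))) P
        + Polynomial.aeval (expand 2 two_ne_zero (Tpow p (1 / 2))) Q * X) = 0 := by
    intro n
    have h1 := congrArg (Borel.rep hp n) e
    rw [map_mul, h n, mul_zero, map_add, map_mul, ← Polynomial.aeval_algHom_apply,
      ← Polynomial.aeval_algHom_apply] at h1
    have hK : Borel.rep hp n (Borel.K p)
        = ev (repE n) (isNilpotent_repE n) (expand 2 two_ne_zero (Tpow p (1 / 2))) := by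
      rw [← evE_eq_ev_repE, evE_Tpow]
      exact Borel.lift_K _
    have hE : Borel.rep hp n (Borel.E p) = repE n := Borel.lift_E _
    rw [hK, hE] at h1
    rw [map_add, map_mul, ev_X, ← Polynomial.aeval_algHom_apply, ← Polynomial.aeval_algHom_apply,
      ← h1]
  have h0 : HasSymbol 0 (Polynomial.aeval (expand 2 two_ne_zero (Tpow p (1 / 2))) P
      + Polynomial.aeval (expand 2 two_ne_zero (Tpow p (1 / 2))) Q * X) 0 := by
    have := hasSymbol_ev (Polynomial.aeval (expand 2 two_ne_zero (Tpow p (1 / 2))) P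
        + Polynomial.aeval (expand 2 two_ne_zero (Tpow p (1 / 2))) Q * X)
    rw [funext hn] at this
    exact this
  obtain ⟨rfl, rfl⟩ := aeval_expand_add_mul_X_eq_zero hp (by norm_num) h0.eq_zero
  have hB := Borel.isBorel p
  have hKK : Borel.Ki p ^ N * Borel.K p ^ N = 1 := by
    rw [← (show Commute (Borel.Ki p) (Borel.K p) from hB.KiK.trans hB.KKi.symm).mul_pow, hB.KiK,
      one_pow]
  rw [map_zero, zero_mul, add_zero] at e
  rw [← one_mul c, ← hKK, mul_assoc, e, mul_zero]

/-- Each factor `H = S h` multiplies the symbol by the series of `S`. Its constant term is `1`, so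
the symbol vanishes only if that of `c` does. -/
theorem Borel.exists_hasSymbol_mul_H_pow (hp : p ≠ 0) {c : Borel p} (hc : c ∈ Borel.torus p)
    (m : ℕ) : ∃ φ : ℂ⟦X⟧, (φ = 0 → c = 0) ∧
      HasSymbol m φ fun n => Borel.rep hp n (c * Borel.H p ^ m) := by
  induction m with
  | zero =>
    obtain ⟨φ, hφ⟩ := Borel.exists_ev_eq_rep hp hc
    refine ⟨φ, ?_, ?_⟩
    · rintro rfl
      exact Borel.eq_zero_of_mem_torus hp hc fun n => by rw [hφ, map_zero]
    · simp only [pow_zero, mul_one, hφ]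
      exact hasSymbol_ev φ
  | succ m ih =>
    obtain ⟨φ, h0, h⟩ := ih
    refine ⟨φ * expand 2 two_ne_zero (Sser p), ?_, ?_⟩
    · intro h1
      apply h0
      refine (mul_eq_zero.1 h1).resolve_right fun h2 => ?_
      have := congrArg constantCoeff h2
      rw [constantCoeff_expand, constantCoeff_Sser, map_zero] at this
      exact one_ne_zero this
    · convert (h.mul_ev (expand 2 two_ne_zero (Sser p))).mul_repH using 2 with n
      have hH : Borel.rep hp n (Borel.H p) = _ := Borel.lift_H _
      rw [pow_succ, ← mul_assoc, map_mul, hH, tH_eq p (isNilpotent_repE n), ← evE_eq_ev_repE,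
        ← mul_assoc]
      rfl

theorem Borel.exists_hasSymbol_of_mem_filt (hp : p ≠ 0) {m : ℕ} {x : Borel p}
    (hx : x ∈ Borel.filt p m) : HasSymbol m 0 fun n => Borel.rep hp n x := by
  induction m generalizing x with
  | zero =>
    rw [Borel.filt, Submodule.mem_bot] at hx
    subst hx
    simp only [map_zero]
    exact hasSymbol_zero 0
  | succ m ih =>
    obtain ⟨y, hy, c, hc, rfl⟩ := Borel.mem_filt_succ.1 hx
    obtain ⟨φ, -, h⟩ := Borel.exists_hasSymbol_mul_H_pow hp hc m
    have := (ih hy).succ.add h.succ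
    rw [add_zero] at this
    simp only [map_add]
    exact this

/-- The symbol of degree `m` sees only the leading term `c Hᵐ`. It vanishes, hence so does `c`, and
induction on the filtration degree finishes. -/
theorem Borel.eq_zero_of_rep_eq_zero (hp : p ≠ 0) {x : Borel p}
    (h : ∀ n, Borel.rep hp n x = 0) : x = 0 := by
  obtain ⟨m, hm⟩ := Borel.exists_mem_filt x
  induction m generalizing x with
  | zero => rwa [Borel.filt, Submodule.mem_bot] at hm
  | succ m ih =>
    obtain ⟨y, hy, c, hc, rfl⟩ := Borel.mem_filt_succ.1 hm
    obtain ⟨φ, h0, h1⟩ := Borel.exists_hasSymbol_mul_H_pow hp hc m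
    have h2 := (Borel.exists_hasSymbol_of_mem_filt hp hy).add h1
    rw [zero_add] at h2
    have h3 : (fun n => Borel.rep hp n y) + (fun n => Borel.rep hp n (c * Borel.H p ^ m)) = 0 := by
      funext n
      have := h n
      rwa [map_add] at this
    rw [h3] at h2
    have hc0 := h0 h2.eq_zero
    subst hc0
    rw [zero_mul, add_zero] at h ⊢
    exact ih h hy

/-- Every `Borel.rep` extends to the whole algebra by the contraction map, so an element of the
kernel is killed by a jointly faithful family. -/
theorem Borel.exists_injective (hp : p ≠ 0) :
    ∃ ι : Borel p →ₐ[ℂ] Uh p, Function.Injective ι ∧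
      ι (Borel.H p) = (Uh.gens p).H ∧ ι (Borel.E p) = (Uh.gens p).E ∧
      ι (Borel.K p) = (Uh.gens p).K ∧ ι (Borel.Ki p) = (Uh.gens p).Ki := by
  have hB := (JordanGens.isJordan_iff.1 (Uh.isJordan p)).1
  refine ⟨Borel.lift hB, ?_, Borel.lift_H _, Borel.lift_E _, Borel.lift_K _, Borel.lift_Ki _⟩
  rw [injective_iff_map_eq_zero]
  intro x hx
  apply Borel.eq_zero_of_rep_eq_zero hp
  intro n
  have hJ := contrMap_isJordan hp (repOsp_isOsp n) (isNilpotent_repE n)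
  have e : Borel.rep hp n = (Uh.lift hJ).comp (Borel.lift hB) := by
    have hm := Uh.map_lift hJ
    apply Borel.hom_ext <;> simp only [AlgHom.comp_apply, Borel.lift_H, Borel.lift_E, Borel.lift_K,
      Borel.lift_Ki, Borel.rep]
    · exact (congrArg JordanGens.H hm).symm
    · exact (congrArg JordanGens.E hm).symm
    · exact (congrArg JordanGens.K hm).symm
    · exact (congrArg JordanGens.Ki hm).symm
  rw [e, AlgHom.comp_apply, hx, map_zero]

end Injectivity

/-! ### The graded `RLL` relations -/

section RLLRelations

/-- In dimension three `e³ = 0`, so `T̃ᵃe = e`, `H̃ = h` and `T̃^{±1}` is linear in `e²`. -/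
theorem contRBlocks_one (p : ℂ) : contRBlocks 1 p = !![1 + p • repE 1 ^ 2, p • repE 1,
    -(p • repH 1) + (p ^ 2 / 2) • repE 1 ^ 2; 0, 1, -(p • repE 1); 0, 0, 1 - p • repE 1 ^ 2] := by
  have h4 : repE 1 ^ 4 = 0 := repE_pow_eq_zero 1 (by norm_num)
  have h3 : repE 1 ^ 2 * repE 1 = 0 := by
    rw [← pow_succ]; exact repE_pow_eq_zero 1 (by norm_num)
  have hu : unipPow (1 / 2) (1 : Mat 1) = 1 := by
    rw [unipPow_eq_ev _ (by simp), ev_eq_sum _ (N := 1) (by simp), Finset.sum_range_one,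
      PowerSeries.coeff_zero_eq_constantCoeff_apply, constantCoeff_bser, pow_zero, one_smul]
  have hT : tT p (repE 1) = 1 + p • repE 1 ^ 2 := by
    rw [tT, h4, smul_zero, add_zero, hu, add_comm]
  have hTi : tTinv p (repE 1) = 1 - p • repE 1 ^ 2 := by
    rw [tTinv, h4, smul_zero, add_zero, hu]; abel
  have hT2 : (tT p (repE 1) - 1) ^ 2 = 0 := by
    rw [hT, add_sub_cancel_left, smul_pow, ← pow_mul, h4, smul_zero]
  have hp : ∀ a, unipPow a (tT p (repE 1)) * repE 1 = repE 1 := by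
    intro a
    rw [unipPow_eq_ev _ (isNilpotent_tT_sub_one p (isNilpotent_repE 1)), ev_eq_sum _ hT2,
      Finset.sum_range_succ, Finset.sum_range_one,
      PowerSeries.coeff_zero_eq_constantCoeff_apply, constantCoeff_bser, hT, add_sub_cancel_left,
      add_mul, pow_zero, one_smul, one_mul, pow_one, smul_mul_assoc, smul_mul_assoc, h3]
    simp
  have hH : tH p (repE 1) (repH 1) = repH 1 := by
    rw [tH, hT, hTi, show (1 + p • repE 1 ^ 2) + (1 - p • repE 1 ^ 2) = (2 : ℂ) • (1 : Mat 1) by module,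
      smul_mul_assoc, one_mul, smul_smul]
    norm_num
  have hc : -(p • repH 1) + (p / 4) • ((1 + p • repE 1 ^ 2) - (1 - p • repE 1 ^ 2))
      = -(p • repH 1) + (p ^ 2 / 2) • repE 1 ^ 2 := by module
  rw [← hc, ← hT, ← hTi, contRBlocks]
  simp only [hp, hH]

/-- The entries of `R_𝗁^{1/2;1/2}`, in `3 × 3` blocks. -/
def fundR (p : ℂ) : Matrix (Fin 3) (Fin 3) (Matrix (Fin 3) (Fin 3) ℂ) :=
  !![!![1, 0, p; 0, 1, 0; 0, 0, 1], !![0, p, 0; 0, 0, p; 0, 0, 0],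
      !![-p, 0, p ^ 2 / 2; 0, 0, 0; 0, 0, p];
    !![0, 0, 0; 0, 0, 0; 0, 0, 0], !![1, 0, 0; 0, 1, 0; 0, 0, 1], !![0, -p, 0; 0, 0, -p; 0, 0, 0];
    !![0, 0, 0; 0, 0, 0; 0, 0, 0], !![0, 0, 0; 0, 0, 0; 0, 0, 0], !![1, 0, -p; 0, 1, 0; 0, 0, 1]]

theorem contR_one_apply (p : ℂ) (i k j l : Fin 3) : contR 1 p (i, k) (j, l) = fundR p i j k l := by
  have h1 : ∀ a b : Fin 3, (1 : Mat 1) a b = if a = b then 1 else 0 := fun a b => Matrix.one_apply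
  have h0 : ∀ a b : Fin 3, (0 : Mat 1) a b = 0 := fun a b => rfl
  have hE : ∀ a b : Fin 3, repE 1 a b = if (a : ℕ) + 1 = b then 1 else 0 := fun a b => rfl
  have hE2 : ∀ a b : Fin 3, (repE 1 ^ 2) a b = if (a : ℕ) + 2 = b then 1 else 0 := fun a b =>
    repE_pow_apply 1 2 a b
  have hH : ∀ a b : Fin 3, repH 1 a b = if a = b then (1 : ℂ) - ((a : ℕ) : ℂ) else 0 := fun a b => by
    rw [repH, Matrix.diagonal_apply, weight]
    push_cast
    rfl
  have hadd : ∀ (X Y : Mat 1) (a b : Fin 3), (X + Y) a b = X a b + Y a b := fun _ _ _ _ => rfl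
  have hsub : ∀ (X Y : Mat 1) (a b : Fin 3), (X - Y) a b = X a b - Y a b := fun _ _ _ _ => rfl
  have hneg : ∀ (X : Mat 1) (a b : Fin 3), (-X) a b = -X a b := fun _ _ _ => rfl
  have hsmul : ∀ (c : ℂ) (X : Mat 1) (a b : Fin 3), (c • X) a b = c * X a b := fun _ _ _ _ => rfl
  change contRBlocks 1 p i j k l = _
  rw [contRBlocks_one, fundR]
  fin_cases i <;> fin_cases j <;>
    simp only [Matrix.of_apply, Matrix.cons_val, Matrix.cons_val_zero, Matrix.cons_val_one,
      Fin.zero_eta, Fin.mk_one, Fin.reduceFinMk, h1, h0, hE, hE2, hH, hadd, hsub, hneg, hsmul] <;>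
    fin_cases k <;> fin_cases l <;> simp
  norm_num

variable {A : Type u} [Ring A]

theorem par_zero : par 0 = 0 := rfl

theorem par_one : par 1 = 1 := rfl

theorem par_two : par 2 = 0 := rfl

theorem gKron_mul_gKron (L : Matrix (Fin 3) (Fin 3) A) (i k j l : Fin 3) :
    (gKron L 1 * gKron 1 L) (i, k) (j, l) = (-1) ^ (par k * (par i + par j)) * (L i j * L k l) := by
  have hs : ∀ j : Fin 3, (-1 : A) ^ (par k * (par j + par j)) = 1 := fun j => by
    rw [← two_mul, mul_left_comm, pow_mul]; simp
  rw [Matrix.mul_apply, Fintype.sum_prod_type, Finset.sum_eq_single j, Finset.sum_eq_single k]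
  · simp [gKron, hs, mul_assoc]
  · intro b _ hb; simp [gKron, Matrix.one_apply, hb.symm]
  · simp
  · intro b _ hb
    refine Finset.sum_eq_zero fun a _ => ?_
    simp [gKron, Matrix.one_apply, hb]
  · simp

/-- The identity factors leave a single intermediate index. In this order the odd index that is
passed is the column `l`, whereas in the other order it is the row `k`. -/
theorem gKron_mul_gKron' (L : Matrix (Fin 3) (Fin 3) A) (i k j l : Fin 3) :
    (gKron 1 L * gKron L 1) (i, k) (j, l) = (-1) ^ (par l * (par i + par j)) * (L k l * L i j) := by
  have hs : ∀ j k : Fin 3, (-1 : A) ^ (par k * (par j + par j)) = 1 := fun j k => by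
    rw [← two_mul, mul_left_comm, pow_mul]; simp
  have hc : ∀ (n : ℕ) (x : A), x * (-1) ^ n = (-1) ^ n * x := fun n x =>
    ((Commute.neg_one_right x).pow_right n).eq
  rw [Matrix.mul_apply, Fintype.sum_prod_type, Finset.sum_eq_single i, Finset.sum_eq_single l]
  · simp [gKron, hs, ← mul_assoc, hc]
  · intro b _ hb; simp [gKron, Matrix.one_apply, hb]
  · simp
  · intro b _ hb
    refine Finset.sum_eq_zero fun a _ => ?_
    simp [gKron, Matrix.one_apply, hb.symm]
  · simp

variable [Algebra ℂ A]

/-- The rows of `R_𝗁^{1/2;1/2}`, applied to a vector. -/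
def rowR (p : ℂ) (X : Fin 3 → Fin 3 → A) : Fin 3 → Fin 3 → A
  | 0, 0 => X 0 0 + p • X 0 2 + p • X 1 1 - p • X 2 0 + (p ^ 2 / 2) • X 2 2
  | 0, 1 => X 0 1 + p • X 1 2
  | 0, 2 => X 0 2 + p • X 2 2
  | 1, 0 => X 1 0 - p • X 2 1
  | 1, 1 => X 1 1 - p • X 2 2
  | 1, 2 => X 1 2
  | 2, 0 => X 2 0 - p • X 2 2
  | 2, 1 => X 2 1
  | 2, 2 => X 2 2

/-- The columns of `R_𝗁^{1/2;1/2}`, applied to a vector. -/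
def colR (p : ℂ) (X : Fin 3 → Fin 3 → A) : Fin 3 → Fin 3 → A
  | 0, 0 => X 0 0
  | 0, 1 => X 0 1
  | 0, 2 => p • X 0 0 + X 0 2
  | 1, 0 => X 1 0
  | 1, 1 => p • X 0 0 + X 1 1
  | 1, 2 => p • X 0 1 + X 1 2
  | 2, 0 => -(p • X 0 0) + X 2 0
  | 2, 1 => -(p • X 1 0) + X 2 1
  | 2, 2 => (p ^ 2 / 2) • X 0 0 + p • X 0 2 - p • X 1 1 - p • X 2 0 + X 2 2

theorem sum_fundR_smul (p : ℂ) (X : Fin 3 → Fin 3 → A) (i k : Fin 3) :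
    ∑ a, ∑ b, fundR p i a k b • X a b = rowR p X i k := by
  simp only [Fin.sum_univ_three, fundR]
  fin_cases i <;> fin_cases k <;>
    simp only [Matrix.of_apply, Matrix.cons_val, Matrix.cons_val_zero, Matrix.cons_val_one,
      Fin.zero_eta, Fin.mk_one, Fin.reduceFinMk, rowR] <;> module

theorem sum_smul_fundR (p : ℂ) (X : Fin 3 → Fin 3 → A) (j l : Fin 3) :
    ∑ a, ∑ b, fundR p a j b l • X a b = colR p X j l := by
  simp only [Fin.sum_univ_three, fundR]
  fin_cases j <;> fin_cases l <;>
    simp only [Matrix.of_apply, Matrix.cons_val, Matrix.cons_val_zero, Matrix.cons_val_one,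
      Fin.zero_eta, Fin.mk_one, Fin.reduceFinMk, colR] <;> module

theorem RLL_iff (p : ℂ) (L : Matrix (Fin 3) (Fin 3) A) : RLL p L ↔ ∀ i k j l : Fin 3,
    rowR p (fun a b => (-1) ^ (par b * (par a + par j)) * (L a j * L b l)) i k
      = colR p (fun a b => (-1) ^ (par b * (par i + par a)) * (L k b * L i a)) j l := by
  have hl : ∀ i k j l, ((contR 1 p).map (algebraMap ℂ A) * (gKron L 1 * gKron 1 L)) (i, k) (j, l)
      = rowR p (fun a b => (-1) ^ (par b * (par a + par j)) * (L a j * L b l)) i k := by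
    intro i k j l
    rw [← sum_fundR_smul, Matrix.mul_apply, Fintype.sum_prod_type]
    refine Finset.sum_congr rfl fun a _ => Finset.sum_congr rfl fun b _ => ?_
    rw [gKron_mul_gKron, Algebra.smul_def, Matrix.map_apply, contR_one_apply]
  have hr : ∀ i k j l, ((gKron 1 L * gKron L 1) * (contR 1 p).map (algebraMap ℂ A)) (i, k) (j, l)
      = colR p (fun a b => (-1) ^ (par b * (par i + par a)) * (L k b * L i a)) j l := by
    intro i k j l
    rw [← sum_smul_fundR, Matrix.mul_apply, Fintype.sum_prod_type]
    refine Finset.sum_congr rfl fun a _ => Finset.sum_congr rfl fun b _ => ?_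
    rw [gKron_mul_gKron', Algebra.smul_def, Matrix.map_apply, contR_one_apply, Algebra.commutes]
  constructor
  · intro h i k j l
    have := congrFun (congrFun h (i, k)) (j, l)
    rwa [mul_assoc, hl, hr] at this
  · intro h
    ext ⟨i, k⟩ ⟨j, l⟩
    rw [mul_assoc, hl, hr]
    exact h i k j l

/-- The hypotheses are oriented as rewriting rules that bring both sides of each of the 81 entries
to a common order. -/
theorem RLL_of_relations {p : ℂ} {T B C D t : A} (h1 : B * T = T * B) (h2 : B * t = t * B)
    (h3 : D * T = T * D) (h4 : D * t = t * D) (h5 : T * t = 1) (h6 : t * T = 1)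
    (h7 : C * T = T * C - p • (T * T) + p • 1) (h8 : C * t = t * C + p • 1 - p • (t * t))
    (h9 : B * B = (p / 2) • (T * T - 1)) (h10 : D * D = (p / 2) • (1 - t * t))
    (h11 : D * B = -((p / 2) • (T - t))) (h12 : B * D = -((p / 2) • (T - t)))
    (h13 : B * C = C * B + p • (T * B) - p • (t * B) - p • D)
    (h14 : C * D = D * C + p • B + p • (T * D) - p • (t * D)) :
    RLL p !![T, B, C; 0, 1, D; 0, 0, t] := by
  rw [RLL_iff]
  obtain ⟨L, hL⟩ : ∃ L : Matrix (Fin 3) (Fin 3) A, L = !![T, B, C; 0, 1, D; 0, 0, t] := ⟨_, rfl⟩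
  have l00 : L 0 0 = T := by rw [hL]; rfl
  have l01 : L 0 1 = B := by rw [hL]; rfl
  have l02 : L 0 2 = C := by rw [hL]; rfl
  have l10 : L 1 0 = 0 := by rw [hL]; rfl
  have l11 : L 1 1 = 1 := by rw [hL]; rfl
  have l12 : L 1 2 = D := by rw [hL]; rfl
  have l20 : L 2 0 = 0 := by rw [hL]; rfl
  have l21 : L 2 1 = 0 := by rw [hL]; rfl
  have l22 : L 2 2 = t := by rw [hL]; rfl
  rw [← hL]
  clear hL
  intro i k j l
  fin_cases i <;> fin_cases k <;> fin_cases j <;> fin_cases l <;>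
    simp only [Fin.zero_eta, Fin.mk_one, Fin.reduceFinMk, rowR, colR, par_zero, par_one, par_two,
      l00, l01, l02, l10, l11, l12, l20, l21, l22, zero_add, add_zero, mul_zero, zero_mul, mul_one,
      one_mul, pow_zero, pow_one, Nat.reduceAdd, even_two, Even.neg_pow, one_pow, smul_zero,
      sub_zero, neg_zero, neg_mul, h1, h2, h3, h4, h5, h6, h7, h8, h9, h10, h11, h12, h13, h14] <;>
    module

/-- Row `(0, 0)` and four of its columns carry all the information needed for the converse. -/
theorem relations_of_RLL {p : ℂ} {T B C D t : A} (h : RLL p !![T, B, C; 0, 1, D; 0, 0, t]) :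
    T * B = B * T ∧ T * C = C * T + p • (T * T - T * t) ∧ p • 1 + (2 : ℂ) • (B * B) = p • (T * T) ∧
      B * C = C * B + p • (B * T - B * t - D) := by
  rw [RLL_iff] at h
  have e1 := h 0 0 0 1
  have e2 := h 0 0 0 2
  have e3 := h 0 0 1 1
  have e4 := h 0 0 1 2
  simp [rowR, colR, par] at e1 e2 e3 e4
  refine ⟨e1, ?_, ?_, ?_⟩
  · linear_combination (norm := module) e2
  · linear_combination (norm := module) e3
  · linear_combination (norm := module) e4

/-- The relations of the Borel algebra as rules that order words in the generators. -/
theorem IsBorel.rewriting {p : ℂ} {H E K Ki : A} (h : IsBorel p H E K Ki) :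
    (∀ x, K * (Ki * x) = x) ∧ (∀ x, Ki * (K * x) = x) ∧ E * K = K * E ∧ E * Ki = Ki * E ∧
    (∀ x, E * (K * x) = K * (E * x)) ∧ (∀ x, E * (Ki * x) = Ki * (E * x)) ∧
    E * E = (2 * p)⁻¹ • (K * K) - (2 * p)⁻¹ • (Ki * Ki) ∧
    H * K = K * H + (1 / 2 : ℂ) • (K * (K * K)) - (1 / 2 : ℂ) • Ki ∧
    (∀ x, H * (K * x) = K * (H * x) + (1 / 2 : ℂ) • (K * (K * (K * x))) - (1 / 2 : ℂ) • (Ki * x)) ∧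
    H * Ki = Ki * H - (1 / 2 : ℂ) • K + (1 / 2 : ℂ) • (Ki * (Ki * Ki)) ∧
    (∀ x, H * (Ki * x)
      = Ki * (H * x) - (1 / 2 : ℂ) • (K * x) + (1 / 2 : ℂ) • (Ki * (Ki * (Ki * x)))) ∧
    H * E = E * H + (1 / 2 : ℂ) • (K * (K * E)) + (1 / 2 : ℂ) • (Ki * (Ki * E)) := by
  have hKiE : Ki * E = E * Ki := by
    have := inverse_commutator (a := E) (c := 0) (by rw [h.KE, sub_self]) h.KKi h.KiK
    rw [mul_zero, zero_mul, neg_zero, sub_eq_zero] at this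
    exact this.symm
  obtain ⟨HE, HT, HTi, EE, KKi, KiK, KE, HK⟩ := h
  have HKi := inverse_commutator HK KKi KiK
  have k1 : ∀ x, K * (Ki * x) = x := fun x => by rw [← mul_assoc, KKi, one_mul]
  have k2 : ∀ x, Ki * (K * x) = x := fun x => by rw [← mul_assoc, KiK, one_mul]
  have c1 : H * K = K * H + (1 / 2 : ℂ) • (K * (K * K)) - (1 / 2 : ℂ) • Ki := by
    rw [sub_eq_iff_eq_add.1 HK, pow_succ', pow_two, smul_sub]; abel
  have c3 : H * Ki = Ki * H - (1 / 2 : ℂ) • K + (1 / 2 : ℂ) • (Ki * (Ki * Ki)) := by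
    rw [sub_eq_iff_eq_add.1 HKi]
    simp only [mul_sub, sub_mul, mul_smul_comm, smul_mul_assoc, pow_succ, pow_zero, one_mul,
      mul_assoc, k1, k2, KKi, KiK, mul_one]
    module
  refine ⟨k1, k2, KE.symm, hKiE.symm, fun x => by rw [← mul_assoc, ← KE, mul_assoc],
    fun x => by rw [← mul_assoc, ← hKiE, mul_assoc], ?_, c1, fun x => ?_, c3, fun x => ?_, ?_⟩
  · rw [← pow_two, EE, smul_sub, pow_two, pow_two]
  · rw [← mul_assoc, c1]
    simp only [add_mul, sub_mul, smul_mul_assoc, mul_assoc]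
  · rw [← mul_assoc, c3]
    simp only [add_mul, sub_mul, smul_mul_assoc, mul_assoc]
  · rw [sub_eq_iff_eq_add.1 HE, add_mul, pow_two, pow_two, smul_add, mul_assoc, mul_assoc]; abel

theorem RLL_Lmat_of_isBorel {p : ℂ} (hp : p ≠ 0) {H E K Ki : A} (h : IsBorel p H E K Ki) :
    RLL p (Lmat p H E K Ki) := by
  obtain ⟨k1, k2, k3, k4, k5, k6, k7, c1, c2, c3, c4, c5⟩ := h.rewriting
  have KKi := h.KKi
  have KiK := h.KiK
  rw [Lmat]
  apply RLL_of_relations <;>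
    simp only [mul_add, add_mul, mul_sub, sub_mul, mul_smul_comm, smul_mul_assoc, mul_neg, neg_mul,
      pow_succ, pow_zero, one_mul, mul_one, mul_assoc, smul_add, smul_sub, smul_neg, smul_smul,
      k1, k2, k3, k4, k5, k6, k7, KKi, KiK, c1, c2, c3, c4, c5]
  all_goals first | done | module | (match_scalars <;> field_simp)

/-- The defect `z` of the claim anticommutes with `K` by the relation for `[H, K²]`. So it commutes
with `K²`, hence with `K` by hypothesis; then `2zK = 0`, and `K` is a unit. -/
theorem commutator_H_K_of_relations {H K Ki : A} (h1 : K * Ki = 1)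
    (h2 : Ki * K = 1) (hc : ∀ x, Commute x (K ^ 2) → Commute x K)
    (HT : H * K ^ 2 - K ^ 2 * H = (K ^ 2) ^ 2 - 1) :
    H * K - K * H = (1 / 2 : ℂ) • (K ^ 3 - Ki) := by
  obtain ⟨z, hz⟩ : ∃ z, z = H * K - K * H - (1 / 2 : ℂ) • (K ^ 3 - Ki) := ⟨_, rfl⟩
  have hanti : z * K + K * z = 0 := by
    rw [hz]
    linear_combination (norm := skip) HT + (1 / 2 : ℂ) • h1 + (1 / 2 : ℂ) • h2
    simp only [mul_add, add_mul, mul_sub, sub_mul, smul_mul_assoc, mul_smul_comm, mul_assoc,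
      pow_succ, pow_zero, one_mul]
    module
  have hcomm : Commute z (K ^ 2) := by
    change z * K ^ 2 = K ^ 2 * z
    linear_combination (norm := noncomm_ring) hanti * K - K * hanti
  have hzK := (hc z hcomm).eq
  have h2z : (2 : ℂ) • (z * K) = 0 := by
    rw [← hzK] at hanti
    rw [two_smul, hanti]
  have hz0 : z = 0 := by
    rw [← mul_one z, ← h1, ← mul_assoc, (smul_eq_zero.1 h2z).resolve_left two_ne_zero, zero_mul]
  rw [hz, sub_eq_zero] at hz0
  exact hz0

theorem isBorel_of_relations {p : ℂ} {H E K Ki : A} (h1 : K * Ki = 1) (h2 : Ki * K = 1)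
    (hc : ∀ x, Commute x (K ^ 2) → Commute x K)
    (HE : H * E - E * H = (1 / 2 : ℂ) • ((K ^ 2 + Ki ^ 2) * E))
    (HT : H * K ^ 2 - K ^ 2 * H = (K ^ 2) ^ 2 - 1) (EE : E ^ 2 = (2 * p)⁻¹ • (K ^ 2 - Ki ^ 2))
    (TE : Commute (K ^ 2) E) : IsBorel p H E K Ki := by
  exact IsBorel.of HE EE h1 h2 (hc E TE.symm).eq.symm (commutator_H_K_of_relations h1 h2 hc HT)

theorem relations_of_RLL_Lmat {p : ℂ} (hp : p ≠ 0) {H E K Ki : A} (h1 : K * Ki = 1)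
    (h2 : Ki * K = 1) (hc : ∀ x, Commute x (K ^ 2) → Commute x K) (h : RLL p (Lmat p H E K Ki)) :
    IsBorel p H E K Ki := by
  obtain ⟨e1, e2, e3, e4⟩ := relations_of_RLL h
  have k1 : ∀ x, K * (Ki * x) = x := fun x => by rw [← mul_assoc, h1, one_mul]
  have k2 : ∀ x, Ki * (K * x) = x := fun x => by rw [← mul_assoc, h2, one_mul]
  have TE : Commute (K ^ 2) E := by
    have h3 : K ^ 2 * (K * E) = K * E * K ^ 2 := by
      rw [mul_smul_comm, smul_mul_assoc] at e1
      exact smul_right_injective A hp e1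
    change K ^ 2 * E = E * K ^ 2
    rw [← k2 (K ^ 2 * E), ← k2 (E * K ^ 2), ← mul_assoc K E, ← h3, ← mul_assoc K, ← mul_assoc (K ^ 2),
      ← pow_succ, ← pow_succ']
  have KE : K * E = E * K := (hc E TE.symm).eq.symm
  have KiE : Ki * E = E * Ki := by
    have := inverse_commutator (a := E) (c := 0) (by rw [KE, sub_self]) h1 h2
    rw [mul_zero, zero_mul, neg_zero, sub_eq_zero] at this
    exact this.symm
  have TTi : K ^ 2 * Ki ^ 2 = 1 := pow_two_mul_pow_two h1
  have TiT : Ki ^ 2 * K ^ 2 = 1 := pow_two_mul_pow_two h2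
  have HT : H * K ^ 2 - K ^ 2 * H = (K ^ 2) ^ 2 - 1 := by
    apply smul_right_injective A hp
    simp only
    linear_combination (norm := skip) e2 - (3 * p / 4) • TTi - (p / 4) • TiT
    simp only [mul_add, add_mul, mul_sub, sub_mul, smul_mul_assoc, mul_smul_comm, mul_neg, neg_mul,
      pow_two (K ^ 2)]
    module
  have EE : E ^ 2 = (2 * p)⁻¹ • (K ^ 2 - Ki ^ 2) := by
    have h3 : (2 * p ^ 2) • (K ^ 2 * E ^ 2) = p • ((K ^ 2) ^ 2 - 1) := by
      linear_combination (norm := skip) e3 + (2 * p ^ 2) • (K * KE * E)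
      simp only [mul_add, add_mul, mul_sub, sub_mul, smul_mul_assoc, mul_smul_comm, mul_assoc,
        pow_succ, pow_zero, one_mul]
      module
    have h4 : (2 * p) • E ^ 2 = K ^ 2 - Ki ^ 2 := by
      apply smul_right_injective A hp
      have h5 : Ki ^ 2 * ((2 * p ^ 2) • (K ^ 2 * E ^ 2)) = (2 * p ^ 2) • E ^ 2 := by
        rw [mul_smul_comm, ← mul_assoc, TiT, one_mul]
      have h6 : Ki ^ 2 * (p • ((K ^ 2) ^ 2 - 1)) = p • (K ^ 2 - Ki ^ 2) := by
        rw [mul_smul_comm, mul_sub, mul_one, pow_two (K ^ 2), ← mul_assoc, TiT, one_mul]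
      simp only
      rw [← h6, ← h3, h5, smul_smul]
      congr 1
      ring
    rw [← h4, smul_smul, inv_mul_cancel₀ (mul_ne_zero two_ne_zero hp), one_smul]
  refine isBorel_of_relations h1 h2 hc ?_ HT EE TE
  have HK := commutator_H_K_of_relations h1 h2 hc HT
  -- The entry `e4` concerns `pKE` instead of `E`, so `[H, K]` is subtracted and the unit `K` is
  -- cancelled afterwards.
  have h3 : K * (H * E - E * H) = K * ((1 / 2 : ℂ) • ((K ^ 2 + Ki ^ 2) * E)) := by
    apply smul_right_injective A (pow_ne_zero 2 hp)
    have k3 : ∀ x, E * (K * x) = K * (E * x) := fun x => by rw [← mul_assoc, ← KE, mul_assoc]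
    have k4 : ∀ x, E * (Ki * x) = Ki * (E * x) := fun x => by rw [← mul_assoc, ← KiE, mul_assoc]
    simp only
    linear_combination (norm := skip) e4 - p ^ 2 • (HK * E)
    simp only [mul_add, add_mul, mul_sub, sub_mul, smul_mul_assoc, mul_smul_comm, mul_assoc,
      mul_neg, neg_mul, pow_succ, pow_zero, one_mul, k1, k2, k3, k4, ← KE, ← KiE]
    module
  rw [← k2 (H * E - E * H), h3, k2]

theorem exists_hom_iff_isBorel {p : ℂ} {H E K Ki : A} : (∃ φ : Borel p →ₐ[ℂ] A,
    φ (Borel.H p) = H ∧ φ (Borel.E p) = E ∧ φ (Borel.K p) = K ∧ φ (Borel.Ki p) = Ki) ↔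
      IsBorel p H E K Ki := by
  constructor
  · rintro ⟨φ, rfl, rfl, rfl, rfl⟩
    exact (Borel.isBorel p).map φ
  · intro h
    exact ⟨Borel.lift h, Borel.lift_H h, Borel.lift_E h, Borel.lift_K h, Borel.lift_Ki h⟩

theorem RLL_Lmat_iff_isBorel {p : ℂ} (hp : p ≠ 0) {H E K Ki : A} (h1 : K * Ki = 1)
    (h2 : Ki * K = 1) (hc : ∀ x, Commute x (K ^ 2) → Commute x K) :
    RLL p (Lmat p H E K Ki) ↔ IsBorel p H E K Ki :=
  ⟨relations_of_RLL_Lmat hp h1 h2 hc, RLL_Lmat_of_isBorel hp⟩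

theorem RLL_Lmat_iff_relations {p : ℂ} (hp : p ≠ 0) {H E K Ki : A} (h1 : K * Ki = 1)
    (h2 : Ki * K = 1) (hc : ∀ x, Commute x (K ^ 2) → Commute x K) :
    RLL p (Lmat p H E K Ki) ↔ H * E - E * H = (1 / 2 : ℂ) • ((K ^ 2 + Ki ^ 2) * E) ∧
      H * K ^ 2 - K ^ 2 * H = (K ^ 2) ^ 2 - 1 ∧ H * Ki ^ 2 - Ki ^ 2 * H = (Ki ^ 2) ^ 2 - 1 ∧
      E ^ 2 = (2 * p)⁻¹ • (K ^ 2 - Ki ^ 2) ∧ Commute (K ^ 2) E := by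
  rw [RLL_Lmat_iff_isBorel hp h1 h2 hc]
  constructor
  · intro h
    exact ⟨h.HE, h.HT, h.HTi, h.EE, (show Commute K E from h.KE).pow_left 2⟩
  · rintro ⟨HE, HT, -, EE, TE⟩
    exact isBorel_of_relations h1 h2 hc HE HT EE TE

theorem Lmat_mul_LmatInv {p : ℂ} (hp : p ≠ 0) {H E K Ki : A} (h : IsBorel p H E K Ki) :
    Lmat p H E K Ki * LmatInv p H E K Ki = 1 := by
  obtain ⟨k1, k2, k3, k4, k5, k6, k7, c1, c2, c3, c4, c5⟩ := h.rewriting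
  have KKi := h.KKi
  have KiK := h.KiK
  ext i j
  rw [Matrix.mul_apply, Fin.sum_univ_three, Lmat, LmatInv, Matrix.one_fin_three]
  fin_cases i <;> fin_cases j <;>
    simp only [Matrix.of_apply, Matrix.cons_val, Matrix.cons_val_zero, Matrix.cons_val_one,
      Fin.zero_eta, Fin.mk_one, Fin.reduceFinMk, mul_zero, zero_mul, add_zero,
      zero_add, mul_add, add_mul, mul_sub, sub_mul, mul_smul_comm, smul_mul_assoc, mul_neg, neg_mul,
      pow_succ, pow_zero, one_mul, mul_one, mul_assoc, smul_add, smul_sub, smul_neg, smul_smul,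
      k1, k2, k3, k4, k5, k6, k7, KKi, KiK, c1, c2, c3, c4, c5]
  all_goals first | done | module | (match_scalars <;> field_simp <;> try ring)

theorem LmatInv_mul_Lmat {p : ℂ} (hp : p ≠ 0) {H E K Ki : A} (h : IsBorel p H E K Ki) :
    LmatInv p H E K Ki * Lmat p H E K Ki = 1 := by
  obtain ⟨k1, k2, k3, k4, k5, k6, k7, c1, c2, c3, c4, c5⟩ := h.rewriting
  have KKi := h.KKi
  have KiK := h.KiK
  ext i j
  rw [Matrix.mul_apply, Fin.sum_univ_three, Lmat, LmatInv, Matrix.one_fin_three]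
  fin_cases i <;> fin_cases j <;>
    simp only [Matrix.of_apply, Matrix.cons_val, Matrix.cons_val_zero, Matrix.cons_val_one,
      Fin.zero_eta, Fin.mk_one, Fin.reduceFinMk, mul_zero, zero_mul, add_zero,
      zero_add, mul_add, add_mul, mul_sub, sub_mul, mul_smul_comm, smul_mul_assoc, mul_neg, neg_mul,
      pow_succ, pow_zero, one_mul, mul_one, mul_assoc, smul_add, smul_sub, smul_neg, smul_smul,
      k1, k2, k3, k4, k5, k6, k7, KKi, KiK, c1, c2, c3, c4, c5]
  all_goals first | done | module | (match_scalars <;> field_simp <;> try ring)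

end RLLRelations

/-! ### The coproduct as a homomorphism into the graded tensor product -/

section Comul

namespace Borel

variable {p : ℂ}

theorem parity_H : parity p (H p) = H p := parity_gen p .H

theorem parity_E : parity p (E p) = -E p := parity_gen p .E

theorem parity_K : parity p (K p) = K p := parity_gen p .K

theorem parity_Ki : parity p (Ki p) = Ki p := parity_gen p .Ki

theorem mem_grading_zero {x : Borel p} : x ∈ grading p 0 ↔ parity p x = x := by
  rw [mem_grading, ZMod.val_zero, pow_zero, one_smul]

theorem mem_grading_one {x : Borel p} : x ∈ grading p 1 ↔ parity p x = -x := by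
  rw [mem_grading, ZMod.val_one, pow_one, neg_one_smul]

theorem tmul_mul_tmul_of_even {b : Borel p} (hb : parity p b = b) (a c d : Borel p) :
    (a ᵍ⊗ₜ[ℂ] b : grading p ᵍ⊗[ℂ] grading p) * c ᵍ⊗ₜ[ℂ] d = (a * c) ᵍ⊗ₜ[ℂ] (b * d) := by
  induction c using DirectSum.Decomposition.inductionOn (grading p) with
  | zero => simp only [GradedTensorProduct.tmul, TensorProduct.zero_tmul, map_zero, mul_zero]
  | homogeneous c =>
    exact GradedTensorProduct.tmul_zero_coe_mul_coe_tmul _ _ a ⟨b, mem_grading_zero.2 hb⟩ c d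
  | add c c' h h' =>
    simp only [GradedTensorProduct.tmul, TensorProduct.add_tmul, map_add, mul_add] at h h' ⊢
    rw [h, h']

/-- The Koszul sign for passing the odd `b` through `c` is the parity automorphism applied to `c`.
In this form no homogeneity of `c` is required. -/
theorem tmul_mul_tmul_of_odd {b : Borel p} (hb : parity p b = -b) (a c d : Borel p) :
    (a ᵍ⊗ₜ[ℂ] b : grading p ᵍ⊗[ℂ] grading p) * c ᵍ⊗ₜ[ℂ] d
      = (a * parity p c) ᵍ⊗ₜ[ℂ] (b * d) := by
  induction c using DirectSum.Decomposition.inductionOn (grading p) with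
  | zero =>
    simp only [GradedTensorProduct.tmul, TensorProduct.zero_tmul, map_zero, mul_zero]
  | @homogeneous i c =>
    have e := GradedTensorProduct.tmul_coe_mul_coe_tmul (R := ℂ) _ _ a
      (⟨b, mem_grading_one.2 hb⟩ : grading p 1) c d
    rw [e]
    have hc := mem_grading.1 c.2
    have h2 : ∀ i : ZMod 2, i = 0 ∨ i = 1 := by decide
    rcases h2 i with rfl | rfl
    · rw [ZMod.val_zero, pow_zero, one_smul] at hc
      rw [hc, mul_zero, uzpow_zero, one_smul]
    · rw [ZMod.val_one, pow_one, neg_one_smul] at hc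
      rw [hc, mul_one, uzpow_one, Units.neg_smul, one_smul, mul_neg]
      simp only [GradedTensorProduct.tmul, TensorProduct.neg_tmul, map_neg]
  | add c c' h h' =>
    simp only [GradedTensorProduct.tmul, TensorProduct.add_tmul, map_add, mul_add] at h h' ⊢
    rw [h, h']

/-- The formulas are `Δ(L) = L ⊗̇ L` solved for the generators: the entry `(0, 1)` gives `Δ(E)`
after cancelling `K ⊗ K`, and the corner gives `Δ(H)`. -/
theorem isBorel_comul (hp : p ≠ 0) :
    IsBorel p (A := grading p ᵍ⊗[ℂ] grading p)
      (H p ᵍ⊗ₜ[ℂ] Ti p + T p ᵍ⊗ₜ[ℂ] H p + p • ((E p * K p) ᵍ⊗ₜ[ℂ] (E p * Ki p)))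
      (E p ᵍ⊗ₜ[ℂ] Ki p + K p ᵍ⊗ₜ[ℂ] E p) (K p ᵍ⊗ₜ[ℂ] K p) (Ki p ᵍ⊗ₜ[ℂ] Ki p) := by
  obtain ⟨k1, k2, k3, k4, k5, k6, k7, c1, c2, c3, c4, c5⟩ := (isBorel p).rewriting
  have KKi := (isBorel p).KKi
  have KiK := (isBorel p).KiK
  have one_def : (1 : grading p ᵍ⊗[ℂ] grading p) = 1 ᵍ⊗ₜ[ℂ] 1 := rfl
  have mK := tmul_mul_tmul_of_even (parity_K (p := p))
  have mKi := tmul_mul_tmul_of_even (parity_Ki (p := p))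
  have mH := tmul_mul_tmul_of_even (parity_H (p := p))
  have mE := tmul_mul_tmul_of_odd (parity_E (p := p))
  have mT := tmul_mul_tmul_of_even (p := p) (b := Ki p * Ki p) (by rw [map_mul, parity_Ki])
  have mKK := tmul_mul_tmul_of_even (p := p) (b := K p * K p) (by rw [map_mul, parity_K])
  have mEK := tmul_mul_tmul_of_odd (p := p) (b := E p * Ki p)
    (by rw [map_mul, parity_Ki, parity_E, neg_mul])
  apply IsBorel.of <;>
  simp only [T, Ti, pow_succ, pow_zero, one_mul, mul_add, add_mul, smul_mul_assoc, mul_smul_comm,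
    mul_assoc, mK, mKi, mH, mE, mT, mKK, mEK] <;>
  simp only [one_def, parity_H, parity_E, parity_K, parity_Ki, map_mul, map_add, map_neg,
    mul_add, add_mul, mul_sub, sub_mul,
    mul_smul_comm, smul_mul_assoc, mul_neg, neg_mul, pow_succ, pow_zero, one_mul, mul_one,
    mul_assoc, smul_add, smul_sub, smul_neg, smul_smul, k1, k2, k3, k4, k5, k6, k7, KKi, KiK, c1,
    c2, c3, c4, c5, GradedTensorProduct.tmul, TensorProduct.add_tmul, TensorProduct.tmul_add,
    TensorProduct.sub_tmul, TensorProduct.tmul_sub, TensorProduct.neg_tmul, TensorProduct.tmul_neg,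
    TensorProduct.tmul_smul, ← TensorProduct.smul_tmul', map_smul, map_sub] <;>
  first
  | done
  | module
  | (match_scalars <;> field_simp <;> try ring)

end Borel

end Comul

/-! ### Coassociativity, by induction along left multiplication -/

section Coassoc

namespace Borel

variable {p : ℂ}

/-- The coproduct of the Borel algebra. -/
def comul (hp : p ≠ 0) : Borel p →ₐ[ℂ] grading p ᵍ⊗[ℂ] grading p := lift (isBorel_comul hp)

theorem comul_H (hp : p ≠ 0) : comul hp (H p) = H p ᵍ⊗ₜ[ℂ] Ti p + T p ᵍ⊗ₜ[ℂ] H p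
    + p • ((E p * K p) ᵍ⊗ₜ[ℂ] (E p * Ki p)) := lift_H _

theorem comul_E (hp : p ≠ 0) : comul hp (E p) = E p ᵍ⊗ₜ[ℂ] Ki p + K p ᵍ⊗ₜ[ℂ] E p := lift_E _

theorem comul_K (hp : p ≠ 0) : comul hp (K p) = K p ᵍ⊗ₜ[ℂ] K p := lift_K _

theorem comul_Ki (hp : p ≠ 0) : comul hp (Ki p) = Ki p ᵍ⊗ₜ[ℂ] Ki p := lift_Ki _

/-- The coproduct, as a linear map into the ungraded tensor product. -/
def comulLin (hp : p ≠ 0) : Borel p →ₗ[ℂ] Borel p ⊗[ℂ] Borel p :=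
  (GradedTensorProduct.of ℂ (grading p) (grading p)).symm.toLinearMap ∘ₗ (comul hp).toLinearMap

theorem comulLin_one (hp : p ≠ 0) : comulLin hp 1 = 1 ⊗ₜ[ℂ] 1 := by
  simp only [comulLin, LinearMap.comp_apply, AlgHom.toLinearMap_apply, map_one]
  rfl

/-- Left multiplication by `a ⊗ b` in the graded tensor product, for even `b`. -/
def leftMulEven (a b : Borel p) : Module.End ℂ (Borel p ⊗[ℂ] Borel p) :=
  TensorProduct.map (LinearMap.mulLeft ℂ a) (LinearMap.mulLeft ℂ b)

/-- Left multiplication by `a ⊗ b` in the graded tensor product, for odd `b`. -/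
def leftMulOdd (a b : Borel p) : Module.End ℂ (Borel p ⊗[ℂ] Borel p) :=
  TensorProduct.map (LinearMap.mulLeft ℂ a ∘ₗ (parity p).toLinearMap) (LinearMap.mulLeft ℂ b)

theorem leftMulEven_tmul (a b c d : Borel p) :
    leftMulEven a b (c ⊗ₜ d) = (a * c) ⊗ₜ (b * d) := rfl

theorem leftMulOdd_tmul (a b c d : Borel p) :
    leftMulOdd a b (c ⊗ₜ d) = (a * parity p c) ⊗ₜ (b * d) := rfl

theorem of_symm_tmul_mul_of_even {b : Borel p} (hb : parity p b = b) (a : Borel p)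
    (z : grading p ᵍ⊗[ℂ] grading p) :
    (GradedTensorProduct.of ℂ (grading p) (grading p)).symm (a ᵍ⊗ₜ[ℂ] b * z)
      = leftMulEven a b ((GradedTensorProduct.of ℂ (grading p) (grading p)).symm z) := by
  obtain ⟨z, rfl⟩ := (GradedTensorProduct.of ℂ (grading p) (grading p)).surjective z
  induction z using TensorProduct.induction_on with
  | zero => simp only [map_zero, mul_zero]
  | tmul c d => exact congrArg _ (tmul_mul_tmul_of_even hb a c d)
  | add x y hx hy => simp only [map_add, mul_add, hx, hy]

theorem of_symm_tmul_mul_of_odd {b : Borel p} (hb : parity p b = -b) (a : Borel p)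
    (z : grading p ᵍ⊗[ℂ] grading p) :
    (GradedTensorProduct.of ℂ (grading p) (grading p)).symm (a ᵍ⊗ₜ[ℂ] b * z)
      = leftMulOdd a b ((GradedTensorProduct.of ℂ (grading p) (grading p)).symm z) := by
  obtain ⟨z, rfl⟩ := (GradedTensorProduct.of ℂ (grading p) (grading p)).surjective z
  induction z using TensorProduct.induction_on with
  | zero => simp only [map_zero, mul_zero]
  | tmul c d => exact congrArg _ (tmul_mul_tmul_of_odd hb a c d)
  | add x y hx hy => simp only [map_add, mul_add, hx, hy]

variable (p) in
/-- Left multiplication by the coproduct of `H`. -/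
def leftMulH : Module.End ℂ (Borel p ⊗[ℂ] Borel p) :=
  leftMulEven (H p) (Ki p * Ki p) + leftMulEven (K p * K p) (H p)
    + p • leftMulOdd (E p * K p) (E p * Ki p)

variable (p) in
/-- Left multiplication by the coproduct of `E`. -/
def leftMulE : Module.End ℂ (Borel p ⊗[ℂ] Borel p) :=
  leftMulEven (E p) (Ki p) + leftMulOdd (K p) (E p)

theorem comulLin_H_mul (hp : p ≠ 0) (y : Borel p) :
    comulLin hp (H p * y) = leftMulH p (comulLin hp y) := by
  simp only [comulLin, LinearMap.comp_apply, AlgHom.toLinearMap_apply, map_mul, comul_H, add_mul,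
    smul_mul_assoc, leftMulH, LinearMap.add_apply, LinearMap.smul_apply, map_add, map_smul,
    LinearEquiv.coe_coe, T, Ti, pow_two]
  rw [of_symm_tmul_mul_of_even (by rw [map_mul, parity_Ki]), of_symm_tmul_mul_of_even parity_H,
    of_symm_tmul_mul_of_odd (by rw [map_mul, parity_Ki, parity_E, neg_mul])]

theorem comulLin_E_mul (hp : p ≠ 0) (y : Borel p) :
    comulLin hp (E p * y) = leftMulE p (comulLin hp y) := by
  simp only [comulLin, LinearMap.comp_apply, AlgHom.toLinearMap_apply, map_mul, comul_E, add_mul,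
    leftMulE, LinearMap.add_apply, map_add, LinearEquiv.coe_coe]
  rw [of_symm_tmul_mul_of_even parity_Ki, of_symm_tmul_mul_of_odd parity_E]

theorem comulLin_K_mul (hp : p ≠ 0) (y : Borel p) :
    comulLin hp (K p * y) = leftMulEven (K p) (K p) (comulLin hp y) := by
  simp only [comulLin, LinearMap.comp_apply, AlgHom.toLinearMap_apply, map_mul, comul_K,
    LinearEquiv.coe_coe]
  rw [of_symm_tmul_mul_of_even parity_K]

theorem comulLin_Ki_mul (hp : p ≠ 0) (y : Borel p) :
    comulLin hp (Ki p * y) = leftMulEven (Ki p) (Ki p) (comulLin hp y) := by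
  simp only [comulLin, LinearMap.comp_apply, AlgHom.toLinearMap_apply, map_mul, comul_Ki,
    LinearEquiv.coe_coe]
  rw [of_symm_tmul_mul_of_even parity_Ki]

/-- Two linear maps on the Borel algebra agree if they agree at `1` and intertwine the left
multiplication by each generator with the same operators. -/
theorem linearMap_ext {M : Type*} [AddCommGroup M] [Module ℂ M] {f g : Borel p →ₗ[ℂ] M}
    (h1 : f 1 = g 1) (hH : ∀ x, f x = g x → f (H p * x) = g (H p * x))
    (hE : ∀ x, f x = g x → f (E p * x) = g (E p * x))
    (hK : ∀ x, f x = g x → f (K p * x) = g (K p * x))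
    (hKi : ∀ x, f x = g x → f (Ki p * x) = g (Ki p * x)) : f = g :=
  LinearMap.ext fun x => mem_of_left_mul (LinearMap.eqLocus f g) h1 hH hE hK hKi x

theorem tensor_ext {M : Type*} [AddCommGroup M] [Module ℂ M]
    {f g : Borel p ⊗[ℂ] Borel p →ₗ[ℂ] M} (h : ∀ c d, f (c ⊗ₜ d) = g (c ⊗ₜ d))
    (z : Borel p ⊗[ℂ] Borel p) : f z = g z :=
  LinearMap.congr_fun (TensorProduct.ext' h) z

/-- The parity automorphism of the tensor square. -/
def parity₂ : Module.End ℂ (Borel p ⊗[ℂ] Borel p) :=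
  TensorProduct.map (parity p).toLinearMap (parity p).toLinearMap

theorem parity₂_tmul (c d : Borel p) :
    parity₂ (c ⊗ₜ d) = parity p c ⊗ₜ[ℂ] parity p d := rfl

/-- Left multiplication by the coproduct of an odd element applies parity to the first leg.
Iterating the coproduct thus requires that it commutes with parity. -/
theorem comulLin_parity (hp : p ≠ 0) (x : Borel p) :
    comulLin hp (parity p x) = parity₂ (comulLin hp x) := by
  have key : comulLin hp ∘ₗ (parity p).toLinearMap = parity₂ ∘ₗ comulLin hp := by
    apply linearMap_ext
    · simp only [LinearMap.comp_apply, AlgHom.toLinearMap_apply, map_one, comulLin_one,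
        parity₂_tmul]
    all_goals
      intro x hx
      simp only [LinearMap.comp_apply, AlgHom.toLinearMap_apply, map_mul, parity_H, parity_E,
        parity_K, parity_Ki, neg_mul, map_neg, comulLin_H_mul, comulLin_E_mul, comulLin_K_mul,
        comulLin_Ki_mul] at hx ⊢
      rw [hx]
    · refine tensor_ext (f := leftMulH p ∘ₗ parity₂) (g := parity₂ ∘ₗ leftMulH p) (fun c d => ?_) _
      simp only [LinearMap.comp_apply, leftMulH, LinearMap.add_apply, LinearMap.smul_apply,
        leftMulEven_tmul, leftMulOdd_tmul, parity₂_tmul, map_add, map_smul, map_mul, parity_H,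
        parity_E, parity_K, parity_Ki, neg_mul, TensorProduct.neg_tmul, TensorProduct.tmul_neg,
        neg_neg]
    · refine tensor_ext (f := -leftMulE p ∘ₗ parity₂) (g := parity₂ ∘ₗ leftMulE p) (fun c d => ?_) _
      simp only [LinearMap.comp_apply, leftMulE, LinearMap.add_apply, LinearMap.neg_apply,
        leftMulEven_tmul, leftMulOdd_tmul, parity₂_tmul, map_add, map_mul,
        parity_E, parity_K, parity_Ki, neg_mul, TensorProduct.neg_tmul, TensorProduct.tmul_neg,
        neg_neg, neg_add]
    · refine tensor_ext (f := leftMulEven (K p) (K p) ∘ₗ parity₂)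
        (g := parity₂ ∘ₗ leftMulEven (K p) (K p)) (fun c d => ?_) _
      simp only [LinearMap.comp_apply, leftMulEven_tmul, parity₂_tmul, map_mul, parity_K]
    · refine tensor_ext (f := leftMulEven (Ki p) (Ki p) ∘ₗ parity₂)
        (g := parity₂ ∘ₗ leftMulEven (Ki p) (Ki p)) (fun c d => ?_) _
      simp only [LinearMap.comp_apply, leftMulEven_tmul, parity₂_tmul, map_mul, parity_Ki]
  exact LinearMap.congr_fun key x

/-- The operators on the triple tensor product by which the iterated coproduct intertwines the left
multiplication by an element with coproduct `a ⊗ b`, where `M` is the left multiplication by the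
coproduct of `b`. -/
def leftMulTriple (f : Module.End ℂ (Borel p)) (M : Module.End ℂ (Borel p ⊗[ℂ] Borel p)) :
    Module.End ℂ (Borel p ⊗[ℂ] (Borel p ⊗[ℂ] Borel p)) :=
  TensorProduct.map f M

theorem leftMulTriple_tmul (f : Module.End ℂ (Borel p))
    (M : Module.End ℂ (Borel p ⊗[ℂ] Borel p)) (c : Borel p) (z : Borel p ⊗[ℂ] Borel p) :
    leftMulTriple f M (c ⊗ₜ z) = f c ⊗ₜ M z := rfl

theorem comulLin_coassoc (hp : p ≠ 0) :
    (TensorProduct.assoc ℂ (Borel p) (Borel p) (Borel p)).toLinearMap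
        ∘ₗ (comulLin hp).rTensor (Borel p) ∘ₗ comulLin hp
      = (comulLin hp).lTensor (Borel p) ∘ₗ comulLin hp := by
  have k1 : ∀ x, K p * (Ki p * x) = x := (isBorel p).rewriting.1
  have k2 : ∀ x, Ki p * (K p * x) = x := (isBorel p).rewriting.2.1
  have k3 : ∀ x, E p * (Ki p * x) = Ki p * (E p * x) := (isBorel p).rewriting.2.2.2.2.2.1
  have k4 : ∀ x, E p * (K p * x) = K p * (E p * x) := (isBorel p).rewriting.2.2.2.2.1
  -- both sides intertwine `ℓ` with `N`
  have step (ℓ : Module.End ℂ (Borel p ⊗[ℂ] Borel p))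
      (N : Module.End ℂ (Borel p ⊗[ℂ] (Borel p ⊗[ℂ] Borel p)))
      (hl : ∀ c d, (TensorProduct.assoc ℂ (Borel p) (Borel p) (Borel p))
          ((comulLin hp).rTensor (Borel p) (ℓ (c ⊗ₜ d)))
        = N ((TensorProduct.assoc ℂ (Borel p) (Borel p) (Borel p))
          ((comulLin hp).rTensor (Borel p) (c ⊗ₜ d))))
      (hr : ∀ c d, (comulLin hp).lTensor (Borel p) (ℓ (c ⊗ₜ d))
        = N ((comulLin hp).lTensor (Borel p) (c ⊗ₜ d)))
      (x : Borel p)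
      (hx : (TensorProduct.assoc ℂ (Borel p) (Borel p) (Borel p))
          ((comulLin hp).rTensor (Borel p) (comulLin hp x))
        = (comulLin hp).lTensor (Borel p) (comulLin hp x)) :
      (TensorProduct.assoc ℂ (Borel p) (Borel p) (Borel p))
          ((comulLin hp).rTensor (Borel p) (ℓ (comulLin hp x)))
        = (comulLin hp).lTensor (Borel p) (ℓ (comulLin hp x)) := by
    have h1 := tensor_ext (f := (TensorProduct.assoc ℂ (Borel p) (Borel p) (Borel p)).toLinearMap
      ∘ₗ (comulLin hp).rTensor (Borel p) ∘ₗ ℓ)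
      (g := N ∘ₗ (TensorProduct.assoc ℂ (Borel p) (Borel p) (Borel p)).toLinearMap
      ∘ₗ (comulLin hp).rTensor (Borel p)) hl (comulLin hp x)
    have h2 := tensor_ext (f := (comulLin hp).lTensor (Borel p) ∘ₗ ℓ)
      (g := N ∘ₗ (comulLin hp).lTensor (Borel p)) hr (comulLin hp x)
    exact h1.trans ((congrArg N hx).trans h2.symm)
  apply linearMap_ext
  · simp only [LinearMap.comp_apply, comulLin_one, LinearMap.rTensor_tmul, LinearMap.lTensor_tmul,
      LinearEquiv.coe_coe, TensorProduct.assoc_tmul]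
  all_goals
    intro x hx
    simp only [LinearMap.comp_apply, comulLin_H_mul, comulLin_E_mul, comulLin_K_mul,
      comulLin_Ki_mul]
  -- The operator is left multiplication by the twofold coproduct of `H`, namely `H ⊗ T⁻¹ ⊗ T⁻¹ + T
  -- ⊗ Δ(H) + p EK ⊗ Δ(E)Δ(K⁻¹)`, with parity on the first leg of the last term.
  · refine step _ (leftMulTriple (LinearMap.mulLeft ℂ (H p)) (leftMulEven (Ki p * Ki p) (Ki p * Ki p))
      + leftMulTriple (LinearMap.mulLeft ℂ (K p * K p)) (leftMulH p)
      + p • leftMulTriple (LinearMap.mulLeft ℂ (E p * K p) ∘ₗ (parity p).toLinearMap)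
        (leftMulE p ∘ₗ leftMulEven (Ki p) (Ki p))) (fun c d => ?_) (fun c d => ?_) x hx
    · simp only [leftMulH, LinearMap.add_apply, LinearMap.smul_apply, leftMulEven_tmul,
        leftMulOdd_tmul, map_add, map_smul, LinearMap.rTensor_tmul, mul_assoc, comulLin_H_mul,
        comulLin_E_mul, comulLin_K_mul, comulLin_parity]
      generalize comulLin hp c = w
      induction w using TensorProduct.induction_on with
      | zero => simp only [map_zero, TensorProduct.zero_tmul, smul_zero, add_zero]
      | tmul a b =>
        simp only [leftMulE, LinearMap.add_apply, LinearMap.smul_apply, leftMulEven_tmul,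
          leftMulOdd_tmul, parity₂_tmul, TensorProduct.add_tmul, ← TensorProduct.smul_tmul',
          map_add, map_smul, TensorProduct.assoc_tmul, leftMulTriple_tmul, LinearMap.comp_apply,
          LinearMap.mulLeft_apply, AlgHom.toLinearMap_apply, TensorProduct.tmul_add,
          TensorProduct.tmul_smul, map_mul, parity_K, parity_Ki, parity_parity, mul_assoc, k1, k2,
          k3, k4]
        module
      | add x y hx hy =>
        simp only [map_add, TensorProduct.add_tmul, LinearMap.add_apply, LinearMap.smul_apply,
          smul_add] at hx hy ⊢
        linear_combination (norm := module) hx + hy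
    · simp only [leftMulH, leftMulE, LinearMap.add_apply, LinearMap.smul_apply, leftMulEven_tmul,
        leftMulOdd_tmul, map_add, map_smul, LinearMap.lTensor_tmul, mul_assoc, comulLin_H_mul,
        comulLin_E_mul, comulLin_Ki_mul, comulLin_parity, leftMulTriple_tmul,
        LinearMap.mulLeft_apply, LinearMap.comp_apply, AlgHom.toLinearMap_apply]
      generalize comulLin hp d = w
      induction w using TensorProduct.induction_on with
      | zero => simp only [map_zero, TensorProduct.tmul_zero, smul_zero, add_zero]
      | tmul a b =>
        simp only [LinearMap.add_apply, LinearMap.smul_apply, leftMulEven_tmul, leftMulOdd_tmul,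
          mul_assoc]
      | add x y hx hy =>
        simp only [map_add, TensorProduct.tmul_add, LinearMap.add_apply, LinearMap.smul_apply,
          smul_add] at hx hy ⊢
        linear_combination (norm := module) hx + hy
  · refine step _ (leftMulTriple (LinearMap.mulLeft ℂ (E p)) (leftMulEven (Ki p) (Ki p))
      + leftMulTriple (LinearMap.mulLeft ℂ (K p) ∘ₗ (parity p).toLinearMap)
        (leftMulE p)) (fun c d => ?_) (fun c d => ?_) x hx
    · simp only [leftMulE, LinearMap.add_apply, leftMulEven_tmul, leftMulOdd_tmul, map_add,
        LinearMap.rTensor_tmul, comulLin_E_mul, comulLin_K_mul, comulLin_parity]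
      generalize comulLin hp c = w
      induction w using TensorProduct.induction_on with
      | zero => simp only [map_zero, TensorProduct.zero_tmul, smul_zero, add_zero]
      | tmul a b =>
        simp only [LinearMap.add_apply, leftMulEven_tmul, leftMulOdd_tmul, parity₂_tmul,
          TensorProduct.add_tmul, map_add, TensorProduct.assoc_tmul, leftMulTriple_tmul,
          LinearMap.comp_apply, LinearMap.mulLeft_apply, AlgHom.toLinearMap_apply,
          TensorProduct.tmul_add]
        module
      | add x y hx hy =>
        simp only [map_add, TensorProduct.add_tmul, LinearMap.add_apply] at hx hy ⊢
        linear_combination (norm := module) hx + hy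
    · simp only [leftMulE, LinearMap.add_apply, leftMulEven_tmul, leftMulOdd_tmul, map_add,
        LinearMap.lTensor_tmul, comulLin_E_mul, comulLin_Ki_mul, comulLin_parity,
        leftMulTriple_tmul, LinearMap.mulLeft_apply, LinearMap.comp_apply, AlgHom.toLinearMap_apply]
  · refine step _ (leftMulTriple (LinearMap.mulLeft ℂ (K p)) (leftMulEven (K p) (K p)))
      (fun c d => ?_) (fun c d => ?_) x hx
    · simp only [leftMulEven_tmul, LinearMap.rTensor_tmul, comulLin_K_mul]
      generalize comulLin hp c = w
      induction w using TensorProduct.induction_on with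
      | zero => simp only [map_zero, TensorProduct.zero_tmul]
      | tmul a b =>
        simp only [leftMulEven_tmul, TensorProduct.assoc_tmul, leftMulTriple_tmul,
          LinearMap.mulLeft_apply]
      | add x y hx hy => simp only [map_add, TensorProduct.add_tmul, hx, hy]
    · simp only [leftMulEven_tmul, LinearMap.lTensor_tmul, comulLin_K_mul, leftMulTriple_tmul,
        LinearMap.mulLeft_apply]
  · refine step _ (leftMulTriple (LinearMap.mulLeft ℂ (Ki p)) (leftMulEven (Ki p) (Ki p)))
      (fun c d => ?_) (fun c d => ?_) x hx
    · simp only [leftMulEven_tmul, LinearMap.rTensor_tmul, comulLin_Ki_mul]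
      generalize comulLin hp c = w
      induction w using TensorProduct.induction_on with
      | zero => simp only [map_zero, TensorProduct.zero_tmul]
      | tmul a b =>
        simp only [leftMulEven_tmul, TensorProduct.assoc_tmul, leftMulTriple_tmul,
          LinearMap.mulLeft_apply]
      | add x y hx hy => simp only [map_add, TensorProduct.add_tmul, hx, hy]
    · simp only [leftMulEven_tmul, LinearMap.lTensor_tmul, comulLin_Ki_mul, leftMulTriple_tmul,
        LinearMap.mulLeft_apply]

end Borel

end Coassoc

/-! ### Counit, evenness of the coproduct, and antipode -/

section Antipode

namespace Borel

variable {p : ℂ}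

theorem isBorel_counit (p : ℂ) : IsBorel p (0 : ℂ) 0 1 1 := by
  apply IsBorel.of <;> simp

variable (p) in
/-- The counit of the Borel algebra. -/
def counit : Borel p →ₐ[ℂ] ℂ := lift (isBorel_counit p)

theorem counit_H : counit p (H p) = 0 := lift_H _

theorem counit_E : counit p (E p) = 0 := lift_E _

theorem counit_K : counit p (K p) = 1 := lift_K _

theorem counit_Ki : counit p (Ki p) = 1 := lift_Ki _

theorem counit_parity (x : Borel p) : counit p (parity p x) = counit p x := by
  have : (counit p).comp (parity p) = counit p := by
    apply hom_ext <;> simp only [AlgHom.comp_apply, parity_H, parity_E, parity_K, parity_Ki,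
      map_neg, counit_E, neg_zero]
  exact DFunLike.congr_fun this x

theorem rTensor_counit_comulLin (hp : p ≠ 0) :
    (counit p).toLinearMap.rTensor (Borel p) ∘ₗ comulLin hp
      = TensorProduct.mk ℂ ℂ (Borel p) 1 := by
  have step (ℓ : Module.End ℂ (Borel p ⊗[ℂ] Borel p)) (g : Borel p)
      (h : ∀ c d, (counit p).toLinearMap.rTensor (Borel p) (ℓ (c ⊗ₜ d))
        = counit p c ⊗ₜ[ℂ] (g * d)) (x : Borel p)
      (hx : (counit p).toLinearMap.rTensor (Borel p) (comulLin hp x) = 1 ⊗ₜ x) :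
      (counit p).toLinearMap.rTensor (Borel p) (ℓ (comulLin hp x)) = 1 ⊗ₜ (g * x) := by
    have h1 := tensor_ext (f := (counit p).toLinearMap.rTensor (Borel p) ∘ₗ ℓ)
      (g := (LinearMap.mulLeft ℂ g).lTensor ℂ ∘ₗ (counit p).toLinearMap.rTensor (Borel p)) h
      (comulLin hp x)
    exact h1.trans (congrArg ((LinearMap.mulLeft ℂ g).lTensor ℂ) hx)
  apply linearMap_ext
  · simp only [LinearMap.comp_apply, comulLin_one, LinearMap.rTensor_tmul,
      AlgHom.toLinearMap_apply, map_one, TensorProduct.mk_apply]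
  all_goals
    intro x hx
    simp only [LinearMap.comp_apply, comulLin_H_mul, comulLin_E_mul, comulLin_K_mul,
      comulLin_Ki_mul]
    refine step _ _ (fun c d => ?_) x hx
    simp only [leftMulH, leftMulE, LinearMap.add_apply, LinearMap.smul_apply, leftMulEven_tmul,
      leftMulOdd_tmul, map_add, map_smul, LinearMap.rTensor_tmul, AlgHom.toLinearMap_apply, map_mul,
      counit_H, counit_E, counit_K, counit_Ki, counit_parity, zero_mul, one_mul,
      TensorProduct.zero_tmul, smul_zero, zero_add, add_zero]

theorem lTensor_counit_comulLin (hp : p ≠ 0) :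
    (counit p).toLinearMap.lTensor (Borel p) ∘ₗ comulLin hp
      = (TensorProduct.mk ℂ (Borel p) ℂ).flip 1 := by
  have step (ℓ : Module.End ℂ (Borel p ⊗[ℂ] Borel p)) (g : Borel p)
      (h : ∀ c d, (counit p).toLinearMap.lTensor (Borel p) (ℓ (c ⊗ₜ d))
        = (g * c) ⊗ₜ[ℂ] counit p d) (x : Borel p)
      (hx : (counit p).toLinearMap.lTensor (Borel p) (comulLin hp x) = x ⊗ₜ 1) :
      (counit p).toLinearMap.lTensor (Borel p) (ℓ (comulLin hp x)) = (g * x) ⊗ₜ 1 := by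
    have h1 := tensor_ext (f := (counit p).toLinearMap.lTensor (Borel p) ∘ₗ ℓ)
      (g := (LinearMap.mulLeft ℂ g).rTensor ℂ ∘ₗ (counit p).toLinearMap.lTensor (Borel p)) h
      (comulLin hp x)
    exact h1.trans (congrArg ((LinearMap.mulLeft ℂ g).rTensor ℂ) hx)
  apply linearMap_ext
  · simp only [LinearMap.comp_apply, comulLin_one, LinearMap.lTensor_tmul,
      AlgHom.toLinearMap_apply, map_one, LinearMap.flip_apply, TensorProduct.mk_apply]
  all_goals
    intro x hx
    simp only [LinearMap.comp_apply, comulLin_H_mul, comulLin_E_mul, comulLin_K_mul,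
      comulLin_Ki_mul]
    refine step _ _ (fun c d => ?_) x hx
    simp only [leftMulH, leftMulE, LinearMap.add_apply, LinearMap.smul_apply, leftMulEven_tmul,
      leftMulOdd_tmul, map_add, map_smul, LinearMap.lTensor_tmul, AlgHom.toLinearMap_apply, map_mul,
      counit_H, counit_E, counit_K, counit_Ki, counit_parity, zero_mul, one_mul,
      TensorProduct.tmul_zero, smul_zero, zero_add, add_zero]

/-- Averaging a tensor with its signed parity image projects onto total degree `i`: components of
the other degree cancel. The coproduct of `x` is fixed by this averaging. -/
theorem comulLin_mem_grading (hp : p ≠ 0) (i : ZMod 2) {x : Borel p} (hx : x ∈ grading p i) :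
    comulLin hp x ∈ ⨆ a : ZMod 2, LinearMap.range
      (TensorProduct.map (grading p a).subtype (grading p (i - a)).subtype) := by
  set N := ⨆ a : ZMod 2, LinearMap.range
      (TensorProduct.map (grading p a).subtype (grading p (i - a)).subtype)
  have hs : (-1 : ℂ) ^ i.val * (-1 : ℂ) ^ i.val = 1 := by rw [← mul_pow]; norm_num
  have key (z : Borel p ⊗[ℂ] Borel p) : z + (-1 : ℂ) ^ i.val • parity₂ z ∈ N := by
    induction z using TensorProduct.induction_on with
    | zero => rw [map_zero, smul_zero, add_zero]; exact zero_mem _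
    | add x y hx hy =>
      rw [map_add, smul_add, add_add_add_comm]
      exact add_mem hx hy
    | tmul c d =>
      induction c using DirectSum.Decomposition.inductionOn (grading p) with
      | zero => rw [TensorProduct.zero_tmul, map_zero, smul_zero, add_zero]; exact zero_mem _
      | add x y hx hy =>
        rw [TensorProduct.add_tmul, map_add, smul_add, add_add_add_comm]
        exact add_mem hx hy
      | @homogeneous a c =>
        induction d using DirectSum.Decomposition.inductionOn (grading p) with
        | zero => rw [TensorProduct.tmul_zero, map_zero, smul_zero, add_zero]; exact zero_mem _
        | add x y hx hy =>
          rw [TensorProduct.tmul_add, map_add, smul_add, add_add_add_comm]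
          exact add_mem hx hy
        | @homogeneous b d =>
          by_cases hb : b = i - a
          · subst hb
            have hm : (c : Borel p) ⊗ₜ[ℂ] (d : Borel p) ∈ N :=
              Submodule.mem_iSup_of_mem a ⟨c ⊗ₜ d, rfl⟩
            rw [parity₂_tmul, mem_grading.1 c.2, mem_grading.1 d.2, TensorProduct.smul_tmul_smul]
            exact add_mem hm (N.smul_mem _ (N.smul_mem _ hm))
          · have h0 : (-1 : ℂ) ^ i.val * ((-1 : ℂ) ^ a.val * (-1 : ℂ) ^ b.val) = -1 := by
              have h2 : ∀ i : ZMod 2, i = 0 ∨ i = 1 := by decide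
              have h01 : (0 : ZMod 2) - 1 = 1 := by decide
              have h11 : (1 : ZMod 2) - 1 = 0 := by decide
              rcases h2 i with rfl | rfl <;> rcases h2 a with rfl | rfl <;>
                rcases h2 b with rfl | rfl <;> simp [ZMod.val_one, h01, h11] at hb ⊢
            rw [parity₂_tmul, mem_grading.1 c.2, mem_grading.1 d.2, TensorProduct.smul_tmul_smul,
              smul_smul, h0, neg_one_smul, add_neg_cancel]
            exact zero_mem _
  have h := key (comulLin hp x)
  rw [← comulLin_parity, mem_grading.1 hx, map_smul, smul_smul, hs, one_smul, ← two_smul ℂ] at h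
  exact (N.smul_mem_iff two_ne_zero).1 h

/-- The images of the generators under the ungraded anti-automorphism from which the antipode is
built. -/
theorem isBorel_op (hp : p ≠ 0) :
    -- The exchange of `K` and `K⁻¹` reverses the sign in the relation for `E²`; the factor `i` in
    -- the image of `E` restores it.
    IsBorel p (MulOpposite.op (-H p - p • E p ^ 2)) (MulOpposite.op (-Complex.I • E p))
      (MulOpposite.op (Ki p)) (MulOpposite.op (K p)) := by
  obtain ⟨k1, k2, k3, k4, k5, k6, k7, c1, c2, c3, c4, c5⟩ := (isBorel p).rewriting
  have KKi := (isBorel p).KKi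
  have KiK := (isBorel p).KiK
  apply IsBorel.of <;> apply MulOpposite.unop_injective <;>
  simp only [MulOpposite.unop_sub, MulOpposite.unop_add, MulOpposite.unop_mul,
    MulOpposite.unop_smul, MulOpposite.unop_one, MulOpposite.unop_op, MulOpposite.unop_pow] <;>
  simp only [mul_add, add_mul, mul_sub, sub_mul,
    mul_smul_comm, smul_mul_assoc, mul_neg, neg_mul, pow_succ, pow_zero, one_mul, mul_one,
    mul_assoc, smul_add, smul_sub, smul_neg, smul_smul, k1, k2, k3, k4, k5, k6, k7, KKi, KiK, c1,
    c2, c3, c4, c5, neg_smul, neg_neg, Complex.I_mul_I] <;>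
  first
  | done
  | module
  | (match_scalars <;> field_simp <;> first | ring1 | simp only [Complex.I_sq, neg_neg])

/-- The ungraded anti-automorphism from which the antipode is built. -/
def antipodeAux (hp : p ≠ 0) : Borel p →ₐ[ℂ] (Borel p)ᵐᵒᵖ := lift (isBorel_op hp)

/-- The antipode of the Borel algebra. -/
def antipode (hp : p ≠ 0) : Borel p →ₗ[ℂ] Borel p :=
  (MulOpposite.opLinearEquiv ℂ).symm.toLinearMap ∘ₗ (antipodeAux hp).toLinearMap
    -- This operator is `1` on even and `-i` on odd elements. As `(-i)² = -1`, it turns an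
    -- antihomomorphism into a graded one, and `E` goes to `(-i)(-i)E = -E`.
    ∘ₗ (((1 - Complex.I) / 2) • LinearMap.id + ((1 + Complex.I) / 2) • (parity p).toLinearMap)

theorem antipode_apply (hp : p ≠ 0) (x : Borel p) : antipode hp x
    = ((1 - Complex.I) / 2) • (antipodeAux hp x).unop
      + ((1 + Complex.I) / 2) • (antipodeAux hp (parity p x)).unop := by
  simp only [antipode, LinearMap.comp_apply, LinearMap.add_apply, LinearMap.smul_apply,
    LinearMap.id_apply, AlgHom.toLinearMap_apply, map_add, map_smul, LinearEquiv.coe_coe]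
  rfl

theorem antipode_one (hp : p ≠ 0) : antipode hp 1 = 1 := by
  simp only [antipode_apply, map_one, MulOpposite.unop_one]
  module

theorem antipode_H_mul (hp : p ≠ 0) (x : Borel p) :
    antipode hp (H p * x) = antipode hp x * (-H p - p • E p ^ 2) := by
  simp only [antipode_apply, map_mul, parity_H, antipodeAux, lift_H, MulOpposite.unop_mul,
    MulOpposite.unop_op, add_mul, smul_mul_assoc]

theorem antipode_K_mul (hp : p ≠ 0) (x : Borel p) :
    antipode hp (K p * x) = antipode hp x * Ki p := by
  simp only [antipode_apply, map_mul, parity_K, antipodeAux, lift_K, MulOpposite.unop_mul,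
    MulOpposite.unop_op, add_mul, smul_mul_assoc]

theorem antipode_Ki_mul (hp : p ≠ 0) (x : Borel p) :
    antipode hp (Ki p * x) = antipode hp x * K p := by
  simp only [antipode_apply, map_mul, parity_Ki, antipodeAux, lift_Ki, MulOpposite.unop_mul,
    MulOpposite.unop_op, add_mul, smul_mul_assoc]

theorem antipode_E_mul (hp : p ≠ 0) (x : Borel p) :
    antipode hp (E p * x) = -(antipode hp (parity p x) * E p) := by
  simp only [antipode_apply, map_mul, map_neg, parity_E, antipodeAux, lift_E, MulOpposite.unop_mul,
    MulOpposite.unop_op, MulOpposite.unop_neg, add_mul, smul_mul_assoc, parity_parity,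
    mul_smul_comm, neg_mul, smul_neg, smul_smul]
  match_scalars <;> ring_nf <;> rw [Complex.I_sq] <;> ring

theorem antipode_H (hp : p ≠ 0) : antipode hp (H p) = -H p - p • E p ^ 2 := by
  have := antipode_H_mul hp 1
  rwa [mul_one, antipode_one, one_mul] at this

theorem antipode_E (hp : p ≠ 0) : antipode hp (E p) = -E p := by
  have := antipode_E_mul hp 1
  rwa [mul_one, map_one, antipode_one, one_mul] at this

theorem antipode_K (hp : p ≠ 0) : antipode hp (K p) = Ki p := by
  have := antipode_K_mul hp 1
  rwa [mul_one, antipode_one, one_mul] at this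

theorem antipode_Ki (hp : p ≠ 0) : antipode hp (Ki p) = K p := by
  have := antipode_Ki_mul hp 1
  rwa [mul_one, antipode_one, one_mul] at this

theorem antipode_parity (hp : p ≠ 0) (x : Borel p) :
    antipode hp (parity p x) = parity p (antipode hp x) := by
  have key : antipode hp ∘ₗ (parity p).toLinearMap
      = (parity p).toLinearMap ∘ₗ antipode hp := by
    apply linearMap_ext
    · simp only [LinearMap.comp_apply, AlgHom.toLinearMap_apply, map_one, antipode_one]
    all_goals
      intro x hx
      simp only [LinearMap.comp_apply, AlgHom.toLinearMap_apply] at hx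
      simp only [LinearMap.comp_apply, AlgHom.toLinearMap_apply, map_mul, map_neg, map_sub,
        map_smul, map_pow, parity_H, parity_E, parity_K, parity_Ki, neg_mul, antipode_H_mul,
        antipode_E_mul, antipode_K_mul, antipode_Ki_mul, hx, parity_parity, neg_sq, mul_neg,
        neg_neg]
  exact LinearMap.congr_fun key x

theorem antipode_mem_grading (hp : p ≠ 0) {i : ZMod 2} {x : Borel p} (hx : x ∈ grading p i) :
    antipode hp x ∈ grading p i := by
  rw [mem_grading] at hx ⊢
  rw [← antipode_parity, hx, map_smul]

theorem antipode_rTensor_comulLin (hp : p ≠ 0) :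
    LinearMap.mul' ℂ (Borel p) ∘ₗ (antipode hp).rTensor (Borel p) ∘ₗ comulLin hp
      = Algebra.linearMap ℂ (Borel p) ∘ₗ (counit p).toLinearMap := by
  obtain ⟨k1, k2, k3, k4, k5, k6, k7, c1, c2, c3, c4, c5⟩ := (isBorel p).rewriting
  have k7' (x) : E p * (E p * x)
      = (2 * p)⁻¹ • (K p * (K p * x)) - (2 * p)⁻¹ • (Ki p * (Ki p * x)) := by
    rw [← mul_assoc, k7]
    simp only [sub_mul, smul_mul_assoc, mul_assoc]
  have KKi := (isBorel p).KKi
  have KiK := (isBorel p).KiK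
  -- The antipode reverses the order, so the two legs of a generator meet between those of `x` and
  -- collapse to the scalar `r`, the counit of the generator.
  have step (ℓ : Module.End ℂ (Borel p ⊗[ℂ] Borel p)) (r : ℂ)
      (h : ∀ c d, LinearMap.mul' ℂ (Borel p) ((antipode hp).rTensor (Borel p) (ℓ (c ⊗ₜ d)))
        = r • (antipode hp c * d)) (x : Borel p)
      (hx : LinearMap.mul' ℂ (Borel p) ((antipode hp).rTensor (Borel p) (comulLin hp x))
        = algebraMap ℂ (Borel p) (counit p x)) :
      LinearMap.mul' ℂ (Borel p) ((antipode hp).rTensor (Borel p) (ℓ (comulLin hp x)))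
        = algebraMap ℂ (Borel p) (r * counit p x) := by
    have h1 := tensor_ext
      (f := LinearMap.mul' ℂ (Borel p) ∘ₗ (antipode hp).rTensor (Borel p) ∘ₗ ℓ)
      (g := r • (LinearMap.mul' ℂ (Borel p) ∘ₗ (antipode hp).rTensor (Borel p))) h
      (comulLin hp x)
    refine h1.trans ((congrArg (r • ·) hx).trans ?_)
    rw [map_mul, Algebra.smul_def]
  apply linearMap_ext
  · simp only [LinearMap.comp_apply, comulLin_one, LinearMap.rTensor_tmul, antipode_one,
      AlgHom.toLinearMap_apply, map_one, LinearMap.mul'_apply, Algebra.linearMap_apply, mul_one]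
  all_goals
    intro x hx
    simp only [LinearMap.comp_apply, comulLin_H_mul, comulLin_E_mul, comulLin_K_mul,
      comulLin_Ki_mul, AlgHom.toLinearMap_apply, map_mul (counit p), Algebra.linearMap_apply]
    refine step _ _ (fun c d => ?_) x hx
    simp only [leftMulH, leftMulE, LinearMap.add_apply, LinearMap.smul_apply, leftMulEven_tmul,
      leftMulOdd_tmul, map_add, map_smul, LinearMap.rTensor_tmul, LinearMap.mul'_apply, mul_assoc,
      antipode_H_mul, antipode_E_mul, antipode_K_mul, antipode_Ki_mul, counit_H, counit_E,
      counit_K, counit_Ki, parity_parity, map_mul, parity_K, mul_sub, sub_mul, mul_neg, neg_mul,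
      smul_mul_assoc, mul_smul_comm, pow_two, k1, k2, k5, k6, k7', c4, mul_add, one_smul,
      zero_smul, smul_sub, smul_add, smul_smul, smul_neg]
    first
    | done
    | module
    | (match_scalars <;> field_simp <;> ring)

theorem antipode_lTensor_comulLin (hp : p ≠ 0) :
    LinearMap.mul' ℂ (Borel p) ∘ₗ (antipode hp).lTensor (Borel p) ∘ₗ comulLin hp
      = Algebra.linearMap ℂ (Borel p) ∘ₗ (counit p).toLinearMap := by
  obtain ⟨k1, k2, k3, k4, k5, k6, k7, c1, c2, c3, c4, c5⟩ := (isBorel p).rewriting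
  have k7' (x) : E p * (E p * x)
      = (2 * p)⁻¹ • (K p * (K p * x)) - (2 * p)⁻¹ • (Ki p * (Ki p * x)) := by
    rw [← mul_assoc, k7]
    simp only [sub_mul, smul_mul_assoc, mul_assoc]
  have KKi := (isBorel p).KKi
  have KiK := (isBorel p).KiK
  -- On this side the two legs of the generator enclose the product for `x`, which is a scalar by
  -- hypothesis. Hence only the value of the enclosing operator `f` at `1` matters.
  have step (ℓ : Module.End ℂ (Borel p ⊗[ℂ] Borel p)) (r : ℂ) (f : Module.End ℂ (Borel p))
      (h : ∀ c d, LinearMap.mul' ℂ (Borel p) ((antipode hp).lTensor (Borel p) (ℓ (c ⊗ₜ d)))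
        = f (c * antipode hp d)) (hf : f 1 = algebraMap ℂ (Borel p) r) (x : Borel p)
      (hx : LinearMap.mul' ℂ (Borel p) ((antipode hp).lTensor (Borel p) (comulLin hp x))
        = algebraMap ℂ (Borel p) (counit p x)) :
      LinearMap.mul' ℂ (Borel p) ((antipode hp).lTensor (Borel p) (ℓ (comulLin hp x)))
        = algebraMap ℂ (Borel p) (r * counit p x) := by
    have h1 := tensor_ext
      (f := LinearMap.mul' ℂ (Borel p) ∘ₗ (antipode hp).lTensor (Borel p) ∘ₗ ℓ)
      (g := f ∘ₗ (LinearMap.mul' ℂ (Borel p) ∘ₗ (antipode hp).lTensor (Borel p))) h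
      (comulLin hp x)
    refine h1.trans ((congrArg f hx).trans ?_)
    rw [mul_comm r, map_mul, Algebra.algebraMap_eq_smul_one (counit p x), map_smul, hf,
      smul_mul_assoc, one_mul]
  apply linearMap_ext
  · simp only [LinearMap.comp_apply, comulLin_one, LinearMap.lTensor_tmul, antipode_one,
      AlgHom.toLinearMap_apply, map_one, LinearMap.mul'_apply, Algebra.linearMap_apply, mul_one]
  all_goals
    intro x hx
    simp only [LinearMap.comp_apply, comulLin_H_mul, comulLin_E_mul, comulLin_K_mul,
      comulLin_Ki_mul, AlgHom.toLinearMap_apply, map_mul (counit p), Algebra.linearMap_apply]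
  · refine step _ _ (LinearMap.mulLeftRight ℂ (H p, K p * K p)
      + LinearMap.mulLeftRight ℂ (K p * K p, -H p - p • (E p * E p))
      - p • LinearMap.mulLeftRight ℂ (E p * K p, K p * E p) ∘ₗ (parity p).toLinearMap)
      (fun c d => ?_) ?_ x hx
    · simp only [leftMulH, leftMulE, LinearMap.add_apply, LinearMap.sub_apply,
        LinearMap.smul_apply, leftMulEven_tmul, leftMulOdd_tmul, map_add, map_smul, LinearMap.lTensor_tmul, LinearMap.mul'_apply,
        mul_assoc, antipode_H_mul, antipode_E_mul, antipode_K_mul, antipode_Ki_mul,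
        antipode_parity, LinearMap.comp_apply, AlgHom.toLinearMap_apply,
        LinearMap.mulLeftRight_apply, map_mul, parity_K, parity_Ki, mul_neg, smul_neg, pow_two]
      module
    · simp only [leftMulH, LinearMap.add_apply, LinearMap.sub_apply, LinearMap.smul_apply,
        LinearMap.comp_apply, AlgHom.toLinearMap_apply, LinearMap.mulLeftRight_apply, map_one,
        mul_one, mul_assoc, mul_sub, mul_neg, mul_smul_comm, counit_H, counit_E, map_zero,
        KKi, KiK, k1, k2, k3, k5, k6, k7, c1, c2, c5, mul_add, smul_sub, smul_add, smul_smul]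
      first
      | done
      | module
      | (match_scalars <;> field_simp <;> ring)
  · refine step _ _ (LinearMap.mulLeftRight ℂ (E p, K p)
      - LinearMap.mulLeftRight ℂ (K p, E p) ∘ₗ (parity p).toLinearMap) (fun c d => ?_) ?_ x hx
    · simp only [leftMulH, leftMulE, LinearMap.add_apply, LinearMap.sub_apply,
        LinearMap.smul_apply, leftMulEven_tmul, leftMulOdd_tmul, map_add, map_smul, LinearMap.lTensor_tmul, LinearMap.mul'_apply,
        mul_assoc, antipode_H_mul, antipode_E_mul, antipode_K_mul, antipode_Ki_mul,
        antipode_parity, LinearMap.comp_apply, AlgHom.toLinearMap_apply,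
        LinearMap.mulLeftRight_apply, map_mul, parity_K, parity_Ki, mul_neg, smul_neg, pow_two]
      module
    · simp only [leftMulH, LinearMap.add_apply, LinearMap.sub_apply, LinearMap.smul_apply,
        LinearMap.comp_apply, AlgHom.toLinearMap_apply, LinearMap.mulLeftRight_apply, map_one,
        mul_one, mul_assoc, mul_sub, mul_neg, mul_smul_comm, counit_H, counit_E, map_zero,
        KKi, KiK, k1, k2, k3, k5, k6, k7, c1, c2, c5, mul_add, smul_sub, smul_add, smul_smul]
      first
      | done
      | module
  · refine step _ _ (LinearMap.mulLeftRight ℂ (K p, Ki p)) (fun c d => ?_) ?_ x hx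
    · simp only [leftMulEven_tmul, LinearMap.lTensor_tmul, LinearMap.mul'_apply, antipode_K_mul,
        LinearMap.mulLeftRight_apply, mul_assoc]
    · simp only [LinearMap.mulLeftRight_apply, mul_one, KKi, counit_K, map_one]
  · refine step _ _ (LinearMap.mulLeftRight ℂ (Ki p, K p)) (fun c d => ?_) ?_ x hx
    · simp only [leftMulEven_tmul, LinearMap.lTensor_tmul, LinearMap.mul'_apply, antipode_Ki_mul,
        LinearMap.mulLeftRight_apply, mul_assoc]
    · simp only [LinearMap.mulLeftRight_apply, mul_one, KiK, counit_Ki, map_one]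

end Borel

end Antipode

/-! ### The FRT conditions and uniqueness of the Hopf structure -/

section Uniqueness

variable {A : Type u} [Ring A] [Algebra ℂ A] {𝒜 : ZMod 2 → Submodule ℂ A} [GradedAlgebra 𝒜]

/-- The underlying coalgebra of a Hopf superalgebra. -/
abbrev HopfSuper.toCoalgebra (S : HopfSuper 𝒜) : Coalgebra ℂ A where
  comul := S.Δ
  counit := S.counit.toLinearMap
  coassoc := S.coassoc
  rTensor_counit_comp_comul := S.counit_left
  lTensor_counit_comp_comul := S.counit_right

/-- The counit is the two-sided unit for the coproduct and the antipode is a two-sided inverse of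
the identity under convolution, so the coproduct determines both. -/
theorem HopfSuper.eq_of_comul_eq {S S' : HopfSuper 𝒜} (h : S'.comul = S.comul) : S' = S := by
  have hΔ : S'.Δ = S.Δ := by rw [S'.Δ_def, S.Δ_def, h]
  have hε : S'.counit = S.counit := by
    apply AlgHom.ext
    intro x
    have h1 := LinearMap.congr_fun S'.counit_left x
    have h2 := LinearMap.congr_fun S.counit_right x
    rw [LinearMap.comp_apply, hΔ] at h1
    -- Both orders of applying the two counits to `Δ x` agree; one gives the counit of `S` at `x`,
    -- the other that of `S'`.
    have e : S.counit.toLinearMap.lTensor ℂ (S'.counit.toLinearMap.rTensor A (S.Δ x))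
        = S'.counit.toLinearMap.rTensor ℂ (S.counit.toLinearMap.lTensor A (S.Δ x)) := by
      rw [← LinearMap.comp_apply, LinearMap.lTensor_comp_rTensor,
        ← LinearMap.comp_apply (LinearMap.rTensor _ _), LinearMap.rTensor_comp_lTensor]
    rw [LinearMap.comp_apply] at h2
    rw [h1, h2, TensorProduct.mk_apply, LinearMap.flip_apply, TensorProduct.mk_apply,
      LinearMap.lTensor_tmul, LinearMap.rTensor_tmul] at e
    have e' := congrArg (TensorProduct.lid ℂ ℂ) e
    simpa using e'.symm
  have hS : S'.antipode = S.antipode := by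
    let := S.toCoalgebra
    -- In the convolution algebra of the common coalgebra, a left inverse of the identity equals a
    -- right inverse.
    have h1 : WithConv.toConv S'.antipode * WithConv.toConv LinearMap.id = 1 := by
      have := S'.antipode_left
      rw [hΔ, hε] at this
      exact congrArg WithConv.toConv this
    have h2 : WithConv.toConv LinearMap.id * WithConv.toConv S.antipode = 1 :=
      congrArg WithConv.toConv S.antipode_right
    exact WithConv.toConv_injective (left_inv_eq_right_inv h1 h2)
  exact HopfSuper.ext h hε hS hΔ

variable {p : ℂ}

/-- A homomorphism from the Borel algebra is determined by the images of `T^{1/2}` and of the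
entries of `L`. -/
theorem Borel.hom_ext_L {B : Type*} [Ring B] [Algebra ℂ B] (hp : p ≠ 0) {φ ψ : Borel p →ₐ[ℂ] B}
    (hK : φ (Borel.K p) = ψ (Borel.K p)) (hL : ∀ i j, φ (Borel.L p i j) = ψ (Borel.L p i j)) :
    φ = ψ := by
  have KKi := (Borel.isBorel p).KKi
  have KiK := (Borel.isBorel p).KiK
  have hKi : φ (Borel.Ki p) = ψ (Borel.Ki p) := by
    have h1 : φ (Borel.Ki p) * φ (Borel.K p) = 1 := by rw [← map_mul, KiK, map_one]
    have h2 : φ (Borel.K p) * ψ (Borel.Ki p) = 1 := by rw [hK, ← map_mul, KKi, map_one]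
    exact left_inv_eq_right_inv h1 h2
  apply Borel.hom_ext _ _ hK hKi
  · have h := hL 0 2
    simp only [Borel.L, Lmat, Matrix.of_apply, Matrix.cons_val, map_add, map_sub, map_neg,
      map_smul, map_pow, hK, hKi, add_left_inj, neg_inj] at h
    exact smul_right_injective B hp h
  · have h := hL 0 1
    simp only [Borel.L, Lmat, Matrix.of_apply, Matrix.cons_val, map_smul, map_mul, hK] at h
    have h' := smul_right_injective B hp h
    have h1 : ψ (Borel.Ki p) * ψ (Borel.K p) = 1 := by rw [← map_mul, KiK, map_one]
    have h2 := congrArg (ψ (Borel.Ki p) * ·) h'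
    simpa only [← mul_assoc, h1, one_mul] using h2

theorem Borel.comul_L (hp : p ≠ 0) (i j : Fin 3) : Borel.comul hp (Borel.L p i j) =
    ∑ k, (Borel.L p i k ᵍ⊗ₜ[ℂ] Borel.L p k j : Borel.grading p ᵍ⊗[ℂ] Borel.grading p) := by
  obtain ⟨k1, k2, k3, k4, k5, k6, k7, c1, c2, c3, c4, c5⟩ := (Borel.isBorel p).rewriting
  have KKi := (Borel.isBorel p).KKi
  have KiK := (Borel.isBorel p).KiK
  have one_def : (1 : Borel.grading p ᵍ⊗[ℂ] Borel.grading p) = 1 ᵍ⊗ₜ[ℂ] 1 := rfl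
  have mK := Borel.tmul_mul_tmul_of_even (Borel.parity_K (p := p))
  have mKi := Borel.tmul_mul_tmul_of_even (Borel.parity_Ki (p := p))
  fin_cases i <;> fin_cases j <;>
  simp only [Fin.sum_univ_three, Borel.L, Lmat, Matrix.of_apply, Matrix.cons_val, Fin.isValue,
    Fin.zero_eta, Fin.mk_one, Fin.reduceFinMk, map_zero, map_one, map_add, map_sub, map_neg,
    map_mul, map_smul, map_pow, Borel.comul_H, Borel.comul_E, Borel.comul_K, Borel.comul_Ki,
    Borel.T, Borel.Ti, pow_two, mul_add, mK, mKi] <;>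
  simp only [one_def, mul_assoc, smul_add, smul_sub, smul_neg, smul_smul, k1, k2, k3, k4, k5, k6,
    KKi, KiK, GradedTensorProduct.tmul, TensorProduct.add_tmul, TensorProduct.tmul_add,
    TensorProduct.sub_tmul, TensorProduct.tmul_sub, TensorProduct.neg_tmul, TensorProduct.tmul_neg,
    TensorProduct.tmul_zero, TensorProduct.zero_tmul, map_zero, zero_add, add_zero,
    TensorProduct.tmul_smul, ← TensorProduct.smul_tmul', map_smul, map_sub, map_add, map_neg] <;>
  first
  | done
  | module

theorem Borel.antipode_L (hp : p ≠ 0) : (Borel.L p).map (Borel.antipode hp)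
    = LmatInv p (Borel.H p) (Borel.E p) (Borel.K p) (Borel.Ki p) := by
  obtain ⟨k1, k2, k3, k4, k5, k6, k7, c1, c2, c3, c4, c5⟩ := (Borel.isBorel p).rewriting
  ext i j
  fin_cases i <;> fin_cases j <;>
  simp only [Borel.L, Lmat, LmatInv, Matrix.map_apply, Matrix.of_apply, Matrix.cons_val,
    Fin.isValue, Fin.zero_eta, Fin.mk_one, Fin.reduceFinMk, map_zero, map_add, map_sub, map_neg,
    map_smul, pow_two, Borel.antipode_K_mul, Borel.antipode_Ki_mul, Borel.antipode_H,
    Borel.antipode_E, Borel.antipode_K, Borel.antipode_Ki, Borel.antipode_one, neg_mul, k3, k4,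
    k7, smul_add, smul_sub, smul_neg, smul_smul, neg_neg]
  match_scalars <;> field_simp <;> ring

/-- The Hopf superalgebra structure of the Borel algebra. -/
def Borel.hopf (hp : p ≠ 0) : HopfSuper (Borel.grading p) where
  comul := Borel.comul hp
  counit := Borel.counit p
  antipode := Borel.antipode hp
  Δ := Borel.comulLin hp
  Δ_def := rfl
  comul_even i _ hx := Borel.comulLin_mem_grading hp i hx
  counit_even x hx := by
    have h := Borel.counit_parity x
    rw [Borel.mem_grading_one.1 hx, map_neg] at h
    exact self_eq_neg.1 h.symm
  antipode_even _ _ hx := Borel.antipode_mem_grading hp hx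
  coassoc := Borel.comulLin_coassoc hp
  counit_left := Borel.rTensor_counit_comulLin hp
  counit_right := Borel.lTensor_counit_comulLin hp
  antipode_left := Borel.antipode_rTensor_comulLin hp
  antipode_right := Borel.antipode_lTensor_comulLin hp

theorem Borel.counit_L (p : ℂ) : (Borel.L p).map (Borel.counit p) = 1 := by
  ext i j
  fin_cases i <;> fin_cases j <;>
  simp [Borel.L, Lmat, Borel.counit_H, Borel.counit_E, Borel.counit_K, Borel.counit_Ki]

theorem Borel.isFRT_hopf (hp : p ≠ 0) : IsFRT p (Borel.hopf hp) where
  comul_L := Borel.comul_L hp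
  comul_K := Borel.comul_K hp
  counit_L := Borel.counit_L p
  antipode_L_mul := by
    change (Borel.L p).map (Borel.antipode hp) * _ = 1
    rw [Borel.antipode_L]
    exact LmatInv_mul_Lmat hp (Borel.isBorel p)
  mul_antipode_L := by
    change _ * (Borel.L p).map (Borel.antipode hp) = 1
    rw [Borel.antipode_L]
    exact Lmat_mul_LmatInv hp (Borel.isBorel p)

theorem IsFRT.unique (hp : p ≠ 0) {S S' : HopfSuper (Borel.grading p)} (h : IsFRT p S)
    (h' : IsFRT p S') : S' = S :=
  HopfSuper.eq_of_comul_eq (Borel.hom_ext_L hp (by rw [h.comul_K, h'.comul_K])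
    fun i j => by rw [h.comul_L, h'.comul_L])

theorem Borel.comul_T (hp : p ≠ 0) :
    Borel.comul hp (Borel.T p) = Borel.T p ᵍ⊗ₜ[ℂ] Borel.T p := by
  rw [Borel.T, pow_two, map_mul, Borel.comul_K, Borel.tmul_mul_tmul_of_even Borel.parity_K]

theorem Borel.comul_Ti (hp : p ≠ 0) :
    Borel.comul hp (Borel.Ti p) = Borel.Ti p ᵍ⊗ₜ[ℂ] Borel.Ti p := by
  rw [Borel.Ti, pow_two, map_mul, Borel.comul_Ki, Borel.tmul_mul_tmul_of_even Borel.parity_Ki]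

theorem Borel.counit_T (p : ℂ) : Borel.counit p (Borel.T p) = 1 := by
  rw [Borel.T, map_pow, Borel.counit_K, one_pow]

theorem Borel.counit_Ti (p : ℂ) : Borel.counit p (Borel.Ti p) = 1 := by
  rw [Borel.Ti, map_pow, Borel.counit_Ki, one_pow]

theorem Borel.antipode_T (hp : p ≠ 0) : Borel.antipode hp (Borel.T p) = Borel.Ti p := by
  rw [Borel.T, Borel.Ti, pow_two, pow_two, Borel.antipode_K_mul, Borel.antipode_K]

theorem Borel.antipode_Ti (hp : p ≠ 0) : Borel.antipode hp (Borel.Ti p) = Borel.T p := by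
  rw [Borel.T, Borel.Ti, pow_two, pow_two, Borel.antipode_Ki_mul, Borel.antipode_Ki]

end Uniqueness

end SuperJordanian

end

theorem mainTheorem5 (p : ℂ) :
    -- the classical spin `n / 2` representations, as limits of the `q`-deformed ones
    (∀ n : ℕ, (repOsp n).IsOsp ∧ IsNilpotent (repE n) ∧
      Tendsto (repFq n) (𝓝[≠] 1) (𝓝 (repF n))) ∧
    -- the operators `T̃^α = lim 𝒯_(α)`, with `T̃ - T̃⁻¹ = 2 𝗁 e²`, and `H̃ = √(1 + 𝗁² e⁴) h`
    (∀ n : ℕ,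
      (∀ α : ℂ, Tendsto (fun q => calT n p q α) (𝓝[≠] 1) (𝓝 (unipPow α (tT p (repE n))))) ∧
      Tendsto (fun q => calT n p q 1) (𝓝[≠] 1) (𝓝 (tT p (repE n))) ∧
      Tendsto (fun q => calT n p q (-1)) (𝓝[≠] 1) (𝓝 (tTinv p (repE n))) ∧
      IsNilpotent (tT p (repE n) - 1) ∧
      tT p (repE n) * tTinv p (repE n) = 1 ∧ tTinv p (repE n) * tT p (repE n) = 1 ∧
      unipPow (1 / 2) (tT p (repE n)) ^ 2 = tT p (repE n) ∧
      unipPow (-1 / 2) (tT p (repE n)) ^ 2 = tTinv p (repE n) ∧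
      tT p (repE n) - tTinv p (repE n) = (2 * p) • repE n ^ 2 ∧
      tH p (repE n) (repH n) = unipPow (1 / 2) (1 + p ^ 2 • repE n ^ 4) * repH n) ∧
    -- the limit of the transformed matrix
    (∀ n : ℕ, Tendsto (fun q => RqTransformed n p q) (𝓝[≠] 1) (𝓝 (contR n p))) ∧
    (p ≠ 0 →
      -- the nonlinear map satisfies the super-Jordanian relations and is invertible
      (∀ (A : Type u) [Ring A] [Algebra ℂ A],
        Set.BijOn (contrMap (A := A) p) {g | g.IsOsp ∧ IsNilpotent g.e}
          {G | G.IsJordan p ∧ IsNilpotent G.E ∧ IsNilpotent (G.K - 1)}) ∧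
      -- via this map, the limit is the `L`-operator of `𝒰_𝗁(osp(1|2))`
      (∀ n : ℕ, ∃ φ : Uh p →ₐ[ℂ] Mat n, (Uh.gens p).map φ = contrMap p (repOsp n) ∧
        contR n p = blocks ((Lmat p (Uh.gens p).H (Uh.gens p).E (Uh.gens p).K
          (Uh.gens p).Ki).map φ)) ∧
      -- the Borel algebra is the subalgebra of `𝒰_𝗁(osp(1|2))` generated by `H, E, T^{±1/2}`
      (∃ ι : Borel p →ₐ[ℂ] Uh p, Function.Injective ι ∧
        ι (Borel.H p) = (Uh.gens p).H ∧ ι (Borel.E p) = (Uh.gens p).E ∧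
        ι (Borel.K p) = (Uh.gens p).K ∧ ι (Borel.Ki p) = (Uh.gens p).Ki) ∧
      -- its algebraic relations are the graded `RLL` relations
      RLL p (Borel.L p) ∧
      (∀ (A : Type u) [Ring A] [Algebra ℂ A] (H E T Ti K Ki : A),
        K * Ki = 1 → Ki * K = 1 → T = K ^ 2 → Ti = Ki ^ 2 →
        -- `K = T^{1/2}` commutes with everything that commutes with `T`
        (∀ x, Commute x T → Commute x K) →
        (RLL p (Lmat p H E K Ki) ↔
          H * E - E * H = (1 / 2 : ℂ) • ((T + Ti) * E) ∧
          H * T - T * H = T ^ 2 - 1 ∧ H * Ti - Ti * H = Ti ^ 2 - 1 ∧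
          E ^ 2 = (2 * p)⁻¹ • (T - Ti) ∧ Commute T E) ∧
        (RLL p (Lmat p H E K Ki) ↔
          ∃ φ : Borel p →ₐ[ℂ] A, φ (Borel.H p) = H ∧ φ (Borel.E p) = E ∧
            φ (Borel.K p) = K ∧ φ (Borel.Ki p) = Ki)) ∧
      -- its coalgebraic structure is determined by `Δ(L) = L ⊗̇ L`, `ε(L) = 1`, `S(L) = L⁻¹`
      Borel.L p * LmatInv p (Borel.H p) (Borel.E p) (Borel.K p) (Borel.Ki p) = 1 ∧
      LmatInv p (Borel.H p) (Borel.E p) (Borel.K p) (Borel.Ki p) * Borel.L p = 1 ∧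
      ∃ S : HopfSuper (Borel.grading p), IsFRT p S ∧ (∀ S₂, IsFRT p S₂ → S₂ = S) ∧
        (Borel.L p).map S.antipode
          = LmatInv p (Borel.H p) (Borel.E p) (Borel.K p) (Borel.Ki p) ∧
        S.comul (Borel.H p) = Borel.H p ᵍ⊗ₜ[ℂ] Borel.Ti p + Borel.T p ᵍ⊗ₜ[ℂ] Borel.H p
          + p • ((Borel.E p * Borel.K p) ᵍ⊗ₜ[ℂ] (Borel.E p * Borel.Ki p)) ∧
        S.comul (Borel.E p) = Borel.E p ᵍ⊗ₜ[ℂ] Borel.Ki p + Borel.K p ᵍ⊗ₜ[ℂ] Borel.E p ∧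
        S.comul (Borel.T p) = Borel.T p ᵍ⊗ₜ[ℂ] Borel.T p ∧
        S.comul (Borel.Ti p) = Borel.Ti p ᵍ⊗ₜ[ℂ] Borel.Ti p ∧
        S.counit (Borel.H p) = 0 ∧ S.counit (Borel.E p) = 0 ∧
        S.counit (Borel.T p) = 1 ∧ S.counit (Borel.Ti p) = 1 ∧
        S.antipode (Borel.H p) = -Borel.H p - p • Borel.E p ^ 2 ∧
        S.antipode (Borel.E p) = -Borel.E p ∧
        S.antipode (Borel.T p) = Borel.Ti p ∧ S.antipode (Borel.Ti p) = Borel.T p) := by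
  refine ⟨fun n => ⟨repOsp_isOsp n, isNilpotent_repE n, tendsto_repFq n⟩, fun n => ?_,
    fun n => tendsto_RqTransformed n p, fun hp => ⟨fun A _ _ => contrMap_bijOn hp, fun n => ?_,
      Borel.exists_injective hp, RLL_Lmat_of_isBorel hp (Borel.isBorel p),
      fun A _ _ H E T Ti K Ki h1 h2 hT hTi hc => ?_, Lmat_mul_LmatInv hp (Borel.isBorel p),
      LmatInv_mul_Lmat hp (Borel.isBorel p), ?_⟩⟩
  · have he := isNilpotent_repE n
    have hT := isNilpotent_tT_sub_one p he
    exact ⟨tendsto_calT n p, tendsto_calT_one n p, tendsto_calT_neg_one n p, hT, tT_mul_tTinv p he,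
      tTinv_mul_tT p he, unipPow_half_sq hT, unipPow_neg_half_sq hT (tTinv_mul_tT p he),
      tT_sub_tTinv p, by rw [tH_eq p he, unipPow_half_one_add p he]⟩
  · have hJ := contrMap_isJordan hp (repOsp_isOsp n) (isNilpotent_repE n)
    exact ⟨Uh.lift hJ, Uh.map_lift hJ, contrBlocks_eq_map n _ (Uh.map_lift hJ)⟩
  · subst hT hTi
    exact ⟨RLL_Lmat_iff_relations hp h1 h2 hc,
      (RLL_Lmat_iff_isBorel hp h1 h2 hc).trans exists_hom_iff_isBorel.symm⟩
  · exact ⟨Borel.hopf hp, Borel.isFRT_hopf hp, fun _ h => (Borel.isFRT_hopf hp).unique hp h,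
      Borel.antipode_L hp, Borel.comul_H hp, Borel.comul_E hp, Borel.comul_T hp, Borel.comul_Ti hp,
      Borel.counit_H, Borel.counit_E, Borel.counit_T p, Borel.counit_Ti p, Borel.antipode_H hp,
      Borel.antipode_E hp, Borel.antipode_T hp, Borel.antipode_Ti hp⟩
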